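/- **Conventions.** $\pi_0$ denotes the set of path components. In $\pi_1$ the product $a\cdot b$ is "first $a$, then $b$". For a continuous map $f:X\to Y$, $\Gamma f$ is the space of continuous sections of $f$ with the compact-open topology. **(1) Maps to $[0,1]$.** Let $X$ be a compact cobordism of manifolds with boundary: a compact smooth $(d+1)$-manifold with corners of codimension at most $2$ whose boundary is a union $\partial X=X_-\cup B\cup X_+$ of closed smooth faces ($d$-manifolds with boundary), with $X_-\cap X_+=\emptyset$, $\partial X_\pm=X_\pm\cap B$ and $\partial B=\partial X_-\sqcup\partial X_+$. Let $f:X\to[0,1]$ be tame: $f$ is smooth, $df\neq 0$ everywhere, $X_-=f^{-1}(0)$, $X_+=f^{-1}(1)$, and the critical points of $f|_B$ are isolated and have distinct critical values, which lie in $(0,1)$. Then $f|_B$ has only finitely many critical points $p_1,\dots,p_n$. Let $t_i=f(p_i)$, $t_1<\dots<t_n$, and choose any levels $$0=s_0<t_1<s_1<t_2<\dots<t_n<s_n=1$$ (if $n=0$, the only level is $s_0=0$). Set $X_i=f^{-1}(s_i)$ for $0\le i\le n$ and $X_i^{i+1}=f^{-1}([s_i,s_{i+1}])$ for $0\le i\le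 n-1$. Let $\eta$ be an outward pointing vector at the critical point $p_{i+1}\in X_i^{i+1}$; put $(\partial^+(i),\partial^-(i))=(i,i+1)$ if $df(\eta)>0$ and $(\partial^+(i),\partial^-(i))=(i+1,i)$ if $df(\eta)<0$. For every $i$ there is a continuous $H_i:X_i^{i+1}\times[0,s_{i+1}-s_i]\to X_i^{i+1}$ with $H_i(x,0)=x$; with $H_i(x,t)=x$ for $x\in X_{\partial^+(i)}$; with $f(H_i(x,t))=\max\{s_i,f(x)-t\}$ if $\partial^+(i)=i$ and $f(H_i(x,t))=\min\{s_{i+1},f(x)+t\}$ if $\partial^+(i)=i+1$; and with $H_i(H_i(x,t),u)=H_i(x,t+u)$. For any choice of such $H_i$, let $C_i=H_i(\cdot,s_{i+1}-s_i):X_i^{i+1}\to X_{\partial^+(i)}$ and $\beta_i=C_i|_{X_{\partial^-(i)}}:X_{\partial^-(i)}\to X_{\partial^+(i)}$, and let $\varprojlim\pi_0(ZX)$ be the set of all $\Psi=(\Psi_i)\in\prod_{i=0}^n\pi_0(X_i)$ with $(\beta_i)_*\Psi_{\partial^-(i)}=\Psi_{\partial^+(i)}$ for $0\le i\le n-1$.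 Then $[\delta]\mapsto([\delta(s_i)])_{i}$ is a well-defined surjection $$\Pi_0:\pi_0(\Gamma f)\to\varprojlim\pi_0(ZX).$$ Let $\Psi\in\varprojlim\pi_0(ZX)$ and let $\mathfrak b\in\Gamma f$ with $\Pi_0([\mathfrak b])=\Psi$. Take collapse maps $C_i$ as above, for any (possibly different) choice of the $H_i$. For $j\in\{i,i+1\}$ let $\sigma_{i,j}$ be the path $C_i\circ\mathfrak b$ in $X_{\partial^+(i)}$, run from $C_i(\mathfrak b(s_j))$ to $C_i(\mathfrak b(s_{\partial^+(i)}))=\mathfrak b(s_{\partial^+(i)})$ (it is constant if $H_i$ preserves the image of $\mathfrak b$), and let $$C_i:\pi_1(X_j,\mathfrak b(s_j))\to\pi_1(X_{\partial^+(i)},\mathfrak b(s_{\partial^+(i)})),\qquad [\gamma]\mapsto[\sigma_{i,j}^{-1}\cdot(C_i\circ\gamma)\cdot\sigma_{i,j}].$$ The group $\prod_{i=0}^n\pi_1(X_i,\mathfrak b(s_i))$ acts on the set $\prod_{i=0}^{n-1}\pi_1(X_{\partial^+(i)},\mathfrak b(s_{\partial^+(i)}))$ by $$(\tau\,\hat\star\,\eta)_i=C_i(\tau_i)\cdot\eta_i\cdot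 C_i(\tau_{i+1})^{-1}.$$ There is exactly one bijection from the set of orbits of $\hat\star$ to the fibre $\Pi_0^{-1}(\Psi)$ that, for every $\delta\in\Gamma f$ with $\delta(s_i)=\mathfrak b(s_i)$ for all $i$, sends the orbit of $\big([\sigma_{i,i}^{-1}\cdot(C_i\circ\delta|_{[s_i,s_{i+1}]})\cdot\sigma_{i,i+1}]\big)_{0\le i\le n-1}$ to $[\delta]$. **(2) Maps to $S^1$.** Let $X$ be a compact smooth $(d+1)$-manifold with boundary and $f:X\to S^1$ a smooth submersion such that the critical points of $f|_{\partial X}$ are isolated and have distinct critical values. Suppose that $f|_{\partial X}$ has at least one critical point; then it has finitely many, and they can be written $p_1,\dots,p_n$ with $f(p_i)=e^{2\pi\sqrt{-1}\,t_i}$ and interleaving real numbers $$s_0<t_1<s_1<\dots<t_n<s_n=s_0+1 .$$ Given any such choice, replace $f$ by the projection to $\mathbb R$ of the pullback $\{(x,t)\in X\times\mathbb R: f(x)=e^{2\pi\sqrt{-1}\,t}\}$ in the definition of $X_i$, $X_i^{i+1}$, $H_i$, $C_i$, $\beta_i$ (so $X_i$ is the fibre of $f$ over $e^{2\pi\sqrt{-1}\,s_i}$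 and $X_0$ is identified with $X_n$ by $(x,s_0)\mapsto(x,s_0+1)$), let $\partial^\pm(i)$ be determined by the sign of $df(\eta)$ with respect to the counterclockwise orientation of $S^1$, and regard sections of $f$ as sections of the pullback over $[s_0,s_n]$. Then all statements of (1) hold, where $\varprojlim\pi_0(ZX)$ now consists of those families that satisfy in addition $\Psi_0=\Psi_n$ under $X_0=X_n$, and the acting group is the subgroup of all $\tau\in\prod_{i=0}^n\pi_1(X_i,\mathfrak b(s_i))$ with $\tau_0=\tau_n$ under $X_0=X_n$. -/

import Mathlib

open Set Topology
open scoped Manifold ContDiff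

noncomputable section

/-! ### Topology of a space over the real line: fibres, slabs, sections, collapse maps -/

namespace SectionSpace

/-- The fundamental group with multiplication "first `a`, then `b`" (Mathlib's multiplication on
`FundamentalGroup` concatenates in the opposite order). -/
abbrev Pi1 (A : Type*) [TopologicalSpace A] (x : A) : Type _ := (FundamentalGroup A x)ᵐᵒᵖ

/-- The map on `π₀` induced by a continuous map. -/
def pi0Map {A B : Type*} [TopologicalSpace A] [TopologicalSpace B] (φ : C(A, B)) :
    ZerothHomotopy A → ZerothHomotopy B :=
  ZerothHomotopy.lift (fun x => .mk (φ x)) fun _ _ p => ZerothHomotopy.sound (p.map φ.continuous)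

section Levels

variable {Y : Type*} [TopologicalSpace Y] (g : Y → ℝ)

/-- The level set `g⁻¹(s)`. -/
abbrev Fibre (s : ℝ) : Type _ := {y : Y // g y = s}

/-- The slab `g⁻¹([a,b])`. -/
abbrev Slab (a b : ℝ) : Type _ := {y : Y // g y ∈ Icc a b}

/-- Continuous sections of `g` over `J ⊆ ℝ`, with the compact-open topology. -/
abbrev Sec (J : Set ℝ) : Type _ := {δ : C(J, Y) // ∀ t, g (δ t) = t}

/-- A deformation retraction of the slab `g⁻¹([a,b])` onto its level set `g⁻¹(c)` that moves the
level sets at constant unit speed towards level `c`, where they stop. It is used for `c = a`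
(speed `-1`) and `c = b` (speed `+1`). -/
structure FibrewiseRetraction (a b c : ℝ) where
  H : C(Slab g a b × Icc (0 : ℝ) (b - a), Slab g a b)
  map_zero : ∀ (x) (t : Icc (0 : ℝ) (b - a)), (t : ℝ) = 0 → H (x, t) = x
  map_fixed : ∀ x t, g x.1 = c → H (x, t) = x
  speed_down : ∀ x t, c ≤ g x.1 → g (H (x, t)).1 = max c (g x.1 - t)
  speed_up : ∀ x t, g x.1 ≤ c → g (H (x, t)).1 = min c (g x.1 + t)
  semigroup : ∀ (x) (t u v : Icc (0 : ℝ) (b - a)), (v : ℝ) = t + u → H (H (x, t), u) = H (x, v)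

variable {g}

/-- The inclusion of a level set into a slab. -/
def inclusion {a b s : ℝ} (h : s ∈ Icc a b) : C(Fibre g s, Slab g a b) where
  toFun y := ⟨y.1, y.2.symm ▸ h⟩
  continuous_toFun := by fun_prop

/-- The collapse map `H(-, b - a)` of the slab onto the level set `g⁻¹(c)`. -/
def FibrewiseRetraction.collapse {a b c : ℝ} (R : FibrewiseRetraction g a b c)
    (hc : c ∈ Icc a b) : C(Slab g a b, Fibre g c) where
  toFun x := ⟨(R.H (x, ⟨b - a, sub_nonneg.2 (hc.1.trans hc.2), le_rfl⟩)).1, by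
    have hx := x.2
    rcases le_total c (g x.1) with h | h
    · rw [R.speed_down _ _ h]
      exact max_eq_left (by linarith [hx.2, hc.1])
    · rw [R.speed_up _ _ h]
      exact min_eq_left (by linarith [hx.1, hc.2])⟩
  continuous_toFun := by fun_prop

theorem FibrewiseRetraction.collapse_inclusion {a b c : ℝ} (R : FibrewiseRetraction g a b c)
    (hc : c ∈ Icc a b) (y : Fibre g c) : R.collapse hc (inclusion hc y) = y := by
  have h := R.map_fixed (inclusion hc y) ⟨b - a, sub_nonneg.2 (hc.1.trans hc.2), le_rfl⟩ y.2
  exact Subtype.ext (congrArg (fun z : Slab g a b => z.1) h :)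

end Levels

/-- Levels `s₀ < s₁ < ⋯ < sₙ`, together with a mark on each interval `[sᵢ, sᵢ₊₁]` recording whether
it is of type D (otherwise it is of type N). -/
structure Levels (n : ℕ) where
  s : Fin (n + 1) → ℝ
  strictMono : StrictMono s
  D : Fin n → Prop

namespace Levels

variable {n : ℕ} (L : Levels n)

open Classical in
/-- `∂⁺(i)`. -/
def plus (i : Fin n) : Fin (n + 1) := if L.D i then i.castSucc else i.succ

open Classical in
/-- `∂⁻(i)`. -/
def minus (i : Fin n) : Fin (n + 1) := if L.D i then i.succ else i.castSucc

/-- The interval `[sᵢ, sᵢ₊₁]`. -/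
abbrev interval (i : Fin n) : Set ℝ := Icc (L.s i.castSucc) (L.s i.succ)

theorem left_mem (i : Fin n) : L.s i.castSucc ∈ L.interval i :=
  ⟨le_rfl, (L.strictMono (Fin.castSucc_lt_succ (i := i))).le⟩

theorem right_mem (i : Fin n) : L.s i.succ ∈ L.interval i :=
  ⟨(L.strictMono (Fin.castSucc_lt_succ (i := i))).le, le_rfl⟩

theorem plus_mem (i : Fin n) : L.s (L.plus i) ∈ L.interval i := by
  unfold plus; split_ifs
  exacts [L.left_mem i, L.right_mem i]

theorem minus_mem (i : Fin n) : L.s (L.minus i) ∈ L.interval i := by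
  unfold minus; split_ifs
  exacts [L.right_mem i, L.left_mem i]

theorem mem (j : Fin (n + 1)) : L.s j ∈ Icc (L.s 0) (L.s (Fin.last n)) :=
  ⟨L.strictMono.monotone (Fin.zero_le j), L.strictMono.monotone (Fin.le_last j)⟩

theorem interval_subset (i : Fin n) : L.interval i ⊆ Icc (L.s 0) (L.s (Fin.last n)) :=
  Icc_subset_Icc (L.mem _).1 (L.mem _).2

variable {Y : Type*} [TopologicalSpace Y] (g : Y → ℝ)

/-- The regular fibre `Xᵢ`. -/
abbrev X (j : Fin (n + 1)) : Type _ := Fibre g (L.s j)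

/-- The regular cobordism `Xᵢ^{i+1}`. -/
abbrev W (i : Fin n) : Type _ := Slab g (L.s i.castSucc) (L.s i.succ)

/-- A choice, for each `i`, of a fibrewise deformation retraction of `Xᵢ^{i+1}` onto
`X_{∂⁺(i)}`. -/
abbrev Retractions : Type _ :=
  ∀ i : Fin n, FibrewiseRetraction g (L.s i.castSucc) (L.s i.succ) (L.s (L.plus i))

variable {L g}

/-- The collapse map `Cᵢ : Xᵢ^{i+1} → X_{∂⁺(i)}`. -/
def collapse (R : L.Retractions g) (i : Fin n) : C(L.W g i, L.X g (L.plus i)) :=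
  (R i).collapse (L.plus_mem i)

/-- `β_{i,i+1} : X_{∂⁻(i)} → X_{∂⁺(i)}`. -/
def beta (R : L.Retractions g) (i : Fin n) : C(L.X g (L.minus i), L.X g (L.plus i)) :=
  (collapse R i).comp (inclusion (L.minus_mem i))

/-- The inverse limit of `π₀(X₀) ↔ π₀(X₁) ↔ ⋯ ↔ π₀(Xₙ)`. -/
def limit (R : L.Retractions g) : Set (∀ j, ZerothHomotopy (L.X g j)) :=
  {Ψ | ∀ i, pi0Map (beta R i) (Ψ (L.minus i)) = Ψ (L.plus i)}

variable {J : Set ℝ} (hJ : Icc (L.s 0) (L.s (Fin.last n)) ⊆ J)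

/-- The evaluation `δ ↦ δ(sⱼ) ∈ Xⱼ`. -/
def eval (j : Fin (n + 1)) : C(Sec g J, L.X g j) where
  toFun δ := ⟨δ.1 ⟨L.s j, hJ (L.mem j)⟩, δ.2 _⟩
  continuous_toFun := by fun_prop

/-- The part of a section between the levels `sⱼ` and `sₖ` of `[sᵢ, sᵢ₊₁]` (in either order), as a
path in `Xᵢ^{i+1}`. -/
def arc (δ : Sec g J) (i : Fin n) {j k : Fin (n + 1)} (hj : L.s j ∈ L.interval i)
    (hk : L.s k ∈ L.interval i) :
    Path (inclusion (g := g) hj (eval hJ j δ)) (inclusion hk (eval hJ k δ)) where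
  toFun t := ⟨δ.1 ⟨AffineMap.lineMap (L.s j) (L.s k) (t : ℝ),
      hJ (L.interval_subset i ((convex_Icc _ _).lineMap_mem hj hk t.2))⟩, by
    rw [δ.2]; exact (convex_Icc _ _).lineMap_mem hj hk t.2⟩
  continuous_toFun := by
    refine Continuous.subtype_mk (δ.1.continuous.comp (Continuous.subtype_mk ?_ _)) _
    exact AffineMap.lineMap_continuous.comp continuous_subtype_val
  source' := by simp [inclusion, eval]
  target' := by simp [inclusion, eval]

/-- The path traced in `X_{∂⁺(i)}` by the collapsed base section, from `Cᵢ(𝔟(sⱼ))` to the base point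
`𝔟(s_{∂⁺(i)})`. It is constant when the retraction preserves the image of `𝔟`. -/
def tether (R : L.Retractions g) (b : Sec g J) (i : Fin n) {j : Fin (n + 1)}
    (hj : L.s j ∈ L.interval i) :
    Path (collapse R i (inclusion hj (eval hJ j b))) (eval hJ (L.plus i) b) :=
  ((arc hJ b i hj (L.plus_mem i)).map (collapse R i).continuous).cast rfl
    ((R i).collapse_inclusion (L.plus_mem i) _).symm

/-- The homomorphism `π₁(Xⱼ, 𝔟(sⱼ)) → π₁(X_{∂⁺(i)}, 𝔟(s_{∂⁺(i)}))` induced by the collapse map `Cᵢ`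
(`j = i` or `j = i + 1`), with base points moved along the collapsed base section. -/
def loopCollapse (R : L.Retractions g) (b : Sec g J) (i : Fin n) {j : Fin (n + 1)}
    (hj : L.s j ∈ L.interval i) :
    Pi1 (L.X g j) (eval hJ j b) →* Pi1 (L.X g (L.plus i)) (eval hJ (L.plus i) b) :=
  MonoidHom.op
    ((FundamentalGroup.fundamentalGroupMulEquivOfPath (tether hJ R b i hj)).toMonoidHom.comp
      (FundamentalGroup.map ((collapse R i).comp (inclusion hj)) (eval hJ j b)))

/-- The group `∏ⱼ π₁(Xⱼ, 𝔟(sⱼ))`. -/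
abbrev LoopGroup (b : Sec g J) : Type _ := ∀ j, Pi1 (L.X g j) (eval (L := L) hJ j b)

/-- The set `∏ᵢ π₁(X_{∂⁺(i)}, 𝔟(s_{∂⁺(i)}))`, on which the choice of collapse maps `R` induces an
action. -/
def Labels (_R : L.Retractions g) (b : Sec g J) : Type _ :=
  ∀ i, Pi1 (L.X g (L.plus i)) (eval hJ (L.plus i) b)

/-- The action
`(τ ⋆ η)ᵢ = Cᵢ(τᵢ) · ηᵢ · Cᵢ(τᵢ₊₁)⁻¹`. -/
instance (R : L.Retractions g) (b : Sec g J) : MulAction (LoopGroup hJ b) (Labels hJ R b) where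
  smul τ η := fun i => loopCollapse hJ R b i (L.left_mem i) (τ i.castSucc) * η i *
    (loopCollapse hJ R b i (L.right_mem i) (τ i.succ))⁻¹
  one_smul η := by
    funext i
    change loopCollapse hJ R b i (L.left_mem i) 1 * η i *
      (loopCollapse hJ R b i (L.right_mem i) 1)⁻¹ = η i
    simp only [map_one, inv_one, one_mul, mul_one]
  mul_smul τ σ η := by
    funext i
    change loopCollapse hJ R b i (L.left_mem i) (τ i.castSucc * σ i.castSucc) * η i *
      (loopCollapse hJ R b i (L.right_mem i) (τ i.succ * σ i.succ))⁻¹ =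
      loopCollapse hJ R b i (L.left_mem i) (τ i.castSucc) *
        (loopCollapse hJ R b i (L.left_mem i) (σ i.castSucc) * η i *
          (loopCollapse hJ R b i (L.right_mem i) (σ i.succ))⁻¹) *
        (loopCollapse hJ R b i (L.right_mem i) (τ i.succ))⁻¹
    simp only [map_mul, mul_inv_rev, mul_assoc]

/-- The section collapse map: a section `δ` with `δ(sⱼ) = 𝔟(sⱼ)` for all `j` is sent to the classes
of the loops `Cᵢ ∘ δ|[sᵢ, sᵢ₊₁]`, with base points moved along the collapsed base section. -/
def sectionCollapse (R : L.Retractions g) (b δ : Sec g J)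
    (h : ∀ j, eval (L := L) hJ j δ = eval hJ j b) : Labels hJ R b := fun i =>
  MulOpposite.op <| FundamentalGroup.fromPath <| Path.Homotopic.Quotient.mk <|
    ((tether hJ R b i (L.left_mem i)).symm.trans
      (((arc hJ δ i (L.left_mem i) (L.right_mem i)).map (collapse R i).continuous).cast
        (by rw [h]) (by rw [h]))).trans
      (tether hJ R b i (L.right_mem i))

end Levels

/-! ### Boundary faces, critical points on faces and their types -/

section Faces

variable {m : ℕ} {H : Type*} [TopologicalSpace H]
  (I : ModelWithCorners ℝ (EuclideanSpace ℝ (Fin m)) H)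
  {X : Type*} [TopologicalSpace X] [ChartedSpace H X]

/-- `φ` is a smooth chart around `p` in which the subset `S` of the boundary is the
coordinate hyperplane face `{xᵢ = 0}`. -/
def IsFaceChart (S : Set X) (p : X) (φ : OpenPartialHomeomorph X H) (i : Fin m) : Prop :=
  φ ∈ IsManifold.maximalAtlas I ∞ X ∧ p ∈ φ.source ∧ ∀ y ∈ φ.source, y ∈ S ↔ φ.extend I y i = 0

/-- `S` is a closed face of `X`, that is, a closed subset which is locally a coordinate hyperplane
face `{xᵢ = 0}`. -/
def IsFace (S : Set X) : Prop :=
  IsClosed S ∧ ∀ p ∈ S, ∃ φ i, IsFaceChart I S p φ i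

/-- The `i`-th coordinate of the tangent vector `v` in the chart `φ`. -/
def tangentCoord (φ : OpenPartialHomeomorph X H) (i : Fin m) (p : X) (v : TangentSpace I p) : ℝ :=
  let w : EuclideanSpace ℝ (Fin m) := mfderiv I 𝓘(ℝ, EuclideanSpace ℝ (Fin m)) (φ.extend I) p v
  w i

/-- `v ∈ T_pX` is tangent to the face `S`. -/
def IsTangentTo (S : Set X) (p : X) (v : TangentSpace I p) : Prop :=
  ∃ φ i, IsFaceChart I S p φ i ∧ tangentCoord I φ i p v = 0

/-- `v ∈ T_pX` points outward through the face `S`. -/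
def IsOutward (S : Set X) (p : X) (v : TangentSpace I p) : Prop :=
  ∃ φ i, IsFaceChart I S p φ i ∧ tangentCoord I φ i p v < 0

/-- The critical points of `f|_S : S → N`, for a map to a one-dimensional manifold `N`: the
differential of `f` vanishes on `T_pS`. -/
def criticalPoints {E' : Type*} [NormedAddCommGroup E'] [NormedSpace ℝ E'] {H' : Type*}
    [TopologicalSpace H'] (I' : ModelWithCorners ℝ E' H') {N : Type*} [TopologicalSpace N]
    [ChartedSpace H' N] (f : X → N) (S : Set X) : Set X :=
  {p | p ∈ S ∧ ∀ v : TangentSpace I p, IsTangentTo I S p v → mfderiv I I' f p v = 0}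

/-- All points of `A` are isolated in `A`. -/
def HasIsolatedPoints (A : Set X) : Prop := ∀ p ∈ A, ∃ U ∈ 𝓝 p, U ∩ A = {p}

end Faces

/-! ### Tame functions on cobordisms of manifolds with boundary -/

section Cobordism

/-- The model `[0,∞)^m ⊆ ℝ^m` of manifolds with corners. -/
abbrev Corners (m : ℕ) : ModelWithCorners ℝ (EuclideanSpace ℝ (Fin m)) (EuclideanQuadrant m) :=
  modelWithCornersEuclideanQuadrant m

variable (d : ℕ) (X : Type*) [TopologicalSpace X] [ChartedSpace (EuclideanQuadrant (d + 1)) X]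

variable {X} in
/-- The index `k` of the stratum `∂ₖX` containing `x`. -/
def depth (x : X) : ℕ := {i | extChartAt (Corners (d + 1)) x x i = 0}.ncard

variable {X} in
/-- The boundary `∂S` of a face `S` of a manifold with corners without strata `∂ₖX`, `k > 2`. -/
def faceBoundary (S : Set X) : Set X := {x | x ∈ S ∧ depth d x = 2}

/-- The structure of a cobordism of manifolds with boundary on the `(d+1)`-dimensional manifold with
corners `X`: a decomposition `∂X = X₋ ∪ B ∪ X₊`. -/
structure BoundaryCobordism where
  bottom : Set X
  side : Set X
  top : Set X
  depth_le_two : ∀ x : X, depth d x ≤ 2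
  boundary_eq : (Corners (d + 1)).boundary X = bottom ∪ side ∪ top
  isFace_bottom : IsFace (Corners (d + 1)) bottom
  isFace_side : IsFace (Corners (d + 1)) side
  isFace_top : IsFace (Corners (d + 1)) top
  bottom_inter_top : bottom ∩ top = ∅
  boundary_bottom : faceBoundary d bottom = bottom ∩ side
  boundary_top : faceBoundary d top = top ∩ side
  boundary_side : faceBoundary d side = faceBoundary d bottom ∪ faceBoundary d top

variable {d X}

/-- The critical points of the restriction of `f` to `B`. -/
def BoundaryCobordism.crit (W : BoundaryCobordism d X) (f : X → ℝ) : Set X :=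
  criticalPoints (Corners (d + 1)) 𝓘(ℝ, ℝ) f W.side

/-- Tame functions `X → [0,1]`. -/
structure IsTame (W : BoundaryCobordism d X) (f : X → ℝ) : Prop where
  mem_Icc : ∀ x, f x ∈ Icc (0 : ℝ) 1
  smooth : ContMDiff (Corners (d + 1)) 𝓘(ℝ, ℝ) ∞ f
  submersive : ∀ x, Function.Surjective (mfderiv (Corners (d + 1)) 𝓘(ℝ, ℝ) f x)
  bottom_eq : W.bottom = f ⁻¹' {0}
  top_eq : W.top = f ⁻¹' {1}
  isolated : HasIsolatedPoints (W.crit f)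
  injOn : InjOn f (W.crit f)
  crit_mem : ∀ p ∈ W.crit f, f p ∈ Ioo (0 : ℝ) 1

/-- A point `p` of `B` is of type D if `df(η) > 0` for an outward pointing `η ∈ T_pX`. -/
def IsTypeD (W : BoundaryCobordism d X) (f : X → ℝ) (p : X) : Prop :=
  ∃ η : TangentSpace (Corners (d + 1)) p, IsOutward (Corners (d + 1)) W.side p η ∧
    (0 : ℝ) < mfderiv (Corners (d + 1)) 𝓘(ℝ, ℝ) f p η

/-- The critical points `p₁, …, pₙ` of `f|_B`, in the order of their values `tᵢ = f(pᵢ)`, with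
interleaving levels `0 = s₀ < t₁ < s₁ < ⋯ < tₙ < sₙ = 1`. If there is no critical point, then the
only level is `s₀ = 0`. -/
structure Subdivision (W : BoundaryCobordism d X) (f : X → ℝ) (n : ℕ) where
  p : Fin n → X
  range_p : range p = W.crit f
  s : Fin (n + 1) → ℝ
  s_zero : s 0 = 0
  s_last : 0 < n → s (Fin.last n) = 1
  left_lt : ∀ i, s i.castSucc < f (p i)
  lt_right : ∀ i, f (p i) < s i.succ

namespace Subdivision

variable {W : BoundaryCobordism d X} {f : X → ℝ} {n : ℕ} (S : Subdivision W f n)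

/-- The levels `sᵢ`, with the types of the critical points between them. -/
def levels : Levels n where
  s := S.s
  strictMono := Fin.strictMono_iff_lt_succ.2 fun i => (S.left_lt i).trans (S.lt_right i)
  D i := IsTypeD W f (S.p i)

theorem subset : Icc (S.levels.s 0) (S.levels.s (Fin.last n)) ⊆ Icc (0 : ℝ) 1 := by
  refine Icc_subset_Icc S.s_zero.ge ?_
  change S.s (Fin.last n) ≤ 1
  rcases Nat.eq_zero_or_pos n with rfl | h
  · exact S.s_zero.le.trans zero_le_one
  · exact (S.s_last h).le

/-- The map `Π₀ : π₀(Γf) → ∏ⱼ π₀(Xⱼ)`, `[δ] ↦ ([δ(sⱼ)])ⱼ`. -/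
def Pi0 (c : ZerothHomotopy (Sec f (Icc 0 1))) (j : Fin (n + 1)) :
    ZerothHomotopy (S.levels.X f j) :=
  pi0Map (Levels.eval S.subset j) c

end Subdivision

end Cobordism

/-! ### Maps to the circle -/

section CircleValued

/-- The universal covering `ℝ → S¹`, `t ↦ exp(2πit)`. -/
def circleMap (t : ℝ) : Circle := Circle.exp (2 * Real.pi * t)

theorem continuous_circleMap : Continuous circleMap := by
  unfold circleMap; fun_prop

theorem circleMap_add_one (t : ℝ) : circleMap (t + 1) = circleMap t := by
  unfold circleMap
  rw [mul_add, mul_one]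
  exact Circle.periodic_exp _

variable {X : Type*} [TopologicalSpace X]

/-- Sections of `f : X → S¹`, with the compact-open topology. -/
abbrev CircleSec (f : X → Circle) : Type _ := {δ : C(Circle, X) // ∀ z, f (δ z) = z}

/-- The pullback `X ×_{S¹} ℝ`. Its slab over `[sᵢ, sᵢ₊₁]` is the cobordism `Xᵢ^{i+1}`, cut
open along the fibre over `sᵢ` if `sᵢ₊₁ = sᵢ + 1`. -/
abbrev Pullback (f : X → Circle) : Type _ := {q : X × ℝ // f q.1 = circleMap q.2}

/-- The projection of the pullback to `ℝ`. -/
def height (f : X → Circle) (q : Pullback f) : ℝ := q.1.2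

/-- The identification `(x, a) ↦ (x, a + 1)` of the fibres over `a` and `a + 1`. -/
def shift (f : X → Circle) {a b : ℝ} (h : b = a + 1) :
    C(Fibre (height f) a, Fibre (height f) b) where
  toFun q := ⟨⟨(q.1.1.1, q.1.1.2 + 1), by rw [circleMap_add_one]; exact q.1.2⟩, by
    rw [h]; exact congrArg (· + 1) q.2⟩
  continuous_toFun := by fun_prop

/-- A section of `f` over the circle, as a section of the pullback over `J ⊆ ℝ`. -/
def lift (f : X → Circle) (J : Set ℝ) : C(CircleSec f, Sec (height f) J) where
  toFun δ := ⟨⟨fun t => ⟨(δ.1 (circleMap t), t), δ.2 _⟩, by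
    have := continuous_circleMap
    fun_prop⟩, fun _ => rfl⟩
  continuous_toFun := by
    refine Continuous.subtype_mk (ContinuousMap.continuous_of_continuous_uncurry _ ?_) _
    have h := continuous_circleMap
    refine Continuous.subtype_mk (Continuous.prodMk ?_ (by fun_prop)) _
    exact (continuous_subtype_val.comp continuous_fst).eval
      (h.comp (continuous_subtype_val.comp continuous_snd))

variable {d : ℕ} [ChartedSpace (EuclideanHalfSpace (d + 1)) X]

/-- The critical points of the restriction of `f : X → S¹` to `∂X`. -/
def circleCrit (d : ℕ) [ChartedSpace (EuclideanHalfSpace (d + 1)) X] (f : X → Circle) : Set X :=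
  criticalPoints (𝓡∂ (d + 1)) (𝓡 1) f ((𝓡∂ (d + 1)).boundary X)

/-- The value `f^*dθ(v)` of the pulled back angular form, `dθ = Im(z̄ dz)` on `S¹ ⊆ ℂ`. -/
def angularDeriv (f : X → Circle) (p : X) (v : TangentSpace (𝓡∂ (d + 1)) p) : ℝ :=
  let w : ℂ := mfderiv (𝓡∂ (d + 1)) 𝓘(ℝ, ℂ) (fun x => (f x : ℂ)) p v
  (starRingEnd ℂ (f p : ℂ) * w).im

/-- Submersions `X → S¹` whose restriction to `∂X` has isolated critical points with distinct
critical values. -/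
structure IsCircleTame (d : ℕ) [ChartedSpace (EuclideanHalfSpace (d + 1)) X] (f : X → Circle) :
    Prop where
  smooth : ContMDiff (𝓡∂ (d + 1)) (𝓡 1) ∞ f
  submersive : ∀ x, Function.Surjective (mfderiv (𝓡∂ (d + 1)) (𝓡 1) f x)
  isolated : HasIsolatedPoints (circleCrit d f)
  injOn : InjOn f (circleCrit d f)

/-- A point `p` of `∂X` is of type D if `df(η) > 0` for an outward pointing `η ∈ T_pX`. -/
def IsCircleTypeD (d : ℕ) [ChartedSpace (EuclideanHalfSpace (d + 1)) X] (f : X → Circle)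
    (p : X) : Prop :=
  ∃ η : TangentSpace (𝓡∂ (d + 1)) p,
    IsOutward (𝓡∂ (d + 1)) ((𝓡∂ (d + 1)).boundary X) p η ∧ 0 < angularDeriv f p η

/-- The critical points `p₁, …, pₙ` of `f|_{∂X}`, in the cyclic order of their values
`f(pᵢ) = exp(2πi tᵢ)`, with interleaving levels `s₀ < t₁ < s₁ < ⋯ < tₙ < sₙ = s₀ + 1`. -/
structure CircleSubdivision (d : ℕ) [ChartedSpace (EuclideanHalfSpace (d + 1)) X]
    (f : X → Circle) (n : ℕ) where
  p : Fin n → X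
  range_p : range p = circleCrit d f
  t : Fin n → ℝ
  circleMap_t : ∀ i, circleMap (t i) = f (p i)
  s : Fin (n + 1) → ℝ
  s_last : s (Fin.last n) = s 0 + 1
  left_lt : ∀ i, s i.castSucc < t i
  lt_right : ∀ i, t i < s i.succ

namespace CircleSubdivision

variable {f : X → Circle} {n : ℕ} (S : CircleSubdivision d f n)

/-- The levels `sᵢ`, with the types of the critical points between them. -/
def levels : Levels n where
  s := S.s
  strictMono := Fin.strictMono_iff_lt_succ.2 fun i => (S.left_lt i).trans (S.lt_right i)
  D i := IsCircleTypeD d f (S.p i)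

/-- The interval `[s₀, s₀ + 1]`. -/
abbrev domain : Set ℝ := Icc (S.levels.s 0) (S.levels.s (Fin.last n))

/-- A section over the circle as a section of the pullback over `[s₀, s₀ + 1]`. -/
abbrev cut (δ : CircleSec f) : Sec (height f) S.domain := lift f S.domain δ

/-- The map `Π₀ : π₀(Γf) → ∏ⱼ π₀(Xⱼ)`, `[δ] ↦ ([δ(sⱼ)])ⱼ`. -/
def Pi0 (c : ZerothHomotopy (CircleSec f)) (j : Fin (n + 1)) :
    ZerothHomotopy (S.levels.X (height f) j) :=
  pi0Map ((Levels.eval subset_rfl j).comp (lift f S.domain)) c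

/-- The identification of `X₀` with `Xₙ`. -/
def ident : C(S.levels.X (height f) 0, S.levels.X (height f) (Fin.last n)) :=
  shift f S.s_last

/-- The inverse limit of `π₀(X₀) ↔ π₀(X₁) ↔ ⋯ ↔ π₀(Xₙ) = π₀(X₀)`. -/
def limit (R : S.levels.Retractions (height f)) :
    Set (∀ j, ZerothHomotopy (S.levels.X (height f) j)) :=
  {Ψ | Ψ ∈ Levels.limit R ∧
    pi0Map S.ident (Ψ 0) = Ψ (Fin.last n)}

theorem ident_eval (b : CircleSec f) :
    S.ident (Levels.eval subset_rfl 0 (S.cut b)) =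
      Levels.eval (L := S.levels) subset_rfl (Fin.last n) (S.cut b) := by
  have h : circleMap (S.levels.s 0) = circleMap (S.levels.s (Fin.last n)) := by
    change circleMap (S.s 0) = circleMap (S.s (Fin.last n))
    rw [S.s_last, circleMap_add_one]
  refine Subtype.ext (Subtype.ext (Prod.ext ?_ ?_))
  · exact congrArg b.1 h
  · exact S.s_last.symm

/-- The subgroup of `∏ⱼ π₁(Xⱼ, 𝔟(sⱼ))` given by `τ₀ = τₙ`. -/
def cyclicLoops (b : CircleSec f) :
    Subgroup (Levels.LoopGroup (L := S.levels) subset_rfl (S.cut b)) :=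
  MonoidHom.eqLocus
    ((MonoidHom.op (FundamentalGroup.mapOfEq S.ident (S.ident_eval b))).comp
      (Pi.evalMonoidHom _ 0))
    (Pi.evalMonoidHom _ (Fin.last n))

end CircleSubdivision

end CircleValued

end SectionSpace

end

open SectionSpace

noncomputable section

namespace SectionSpace

section

open scoped unitInterval

/-! ### Path classes -/

section PathClass

variable {A : Type*} [TopologicalSpace A] {x y z w : A}

/-! The geometric input is a vector field along which `f` changes at unit speed, upwards on a slab
of type N and downwards on a slab of type D. Away from the critical points of `f|_B` it can be taken
tangent to `B`. At a critical point `df` vanishes on `T_pB`, so inward vectors transverse to `B` all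
have the same sign of `df`, and the type records in which direction the travel points inward. Hence
the flow keeps the slab inside `X` until the level `∂⁺(i)` is reached, which gives the retractions.
No critical point lies near that end level, so the flow can be reversed there and the slab ends in a
product collar.

Because `X` has boundary and corners, the flow is built in a Euclidean space containing `X`
(`exists_isCollapsing_of_local`). A smooth field on the compact `X` is Lipschitz for the ambient
metric (`exists_norm_sub_le_mul`), so it extends to a bounded Lipschitz field with a global flow,
and Nagumo's subtangency criterion (`forall_mem_of_isSubtangent`) keeps the integral curves in `X`.
A `Clock` treats real and circle valued maps together.

The homotopical input is that over a slab with a `CollaredFlow` a section is, up to homotopy of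
sections with fixed ends, the same as a path in the end fibre between the collapses of its ends. To
realise a path, flow to the collar and follow the path there. To compare two sections, flow up from
them and from the path joining their starting points; this sweeps out a square of sections whose
upper edge is then corrected inside the collar. An arbitrary retraction `C` need not come from a
reversible flow, but the paths `C (F (x, s))` compare it naturally with the end of the flow, so both
statements hold for every choice of collapse maps (`exists_section`, `exists_square`).

Gluing over the levels gives the theorem. Points at the levels extend to a section if and only if
their components are compatible. Every section in the fibre can be moved to one that agrees with `b`
at the levels, every label is realised by such a section, and two of them are joined by a path of
sections exactly if loops `τ` at the levels satisfy `C(τᵢ) · δ' = δ · C(τᵢ₊₁)` on collapsed classes,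
which is the orbit relation. Over the circle the same argument runs on the cut interval, with the
data at level `n` chosen as the transport of those at level `0`, so that everything descends. Over
`[0,1]` without critical points there is no slab, and one global upward flow shows that a section is
determined up to homotopy by the component of its starting point. -/

theorem pathClass_trans_left_cancel {c : Path.Homotopic.Quotient x y}
    {c₁ c₂ : Path.Homotopic.Quotient y z} (h : c.trans c₁ = c.trans c₂) : c₁ = c₂ := by
  have := congrArg (fun e => c.symm.trans e) h
  simpa only [← Path.Homotopic.Quotient.trans_assoc, Path.Homotopic.Quotient.symm_trans,
      Path.Homotopic.Quotient.refl_trans] using this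

theorem pathClass_trans_right_cancel {c : Path.Homotopic.Quotient y z}
    {c₁ c₂ : Path.Homotopic.Quotient x y} (h : c₁.trans c = c₂.trans c) : c₁ = c₂ := by
  have := congrArg (fun e => e.trans c.symm) h
  simpa only [Path.Homotopic.Quotient.trans_assoc, Path.Homotopic.Quotient.trans_symm,
      Path.Homotopic.Quotient.trans_refl] using this

theorem pathClass_symm_symm (c : Path.Homotopic.Quotient x y) : c.symm.symm = c := by
  apply pathClass_trans_left_cancel (c := c.symm)
  rw [Path.Homotopic.Quotient.trans_symm, Path.Homotopic.Quotient.symm_trans]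

/-- A commutative square of path classes, reflected in a vertical axis. -/
theorem pathClass_square_symm {p : Path.Homotopic.Quotient x y} {a' : Path.Homotopic.Quotient y w}
    {a : Path.Homotopic.Quotient x z} {q : Path.Homotopic.Quotient z w}
    (h : p.trans a' = a.trans q) : q.trans a'.symm = a.symm.trans p := by
  apply pathClass_trans_left_cancel (c := a)
  apply pathClass_trans_right_cancel (c := a')
  simp only [Path.Homotopic.Quotient.trans_assoc, Path.Homotopic.Quotient.symm_trans,
    Path.Homotopic.Quotient.trans_refl]
  rw [← Path.Homotopic.Quotient.trans_assoc a, Path.Homotopic.Quotient.trans_symm,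
    Path.Homotopic.Quotient.refl_trans, h]

end PathClass

/-! ### Squares of paths -/

/-- The four edges of a square satisfy the obvious relation in the fundamental groupoid. -/
theorem square_relation {B : Type*} [TopologicalSpace B] (T : I × I → B) (hT : Continuous T)
    {a b c d : B} (bot : Path a b) (right : Path b d) (left : Path a c) (top : Path c d)
    (hb : ∀ r, T (r, 0) = bot r) (hr : ∀ t, T (1, t) = right t)
    (hl : ∀ t, T (0, t) = left t) (ht : ∀ r, T (r, 1) = top r) :
    (Path.Homotopic.Quotient.mk bot).trans (.mk right) = (Path.Homotopic.Quotient.mk left).trans (.mk top) := by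
  obtain rfl : T (0, 0) = a := by rw [hb]; exact bot.source
  obtain rfl : T (1, 0) = b := by rw [hb]; exact bot.target
  obtain rfl : T (0, 1) = c := by rw [hl]; exact left.target
  obtain rfl : T (1, 1) = d := by rw [ht]; exact top.target
  let P₁ : Path ((0, 0) : I × I) (1, 0) := ⟨⟨fun r => (r, 0), by fun_prop⟩, rfl, rfl⟩
  let P₂ : Path ((1, 0) : I × I) (1, 1) := ⟨⟨fun r => (1, r), by fun_prop⟩, rfl, rfl⟩
  let P₃ : Path ((0, 0) : I × I) (0, 1) := ⟨⟨fun r => (0, r), by fun_prop⟩, rfl, rfl⟩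
  let P₄ : Path ((0, 1) : I × I) (1, 1) := ⟨⟨fun r => (r, 1), by fun_prop⟩, rfl, rfl⟩
  -- The square is simply connected, so the two ways around it are homotopic already before `T` is
  -- applied.
  have : ContractibleSpace I := (convex_Icc (0 : ℝ) 1).contractibleSpace ⟨0, by simp⟩
  have h : (P₁.trans P₂).Homotopic (P₃.trans P₄) := SimplyConnectedSpace.paths_homotopic _ _
  have hpath := h.map ⟨T, hT⟩
  simp only [Path.map_trans] at hpath
  have e₁ : bot = P₁.map hT := by ext r; exact (hb r).symm
  have e₂ : right = P₂.map hT := by ext r; exact (hr r).symm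
  have e₃ : left = P₃.map hT := by ext r; exact (hl r).symm
  have e₄ : top = P₄.map hT := by ext r; exact (ht r).symm
  rw [e₁, e₂, e₃, e₄, ← Path.Homotopic.Quotient.mk_trans, ← Path.Homotopic.Quotient.mk_trans]
  exact Path.Homotopic.Quotient.eq.2 hpath

/-- A continuous map which is constant on `{x₀} × I` may be evaluated at `x₀` along any function. -/
theorem continuousAt_comp_of_const {X B : Type*} [TopologicalSpace X] [TopologicalSpace B]
    {f : I × X → B} (hf : Continuous f) {x₀ : X} {y : B} (h : ∀ w, f (w, x₀) = y)
    (w : X → I) : ContinuousAt (fun x => f (w x, x)) x₀ := by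
  intro U hU
  simp only [h] at hU
  -- Compactness of `I` gives one neighbourhood of `x₀` that serves all `w` at once, so `w` may
  -- depend on `x` without any continuity.
  have : ∀ᶠ x in 𝓝 x₀, ∀ w ∈ (univ : Set I), f (w, x) ∈ U := by
    refine isCompact_univ.eventually_forall_of_forall_eventually fun w _ => ?_
    have : Filter.Tendsto (fun z : X × I => f (z.2, z.1)) (𝓝 (x₀, w)) (𝓝 y) := by
      have := (hf.comp continuous_swap).tendsto (x₀, w)
      simpa [Function.comp_def, Prod.swap, h] using this
    exact this.eventually hU
  exact this.mono fun x hx => hx _ trivial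

/-- The upper edge of a square may be changed by a homotopy relative to its end points, without
changing the other three edges, nor the part of the square below height `a < 1`. -/
theorem exists_square_change_top {B : Type*} [TopologicalSpace B] (T : I × I → B)
    (hT : Continuous T) {y y' : B} (m q : Path y y') (hm : ∀ r, T (r, 1) = m r)
    (hmq : m.Homotopic q) {a : ℝ} (ha : a < 1) :
    ∃ T' : I × I → B, Continuous T' ∧ (∀ (r t : I), (t : ℝ) ≤ a → T' (r, t) = T (r, t)) ∧
      (∀ t, T' (0, t) = T (0, t)) ∧ (∀ t, T' (1, t) = T (1, t)) ∧ ∀ r, T' (r, 1) = q r := by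
  obtain ⟨h⟩ := hmq
  -- `η` vanishes exactly on the vertical edges. Above height `a` the square is stretched to total
  -- height `1 + η r`, and the surplus of length `η r` is used to run the homotopy.
  let η : I → ℝ := fun r => min (r : ℝ) (1 - r)
  have hη : Continuous η := by fun_prop
  have hη0 : ∀ r, 0 ≤ η r := fun r => le_min r.2.1 (by linarith [r.2.2])
  have hη_zero : ∀ r, η r = 0 → r = 0 ∨ r = 1 := by
    intro r hr
    rcases min_choice (r : ℝ) (1 - r) with h' | h'
    · left; ext; simpa [η, h'] using hr
    · right; ext
      have : 1 - (r : ℝ) = 0 := by simpa [η, h'] using hr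
      rw [Icc.coe_one]; linarith
  let τ : I × I → ℝ := fun z => z.2 + η z.1 * max 0 ((z.2 - a) / (1 - a))
  have hτ : Continuous τ := by fun_prop
  have hτ0 : ∀ z, 0 ≤ τ z := fun z =>
    add_nonneg z.2.2.1 (mul_nonneg (hη0 _) (le_max_left _ _))
  -- Where `η = 0` the quotient is a meaningless default, but there `h` sits at an end point of the
  -- paths and does not depend on its first argument.
  let w : I × I → I := fun z => projIcc 0 1 zero_le_one ((τ z - 1) / η z.1)
  have h₂ : Continuous fun z : I × I => h (w z, z.1) := by
    rw [continuous_iff_continuousAt]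
    intro z
    by_cases hz : η z.1 = 0
    · have hc : ∀ v, h (v, z.1) = y ∨ h (v, z.1) = y' := fun v => by
        rcases hη_zero _ hz with h' | h' <;> simp [h']
      have : ∃ y₀, ∀ v, h (v, z.1) = y₀ := by
        rcases hη_zero _ hz with h' | h'
        · exact ⟨y, fun v => by simp [h']⟩
        · exact ⟨y', fun v => by simp [h']⟩
      obtain ⟨y₀, hy₀⟩ := this
      exact continuousAt_comp_of_const (f := fun u : I × (I × I) => h (u.1, u.2.1))
        (by fun_prop) hy₀ w
    · have : ContinuousAt w z := by
        refine continuous_projIcc.continuousAt.comp ?_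
        exact ((hτ.continuousAt).sub continuousAt_const).div
          (hη.comp continuous_fst).continuousAt hz
      exact h.continuous.continuousAt.comp (this.prodMk continuousAt_fst)
  refine ⟨fun z => if τ z ≤ 1 then T (z.1, projIcc 0 1 zero_le_one (τ z)) else h (w z, z.1),
    ?_, ?_, ?_, ?_, ?_⟩
  · refine Continuous.if_le ?_ h₂ hτ continuous_const ?_
    · exact hT.comp (continuous_fst.prodMk (continuous_projIcc.comp hτ))
    · intro z hz
      have : w z = 0 := by simp [w, hz]
      rw [this, hz, h.apply_zero, projIcc_right]
      exact hm _
  · intro r t hta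
    have : τ (r, t) = t := by
      simp only [τ]
      rw [max_eq_left (div_nonpos_of_nonpos_of_nonneg (by linarith) (by linarith))]; simp
    simp only [this, t.2.2, if_true, projIcc_val]
  · intro t
    have : τ (0, t) = t := by simp [τ, η]
    simp only [this, t.2.2, if_true, projIcc_val]
  · intro t
    have : τ (1, t) = t := by simp [τ, η]
    simp only [this, t.2.2, if_true, projIcc_val]
  · intro r
    have : τ (r, 1) = 1 + η r := by
      simp only [τ, Icc.coe_one]
      rw [div_self (by linarith)]; simp
    dsimp only
    rcases (hη0 r).eq_or_lt with h0 | h0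
    · rw [if_pos (by rw [this, ← h0]; simp)]
      have e : projIcc (0 : ℝ) 1 zero_le_one (τ (r, 1)) = 1 := by
        rw [this, ← h0, add_zero, projIcc_right]; rfl
      rw [e, hm]
      rcases hη_zero _ h0.symm with h' | h' <;> simp [h']
    · rw [if_neg (by rw [this]; linarith)]
      have : w (r, 1) = 1 := by
        simp only [w, this, add_sub_cancel_left]
        rw [div_self h0.ne', projIcc_right]; rfl
      rw [this, h.apply_one]; rfl

/-! ### Sections of a slab with a collared flow -/

/-- A semiflow on `A` which raises the height `k : A → [0,1]` at unit speed until it reaches the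
level set `B` at height `1`, and which is a product over `[a, 1]`. -/
structure CollaredFlow {A B : Type*} [TopologicalSpace A] [TopologicalSpace B] (k : A → ℝ)
    (ι : C(B, A)) where
  F : C(A × I, A)
  C : C(A, B)
  F_zero : ∀ x, F (x, 0) = x
  k_F : ∀ x s, k (F (x, s)) = min 1 (k x + s)
  C_F : ∀ x s, C (F (x, s)) = C x
  F_one : ∀ x, F (x, 1) = ι (C x)
  a : ℝ
  a_nonneg : 0 ≤ a
  a_lt : a < 1
  K : C(B × Icc a 1, A)
  k_K : ∀ y t, k (K (y, t)) = t
  C_K : ∀ y t, C (K (y, t)) = y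
  K_C : ∀ x (h : k x ∈ Icc a 1), K (C x, ⟨k x, h⟩) = x

namespace CollaredFlow

variable {A B : Type*} [TopologicalSpace A] [TopologicalSpace B] {k : A → ℝ} {ι : C(B, A)}
  (Φ : CollaredFlow k ι)

/-- Over the collar, the height and the collapse are a full set of coordinates, by `K_C`. -/
theorem ext {x x' : A} (ha : Φ.a ≤ k x) {t : ℝ} (hx : k x = t) (hx' : k x' = t) (ht : t ≤ 1)
    (h : Φ.C x = Φ.C x') : x = x' := by
  have h₁ := Φ.K_C x ⟨ha, hx.le.trans ht⟩
  have h₂ := Φ.K_C x' ⟨by rw [hx', ← hx]; exact ha, hx'.le.trans ht⟩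
  rw [← h₁, ← h₂, h]
  congr 2
  exact Subtype.ext (hx.trans hx'.symm)

/-- Every path in `B` between the collapses of `x` and `z` is, up to homotopy, the collapse of a
section from `x` to `z`. -/
theorem exists_section_of_collared {x z : A} (hx : k x = 0) (hz : k z = 1)
    (γ : Path (Φ.C x) (Φ.C z)) :
    ∃ δ : Path x z, (∀ t, k (δ t) = t) ∧
      Path.Homotopic.Quotient.mk (δ.map Φ.C.continuous) = .mk γ := by
  have ha := Φ.a_lt
  have ha0 := Φ.a_nonneg
  -- The section follows the flow line of `x` up to height `a`, during which its collapse stays at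
  -- `C x`, and then runs through `γ` inside the collar. `ρ` waits until height `a`, so the collapse
  -- is `γ` reparametrised by `ρ`.
  let ρ : I → I := fun t => projIcc 0 1 zero_le_one ((t - Φ.a) / (1 - Φ.a))
  have hρ : Continuous ρ := by fun_prop
  have hρ0 : ∀ t : I, (t : ℝ) ≤ Φ.a → ρ t = 0 := fun t ht =>
    projIcc_of_le_left _ (div_nonpos_of_nonpos_of_nonneg (by linarith) (by linarith))
  have hρ1 : ρ 1 = 1 := by
    simp only [ρ, Icc.coe_one]
    rw [div_self (by linarith)]; exact projIcc_right zero_le_one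
  let δ : I → A := fun t => if (t : ℝ) ≤ Φ.a then Φ.F (x, t)
    else Φ.K (γ (ρ t), projIcc Φ.a 1 ha.le t)
  have hFk : ∀ t, k (Φ.F (x, t)) = t := fun t => by
    rw [Φ.k_F, hx, zero_add, min_eq_right t.2.2]
  have hδk : ∀ t, k (δ t) = t := by
    intro t
    simp only [δ]
    split_ifs with h
    · exact hFk t
    · rw [Φ.k_K, projIcc_of_mem _ ⟨by linarith, t.2.2⟩]
  have hδC : ∀ t, Φ.C (δ t) = γ (ρ t) := by
    intro t
    simp only [δ]
    split_ifs with h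
    · rw [Φ.C_F, hρ0 t h, γ.source]
    · rw [Φ.C_K]
  have hδc : Continuous δ := by
    refine Continuous.if_le (by fun_prop) ?_ (by fun_prop) (by fun_prop) ?_
    · exact Φ.K.continuous.comp ((γ.continuous.comp hρ).prodMk
        (continuous_projIcc.comp continuous_subtype_val))
    · intro t ht
      have hm : k (Φ.F (x, t)) ∈ Icc Φ.a 1 := by rw [hFk]; exact ⟨ht.ge, t.2.2⟩
      have h1 := Φ.K_C _ hm
      rw [Φ.C_F] at h1
      rw [hρ0 t ht.le, γ.source, ← h1]
      congr 2
      rw [projIcc_of_mem _ ⟨ht.ge, t.2.2⟩]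
      exact Subtype.ext (hFk t)
  have hδ0 : δ 0 = x := by
    simp only [δ, Icc.coe_zero, ha0, if_true, Φ.F_zero]
  have hδ1 : δ 1 = z := by
    refine Φ.ext (by rw [hδk]; exact ha.le) (by rw [hδk]; rfl) hz le_rfl ?_
    rw [hδC, hρ1, γ.target]
  refine ⟨⟨⟨δ, hδc⟩, hδ0, hδ1⟩, hδk, ?_⟩
  have : (⟨⟨δ, hδc⟩, hδ0, hδ1⟩ : Path x z).map Φ.C.continuous = γ.reparam ρ hρ (hρ0 0 ha0) hρ1 := by
    ext t; exact hδC t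
  rw [this]
  exact (Path.Homotopic.Quotient.eq.2 ⟨Path.Homotopy.reparam γ ρ hρ (hρ0 0 ha0) hρ1⟩).symm

/-- Two sections which start at the ends of a path `p` at height `0` and end at the ends of a path
`q` at height `1` are joined by a family of sections that start on `p` and end on `q`, if the collapsed
paths bound. -/
theorem exists_square_of_collared {x x' y y' : A} (δ : Path x y) (δ' : Path x' y')
    (hδ : ∀ t, k (δ t) = t) (hδ' : ∀ t, k (δ' t) = t) (p : Path x x') (hp : ∀ r, k (p r) = 0)
    (q : Path y y') (hq : ∀ r, k (q r) = 1)
    (h : (Path.Homotopic.Quotient.mk (p.map Φ.C.continuous)).trans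
        (.mk (δ'.map Φ.C.continuous)) =
      (Path.Homotopic.Quotient.mk (δ.map Φ.C.continuous)).trans
        (.mk (q.map Φ.C.continuous))) :
    ∃ S : I × I → A, Continuous S ∧ (∀ r t, k (S (r, t)) = t) ∧ (∀ t, S (0, t) = δ t) ∧
      (∀ t, S (1, t) = δ' t) ∧ (∀ r, S (r, 0) = p r) ∧ ∀ r, S (r, 1) = q r := by
  have ha := Φ.a_lt
  have ha0 := Φ.a_nonneg
  -- The reversed `δ`, then `p`, then `δ'`, as one curve. All points of the square below are reached
  -- from it along the flow.
  let E : ℝ → A := fun z =>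
    if z ≤ 0 then δ.extend (-z) else if z ≤ 1 then p.extend z else δ'.extend (z - 1)
  have hE : Continuous E := by
    refine Continuous.if_le (by fun_prop) (Continuous.if_le (by fun_prop) (by fun_prop)
      continuous_id continuous_const ?_) continuous_id continuous_const ?_
    · rintro z rfl; simp
    · rintro z rfl; simp
  -- Starting point `z` and flow time `u` are chosen such that the height reached is always `t`. For
  -- `3r ≤ t` the start is `δ(t - 3r)` and the time is `3r`; for `3(1 - r) ≤ t` the same holds with
  -- `δ'`; in between the start lies on `p` and the time is `t`. The fraction rescales the middle
  -- range `[t/3, 1 - t/3]` to `[0,1]`.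
  let z : I × I → ℝ := fun w => min 0 (3 * (w.1 : ℝ) - w.2) +
    max 0 (min 1 ((3 * (w.1 : ℝ) - w.2) / (3 - 2 * w.2))) + max 0 ((w.2 : ℝ) - 3 * (1 - w.1))
  have hpos : ∀ t : I, (0 : ℝ) < 3 - 2 * t := fun t => by linarith [t.2.2]
  have hz : Continuous z := by
    have : Continuous fun w : I × I => (3 * w.1 - w.2 : ℝ) / (3 - 2 * w.2) :=
      Continuous.div (by fun_prop) (by fun_prop) fun w => (hpos w.2).ne'
    fun_prop
  let u : I × I → I := fun w =>
    projIcc 0 1 zero_le_one (min (w.2 : ℝ) (min (3 * w.1) (3 * (1 - w.1))))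
  have hu : Continuous u := by fun_prop
  have case₁ : ∀ r t : I, 3 * (r : ℝ) ≤ t → E (z (r, t)) = δ.extend (t - 3 * r) ∧
      (u (r, t) : ℝ) = 3 * r := by
    intro r t hrt
    have hr := r.2
    have ht := t.2
    have e : z (r, t) = 3 * r - t := by
      have h₁ : (3 * r - t : ℝ) / (3 - 2 * t) ≤ 0 :=
        div_nonpos_of_nonpos_of_nonneg (by linarith) (hpos t).le
      simp only [z]
      rw [min_eq_right (by linarith), max_eq_left ((min_le_right _ _).trans h₁),
        max_eq_left (by linarith [ht.2])]
      ring
    refine ⟨?_, ?_⟩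
    · simp only [E]
      rw [if_pos (by rw [e]; linarith), e, neg_sub]
    · simp only [u]
      rw [min_eq_right (by exact (min_le_left _ _).trans hrt),
        min_eq_left (by linarith [ht.2]), projIcc_of_mem _ ⟨by linarith [hr.1], by linarith [ht.2]⟩]
  have case₂ : ∀ r t : I, 3 * (1 - (r : ℝ)) ≤ t → E (z (r, t)) = δ'.extend (t - 3 * (1 - r)) ∧
      (u (r, t) : ℝ) = 3 * (1 - r) := by
    intro r t hrt
    have hr := r.2
    have ht := t.2
    have e : z (r, t) = 1 + (t - 3 * (1 - r)) := by
      have h₁ : 1 ≤ (3 * r - t : ℝ) / (3 - 2 * t) := by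
        rw [one_le_div (hpos t)]; linarith
      simp only [z]
      rw [min_eq_left (by linarith [ht.2]), min_eq_left h₁, max_eq_right zero_le_one,
        max_eq_right (by linarith)]
      ring
    refine ⟨?_, ?_⟩
    · simp only [E]
      rw [if_neg (by rw [e]; linarith)]
      split_ifs with h1
      · have h2 : (t : ℝ) - 3 * (1 - r) = 0 := by linarith
        rw [e, h2]; simp
      · rw [e, add_sub_cancel_left]
    · simp only [u]
      rw [min_eq_right (by exact (min_le_right _ _).trans hrt),
        min_eq_right (by linarith [ht.2]),
        projIcc_of_mem _ ⟨by linarith [hr.2], by linarith [ht.2]⟩]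
  have case₃ : ∀ r t : I, (t : ℝ) ≤ 3 * r → (t : ℝ) ≤ 3 * (1 - r) →
      E (z (r, t)) = p.extend ((3 * r - t) / (3 - 2 * t)) ∧ (u (r, t) : ℝ) = t := by
    intro r t h1 h2
    have hr := r.2
    have ht := t.2
    have h₀ : 0 ≤ (3 * r - t : ℝ) / (3 - 2 * t) := div_nonneg (by linarith) (hpos t).le
    have h₁ : (3 * r - t : ℝ) / (3 - 2 * t) ≤ 1 := by
      rw [div_le_one (hpos t)]; linarith
    have e : z (r, t) = (3 * r - t : ℝ) / (3 - 2 * t) := by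
      simp only [z]
      rw [min_eq_left (by linarith [ht.2]), min_eq_right h₁, max_eq_right h₀,
        max_eq_left (by linarith)]
      ring
    refine ⟨?_, ?_⟩
    · simp only [E]
      split_ifs with h3 h4
      · have h5 : (3 * r - t : ℝ) / (3 - 2 * t) = 0 := le_antisymm (e ▸ h3) h₀
        rw [e, h5]; simp
      · rw [e]
      · exact absurd (e.le.trans h₁) h4
    · simp only [u]
      rw [min_eq_left (le_min h1 h2), projIcc_of_mem _ ht]
  have hext : ∀ {x y : A} (γ : Path x y) (hγ : ∀ t, k (γ t) = t) (s : ℝ), 0 ≤ s → s ≤ 1 →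
      k (γ.extend s) = s := fun γ hγ s h0 h1 => by
    rw [Path.extend_apply γ ⟨h0, h1⟩, hγ]
  let S₀ : I × I → A := fun w => Φ.F (E (z w), u w)
  have hS₀ : Continuous S₀ := by fun_prop
  have hkS₀ : ∀ r t, k (S₀ (r, t)) = t := by
    intro r t
    have hr := r.2
    have ht := t.2
    simp only [S₀, Φ.k_F]
    rcases le_total (3 * (r : ℝ)) t with h1 | h1
    · obtain ⟨e₁, e₂⟩ := case₁ r t h1
      rw [e₁, e₂, hext δ hδ _ (by linarith) (by linarith [ht.2, hr.1]), sub_add_cancel,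
        min_eq_right ht.2]
    · rcases le_total (3 * (1 - (r : ℝ))) t with h2 | h2
      · obtain ⟨e₁, e₂⟩ := case₂ r t h2
        rw [e₁, e₂, hext δ' hδ' _ (by linarith) (by linarith [ht.2, hr.2]), sub_add_cancel,
          min_eq_right ht.2]
      · obtain ⟨e₁, e₂⟩ := case₃ r t h1 h2
        have : k (p.extend ((3 * r - t) / (3 - 2 * t))) = 0 := hp _
        rw [e₁, e₂, this, zero_add, min_eq_right ht.2]
  have hS₀l : ∀ t, S₀ (0, t) = δ t := by
    intro t
    obtain ⟨e₁, e₂⟩ := case₁ 0 t (by simpa using t.2.1)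
    have e₃ : u (0, t) = 0 := Subtype.ext (by simpa using e₂)
    simp [S₀, e₁, e₃, Φ.F_zero]
  have hS₀r : ∀ t, S₀ (1, t) = δ' t := by
    intro t
    obtain ⟨e₁, e₂⟩ := case₂ 1 t (by simpa using t.2.1)
    have e₃ : u (1, t) = 0 := Subtype.ext (by simpa using e₂)
    simp [S₀, e₁, e₃, Φ.F_zero]
  have hS₀b : ∀ r, S₀ (r, 0) = p r := by
    intro r
    obtain ⟨e₁, e₂⟩ := case₃ r 0 (by simpa using r.2.1) (by simpa using r.2.2)
    have e₃ : u (r, 0) = 0 := Subtype.ext (by simpa using e₂)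
    have e₄ : (3 * (r : ℝ) - (0 : I)) / (3 - 2 * (0 : I)) = r := by simp
    simp only [S₀, e₁, e₃, Φ.F_zero, e₄, Path.extend_extends']
  have hy : Φ.C (S₀ (0, 1)) = Φ.C y := by rw [hS₀l, δ.target]
  have hy' : Φ.C (S₀ (1, 1)) = Φ.C y' := by rw [hS₀r, δ'.target]
  let T : I × I → B := fun w => Φ.C (S₀ w)
  have hT : Continuous T := by fun_prop
  let m : Path (Φ.C y) (Φ.C y') := ⟨⟨fun r => T (r, 1), by fun_prop⟩, hy, hy'⟩
  -- `S₀` has the right left, right and lower edges, but its upper edge is only what the flow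
  -- produces. The relation of the collapsed square, compared with `h`, identifies the class of that
  -- edge.
  have hrel := square_relation T hT (p.map Φ.C.continuous)
    (δ'.map Φ.C.continuous) (δ.map Φ.C.continuous) m
    (fun r => congrArg Φ.C (hS₀b r)) (fun t => congrArg Φ.C (hS₀r t))
    (fun t => congrArg Φ.C (hS₀l t)) fun _ => rfl
  have hmq : m.Homotopic (q.map Φ.C.continuous) := by
    rw [← Path.Homotopic.Quotient.eq]
    exact pathClass_trans_left_cancel (hrel.symm.trans h)
  obtain ⟨T', hT', hT'a, hT'l, hT'r, hT't⟩ :=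
    exists_square_change_top T hT m (q.map Φ.C.continuous) (fun _ => rfl) hmq ha
  -- Below height `a` the swept square is kept; above, the collapsed square with the corrected upper
  -- edge is lifted through the collar.
  let S : I × I → A := fun w => if (w.2 : ℝ) ≤ Φ.a then S₀ w
    else Φ.K (T' w, projIcc Φ.a 1 ha.le w.2)
  have hkS : ∀ r t, k (S (r, t)) = t := by
    intro r t
    simp only [S]
    split_ifs with h1
    · exact hkS₀ r t
    · rw [Φ.k_K, projIcc_of_mem _ ⟨by linarith, t.2.2⟩]
  have hCS : ∀ w, Φ.C (S w) = T' w := by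
    rintro ⟨r, t⟩
    simp only [S]
    split_ifs with h1
    · rw [hT'a r t h1]
    · rw [Φ.C_K]
  -- An edge is checked by its height and collapse alone in the collar, and by comparison with `S₀`
  -- below it.
  have key : ∀ r (t : I) (x₀ : A), k x₀ = t → Φ.C x₀ = T' (r, t) →
      ((t : ℝ) ≤ Φ.a → S₀ (r, t) = x₀) → S (r, t) = x₀ := by
    intro r t x₀ h1 h2 h3
    by_cases h4 : (t : ℝ) ≤ Φ.a
    · simp only [S, if_pos h4, h3 h4]
    · refine Φ.ext ?_ (hkS r t) h1 t.2.2 (by rw [hCS, h2])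
      rw [hkS]; linarith
  refine ⟨S, ?_, hkS, ?_, ?_, ?_, ?_⟩
  · refine Continuous.if_le hS₀ ?_ (by fun_prop) (by fun_prop) ?_
    · exact Φ.K.continuous.comp (hT'.prodMk
        (continuous_projIcc.comp (continuous_subtype_val.comp continuous_snd)))
    · rintro ⟨r, t⟩ ht
      simp only at ht
      refine Φ.ext (t := t) ?_ (hkS₀ r t) ?_ t.2.2 ?_
      · rw [hkS₀, ht]
      · rw [Φ.k_K, projIcc_of_mem _ ⟨ht.ge, t.2.2⟩]
      · rw [Φ.C_K, hT'a r t ht.le]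
  · exact fun t => key 0 t _ (hδ t) (by rw [hT'l, ← hS₀l]) fun _ => hS₀l t
  · exact fun t => key 1 t _ (hδ' t) (by rw [hT'r, ← hS₀r]) fun _ => hS₀r t
  · intro r
    exact key r 0 _ (hp r) (by rw [hT'a r 0 ha0, ← hS₀b]) fun _ => hS₀b r
  · intro r
    exact key r 1 _ (hq r) (by rw [hT't]; rfl) fun h => absurd h (by simpa using ha)

variable (C : C(A, B))

/-- The path from `C x` to the end of the flow line of `x`. -/
def comparison (hC : ∀ y, C (ι y) = y) (x : A) : Path (C x) (Φ.C x) where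
  toFun s := C (Φ.F (x, s))
  continuous_toFun := by fun_prop
  source' := by rw [Φ.F_zero]
  target' := by rw [Φ.F_one, hC]

/-- The square `C (F (δ r, s))` interpolates between the two collapses of `δ`. This replaces an
arbitrary retraction `C` by the collapse of the flow, at the cost of comparison paths at the ends,
which cancel later. -/
theorem comparison_naturality (hC : ∀ y, C (ι y) = y) {x x' : A} (δ : Path x x') :
    (Path.Homotopic.Quotient.mk (δ.map C.continuous)).trans (.mk (Φ.comparison C hC x')) =
      (Path.Homotopic.Quotient.mk (Φ.comparison C hC x)).trans (.mk (δ.map Φ.C.continuous)) :=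
  square_relation (fun w => C (Φ.F (δ w.1, w.2))) (by fun_prop) _ _ _ _
    (fun r => by simp [Φ.F_zero]) (fun t => by simp [comparison])
    (fun t => by simp [comparison]) (fun r => by simp [Φ.F_one, hC])

/-- Every path class from `C x` to `C z`, where `x` has height `0` and `z` has height `1`, is the
collapse of a section from `x` to `z`. -/
theorem exists_section (Φ : CollaredFlow k ι) (hC : ∀ y, C (ι y) = y) {x z : A} (hx : k x = 0) (hz : k z = 1)
    (γ : Path.Homotopic.Quotient (C x) (C z)) :
    ∃ δ : Path x z, (∀ t, k (δ t) = t) ∧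
      Path.Homotopic.Quotient.mk (δ.map C.continuous) = γ := by
  obtain ⟨γ₀, hγ₀⟩ := Path.Homotopic.Quotient.mk_surjective
    ((Path.Homotopic.Quotient.mk (Φ.comparison C hC x)).symm.trans
      (γ.trans (.mk (Φ.comparison C hC z))))
  obtain ⟨δ, hδ, hδγ⟩ := Φ.exists_section_of_collared hx hz γ₀
  refine ⟨δ, hδ, ?_⟩
  apply pathClass_trans_right_cancel (c := .mk (Φ.comparison C hC z))
  rw [comparison_naturality, hδγ, hγ₀, ← Path.Homotopic.Quotient.trans_assoc,
    Path.Homotopic.Quotient.trans_symm, Path.Homotopic.Quotient.refl_trans]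

/-- Two sections which start at the ends of a path `p` at height `0` and end at the ends of a path
`q` at height `1` are joined by a family of sections that start on `p` and end on `q`, if the
collapsed paths bound. -/
theorem exists_square (Φ : CollaredFlow k ι) (hC : ∀ y, C (ι y) = y) {x x' y y' : A}
    (δ : Path x y) (δ' : Path x' y')
    (hδ : ∀ t, k (δ t) = t) (hδ' : ∀ t, k (δ' t) = t) (p : Path x x') (hp : ∀ r, k (p r) = 0)
    (q : Path y y') (hq : ∀ r, k (q r) = 1)
    (h : (Path.Homotopic.Quotient.mk (p.map C.continuous)).trans (.mk (δ'.map C.continuous)) =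
      (Path.Homotopic.Quotient.mk (δ.map C.continuous)).trans (.mk (q.map C.continuous))) :
    ∃ S : I × I → A, Continuous S ∧ (∀ r t, k (S (r, t)) = t) ∧ (∀ t, S (0, t) = δ t) ∧
      (∀ t, S (1, t) = δ' t) ∧ (∀ r, S (r, 0) = p r) ∧ ∀ r, S (r, 1) = q r := by
  refine Φ.exists_square_of_collared δ δ' hδ hδ' p hp q hq ?_
  apply pathClass_trans_left_cancel (c := .mk (Φ.comparison C hC x))
  rw [← Path.Homotopic.Quotient.trans_assoc, ← Path.Homotopic.Quotient.trans_assoc,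
    ← comparison_naturality, ← comparison_naturality, Path.Homotopic.Quotient.trans_assoc,
    Path.Homotopic.Quotient.trans_assoc, ← comparison_naturality, ← comparison_naturality,
    ← Path.Homotopic.Quotient.trans_assoc, ← Path.Homotopic.Quotient.trans_assoc, h]

end CollaredFlow

/-! ### Sections and families of sections over one slab -/

namespace Levels

variable {n : ℕ} (L : Levels n) {Y : Type*} (g : Y → ℝ)

/-- The height in the slab `Xᵢ^{i+1}`, normalised to be `0` on `X_{∂⁻(i)}` and `1` on
`X_{∂⁺(i)}`. -/
def slabHeight (i : Fin n) (w : L.W g i) : ℝ :=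
  (g w.1 - L.s (L.minus i)) / (L.s (L.plus i) - L.s (L.minus i))

/-- The slab `Xᵢ^{i+1}` has a collared flow towards `X_{∂⁺(i)}`. -/
abbrev SlabFlow [TopologicalSpace Y] (i : Fin n) : Type _ :=
  CollaredFlow (L.slabHeight g i) (inclusion (g := g) (L.plus_mem i))

variable {L g}

theorem lt_succ (i : Fin n) : L.s i.castSucc < L.s i.succ :=
  L.strictMono (Fin.castSucc_lt_succ (i := i))

theorem slabHeight_of_not {i : Fin n} (h : ¬ L.D i) (w : L.W g i) :
    L.slabHeight g i w = (g w.1 - L.s i.castSucc) / (L.s i.succ - L.s i.castSucc) := by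
  simp [slabHeight, plus, minus, h]

theorem slabHeight_of_D {i : Fin n} (h : L.D i) (w : L.W g i) :
    L.slabHeight g i w = 1 - (g w.1 - L.s i.castSucc) / (L.s i.succ - L.s i.castSucc) := by
  have := (L.lt_succ i).ne
  have h2 : L.s i.succ - L.s i.castSucc ≠ 0 := sub_ne_zero.2 this.symm
  have h3 : L.s i.castSucc - L.s i.succ ≠ 0 := sub_ne_zero.2 this
  simp only [slabHeight, plus, minus, h, if_true]
  field_simp
  ring

theorem height_eq_lineMap {i : Fin n} {v t : ℝ} :
    (v - L.s i.castSucc) / (L.s i.succ - L.s i.castSucc) = t ↔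
      v = AffineMap.lineMap (L.s i.castSucc) (L.s i.succ) t := by
  have h2 : L.s i.succ - L.s i.castSucc ≠ 0 := sub_ne_zero.2 (L.lt_succ i).ne'
  rw [AffineMap.lineMap_apply_module', div_eq_iff h2, sub_eq_iff_eq_add, smul_eq_mul]

variable [TopologicalSpace Y]

/-- Every path class between the collapses of `x ∈ Xᵢ` and `x' ∈ Xᵢ₊₁` is the collapse of a section
over `[sᵢ, sᵢ₊₁]`. -/
theorem exists_arc (R : L.Retractions g) {i : Fin n} (Φ : L.SlabFlow g i)
    (x : L.X g i.castSucc) (x' : L.X g i.succ)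
    (γ : Path.Homotopic.Quotient (collapse R i (inclusion (L.left_mem i) x))
      (collapse R i (inclusion (L.right_mem i) x'))) :
    ∃ α : Path (inclusion (L.left_mem i) x) (inclusion (L.right_mem i) x'),
      (∀ t, g (α t).1 = AffineMap.lineMap (L.s i.castSucc) (L.s i.succ) (t : ℝ)) ∧
      Path.Homotopic.Quotient.mk (α.map (collapse R i).continuous) = γ := by
  have hC := (R i).collapse_inclusion (L.plus_mem i)
  have h2 : L.s i.succ - L.s i.castSucc ≠ 0 := sub_ne_zero.2 (L.lt_succ i).ne'
  have hx : g (inclusion (L.left_mem i) x).1 = L.s i.castSucc := x.2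
  have hx' : g (inclusion (L.right_mem i) x').1 = L.s i.succ := x'.2
  -- For type D the flow runs downwards, so the normalised height is reversed and the section is
  -- constructed from right to left.
  by_cases hD : L.D i
  · obtain ⟨δ, hδ, hδγ⟩ := Φ.exists_section (collapse R i) hC
      (x := inclusion (L.right_mem i) x') (z := inclusion (L.left_mem i) x)
      (by rw [slabHeight_of_D hD, hx', div_self h2, sub_self])
      (by rw [slabHeight_of_D hD, hx, sub_self, zero_div, sub_zero]) γ.symm
    refine ⟨δ.symm, fun t => ?_, ?_⟩
    · have := hδ (unitInterval.symm t)
      rw [slabHeight_of_D hD, unitInterval.coe_symm_eq, sub_right_inj] at this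
      exact height_eq_lineMap.1 this
    · rw [← Path.map_symm, Path.Homotopic.Quotient.mk_symm, hδγ, pathClass_symm_symm]
  · obtain ⟨δ, hδ, hδγ⟩ := Φ.exists_section (collapse R i) hC
      (x := inclusion (L.left_mem i) x) (z := inclusion (L.right_mem i) x')
      (by rw [slabHeight_of_not hD, hx, sub_self, zero_div])
      (by rw [slabHeight_of_not hD, hx', div_self h2]) γ
    refine ⟨δ, fun t => ?_, hδγ⟩
    have := hδ t
    rw [slabHeight_of_not hD] at this
    exact height_eq_lineMap.1 this

/-- Two sections over `[sᵢ, sᵢ₊₁]` are joined by a family of sections with prescribed ends, if the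
collapsed paths bound. -/
theorem exists_arc_square (R : L.Retractions g) {i : Fin n} (Φ : L.SlabFlow g i)
    {x y : L.X g i.castSucc} {x' y' : L.X g i.succ}
    (α : Path (inclusion (L.left_mem i) x) (inclusion (L.right_mem i) x'))
    (β : Path (inclusion (L.left_mem i) y) (inclusion (L.right_mem i) y'))
    (hα : ∀ t, g (α t).1 = AffineMap.lineMap (L.s i.castSucc) (L.s i.succ) (t : ℝ))
    (hβ : ∀ t, g (β t).1 = AffineMap.lineMap (L.s i.castSucc) (L.s i.succ) (t : ℝ))
    (p : Path x y) (q : Path x' y')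
    (h : (Path.Homotopic.Quotient.mk
        (p.map ((collapse R i).comp (inclusion (L.left_mem i))).continuous)).trans
        (.mk (β.map (collapse R i).continuous)) =
      (Path.Homotopic.Quotient.mk (α.map (collapse R i).continuous)).trans
        (.mk (q.map ((collapse R i).comp (inclusion (L.right_mem i))).continuous))) :
    ∃ S : I × I → L.W g i, Continuous S ∧
      (∀ r t, g (S (r, t)).1 = AffineMap.lineMap (L.s i.castSucc) (L.s i.succ) (t : ℝ)) ∧
      (∀ t, S (0, t) = α t) ∧ (∀ t, S (1, t) = β t) ∧
      (∀ r, S (r, 0) = inclusion (L.left_mem i) (p r)) ∧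
      ∀ r, S (r, 1) = inclusion (L.right_mem i) (q r) := by
  have hC := (R i).collapse_inclusion (L.plus_mem i)
  have h2 : L.s i.succ - L.s i.castSucc ≠ 0 := sub_ne_zero.2 (L.lt_succ i).ne'
  have hp : ∀ r, g ((p.map (inclusion (L.left_mem i)).continuous) r).1 = L.s i.castSucc :=
    fun r => (p r).2
  have hq : ∀ r, g ((q.map (inclusion (L.right_mem i)).continuous) r).1 = L.s i.succ :=
    fun r => (q r).2
  by_cases hD : L.D i
  · obtain ⟨S, hS, hk, hl, hr, hb, ht⟩ := Φ.exists_square (collapse R i) hC α.symm β.symm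
      (fun t => by
        rw [slabHeight_of_D hD, Path.symm_apply, Function.comp_apply, height_eq_lineMap.2 (hα _),
          unitInterval.coe_symm_eq, sub_sub_cancel])
      (fun t => by
        rw [slabHeight_of_D hD, Path.symm_apply, Function.comp_apply, height_eq_lineMap.2 (hβ _),
          unitInterval.coe_symm_eq, sub_sub_cancel])
      (q.map (inclusion (L.right_mem i)).continuous)
      (fun r => by rw [slabHeight_of_D hD, hq, div_self h2, sub_self])
      (p.map (inclusion (L.left_mem i)).continuous)
      (fun r => by rw [slabHeight_of_D hD, hp, sub_self, zero_div, sub_zero])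
      (by
        rw [← Path.map_symm, ← Path.map_symm, Path.Homotopic.Quotient.mk_symm,
          Path.Homotopic.Quotient.mk_symm]
        exact pathClass_square_symm h)
    refine ⟨fun w => S (w.1, unitInterval.symm w.2), by fun_prop, fun r t => ?_, fun t => ?_,
      fun t => ?_, fun r => ?_, fun r => ?_⟩
    · have := hk r (unitInterval.symm t)
      rw [slabHeight_of_D hD, unitInterval.coe_symm_eq, sub_right_inj] at this
      exact height_eq_lineMap.1 this
    · simp [hl]
    · simp [hr]
    · simp [ht]
    · simp [hb]
  · obtain ⟨S, hS, hk, hl, hr, hb, ht⟩ := Φ.exists_square (collapse R i) hC α β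
      (fun t => by rw [slabHeight_of_not hD, height_eq_lineMap.2 (hα _)])
      (fun t => by rw [slabHeight_of_not hD, height_eq_lineMap.2 (hβ _)])
      (p.map (inclusion (L.left_mem i)).continuous)
      (fun r => by rw [slabHeight_of_not hD, hp, sub_self, zero_div])
      (q.map (inclusion (L.right_mem i)).continuous)
      (fun r => by rw [slabHeight_of_not hD, hq, div_self h2]) h
    refine ⟨S, hS, fun r t => ?_, hl, hr, hb, ht⟩
    have := hk r t
    rw [slabHeight_of_not hD] at this
    exact height_eq_lineMap.1 this

/-! ### Gluing sections over the intervals -/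

/-- Induction on the upper level. The assumption `0 < n` matters: for `n = 0` the point `s₀` lies in
no interval, as there are none. -/
theorem exists_mem_interval (hn : 0 < n) {t : ℝ} (ht : t ∈ Icc (L.s 0) (L.s (Fin.last n))) :
    ∃ i, t ∈ L.interval i := by
  have key : ∀ j : Fin (n + 1), t ≤ L.s j → (∃ i, t ∈ L.interval i) ∨ t ≤ L.s 0 := by
    intro j
    induction j using Fin.induction with
    | zero => exact fun h => Or.inr h
    | succ i ih =>
      intro h
      rcases le_total (L.s i.castSucc) t with h' | h'
      · exact Or.inl ⟨i, h', h⟩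
      · exact ih h'
  rcases key _ ht.2 with h | h
  · exact h
  · have : NeZero n := ⟨hn.ne'⟩
    refine ⟨0, ?_⟩
    have e : t = L.s 0 := le_antisymm h ht.1
    rw [e]
    exact L.left_mem 0

theorem interval_overlap {i j : Fin n} {t : ℝ} (hi : t ∈ L.interval i) (hj : t ∈ L.interval j)
    (hij : i < j) : i.succ = j.castSucc ∧ t = L.s i.succ := by
  have h1 : i.succ ≤ j.castSucc := by
    rw [Fin.le_def]; simpa using hij
  have h2 : L.s i.succ ≤ L.s j.castSucc := L.strictMono.monotone h1
  have h3 : L.s i.succ = L.s j.castSucc := le_antisymm h2 (hj.1.trans hi.2)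
  exact ⟨L.strictMono.injective h3, le_antisymm hi.2 (h3.le.trans hj.1)⟩

/-- Continuous families over the intervals `[sᵢ, sᵢ₊₁]` that agree at the common levels glue. -/
theorem exists_glue (hn : 0 < n) {J : Set ℝ} (hJ : J ⊆ Icc (L.s 0) (L.s (Fin.last n)))
    {Z : Type*} [TopologicalSpace Z] (φ : Fin n → Z × I → Y) (hφ : ∀ i, Continuous (φ i))
    (hφs : ∀ i j : Fin n, i.succ = j.castSucc → ∀ z, φ i (z, 1) = φ j (z, 0)) :
    ∃ Ψ : Z × J → Y, Continuous Ψ ∧ ∀ (i : Fin n) (z : Z) (t : I) (u : J),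
      (u : ℝ) = AffineMap.lineMap (L.s i.castSucc) (L.s i.succ) (t : ℝ) →
        Ψ (z, u) = φ i (z, t) := by
  let ρ : Fin n → ℝ → I := fun i u =>
    projIcc 0 1 zero_le_one ((u - L.s i.castSucc) / (L.s i.succ - L.s i.castSucc))
  have hρ : ∀ i, Continuous (ρ i) := fun i => by fun_prop
  have hρ0 : ∀ i, ρ i (L.s i.castSucc) = 0 := fun i => by
    simp only [ρ, sub_self, zero_div]; exact projIcc_left zero_le_one
  have hρ1 : ∀ i, ρ i (L.s i.succ) = 1 := fun i => by
    simp only [ρ]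
    rw [div_self (sub_ne_zero.2 (L.lt_succ i).ne')]; exact projIcc_right zero_le_one
  have agree : ∀ i j (u : ℝ) (z : Z), u ∈ L.interval i → u ∈ L.interval j → i < j →
      φ i (z, ρ i u) = φ j (z, ρ j u) := by
    intro i j u z hi hj hij
    obtain ⟨h1, h2⟩ := interval_overlap hi hj hij
    have h3 : u = L.s j.castSucc := by rw [h2, h1]
    rw [h2, hρ1, hφs i j h1, ← h2, h3, hρ0]
  -- Any interval containing `u` may be used: two of them can meet only in a common level, where
  -- `agree` applies. Continuity then follows from the finite closed cover by the intervals.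
  choose idx hidx using fun u : J => exists_mem_interval hn (hJ u.2)
  let Ψ : Z × J → Y := fun w => φ (idx w.2) (w.1, ρ (idx w.2) w.2)
  have hΨ : ∀ i (z : Z) (u : J), (u : ℝ) ∈ L.interval i → Ψ (z, u) = φ i (z, ρ i u) := by
    intro i z u hu
    rcases lt_trichotomy (idx u) i with h | h | h
    · exact agree _ _ _ _ (hidx u) hu h
    · simp only [Ψ, h]
    · exact (agree _ _ _ _ hu (hidx u) h).symm
  refine ⟨Ψ, ?_, fun i z t u hu => ?_⟩
  · refine (locallyFinite_of_finite
      (fun i : Fin n => {w : Z × J | (w.2 : ℝ) ∈ L.interval i})).continuous ?_ ?_ ?_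
    · exact iUnion_eq_univ_iff.2 fun w => ⟨idx w.2, hidx w.2⟩
    · exact fun i => isClosed_Icc.preimage (continuous_subtype_val.comp continuous_snd)
    · intro i
      have : ContinuousOn (fun w : Z × J => φ i (w.1, ρ i w.2))
          {w : Z × J | (w.2 : ℝ) ∈ L.interval i} := by
        have := hφ i
        have := hρ i
        fun_prop
      exact this.congr fun w hw => hΨ i w.1 w.2 hw
  · have h1 : (u : ℝ) ∈ L.interval i := by
      rw [hu]; exact (convex_Icc _ _).lineMap_mem (L.left_mem i) (L.right_mem i) t.2
    rw [hΨ i z u h1]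
    congr 2
    simp only [ρ]
    rw [height_eq_lineMap.2 hu, projIcc_val]

variable {J : Set ℝ} (hJ : Icc (L.s 0) (L.s (Fin.last n)) ⊆ J)

/-- Arcs over the intervals `[sᵢ, sᵢ₊₁]` glue to a section. -/
theorem exists_sec_of_arcs (hn : 0 < n) (hJ' : J ⊆ Icc (L.s 0) (L.s (Fin.last n)))
    (x : ∀ j, L.X g j)
    (α : ∀ i, Path (inclusion (L.left_mem i) (x i.castSucc)) (inclusion (L.right_mem i) (x i.succ)))
    (hα : ∀ i t, g (α i t).1 = AffineMap.lineMap (L.s i.castSucc) (L.s i.succ) (t : ℝ)) :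
    ∃ δ : Sec g J, (∀ j, eval hJ j δ = x j) ∧
      ∀ i t, arc hJ δ i (L.left_mem i) (L.right_mem i) t = α i t := by
  obtain ⟨Ψ, hΨ, hΨα⟩ := exists_glue (L := L) hn hJ' (Z := Unit)
    (fun i w => (α i w.2).1) (fun i => by fun_prop) (by
      intro i j hij _
      simp only [Path.source, Path.target]
      change (x i.succ).1 = (x j.castSucc).1
      rw [hij])
  have hg : ∀ u : J, g (Ψ ((), u)) = u := by
    intro u
    obtain ⟨i, hi⟩ := exists_mem_interval hn (hJ' u.2)
    have hmem : ((u : ℝ) - L.s i.castSucc) / (L.s i.succ - L.s i.castSucc) ∈ Icc (0 : ℝ) 1 :=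
      ⟨div_nonneg (sub_nonneg.2 hi.1) (sub_nonneg.2 (L.lt_succ i).le),
        (div_le_one (sub_pos.2 (L.lt_succ i))).2 (by linarith [hi.2])⟩
    have e := (height_eq_lineMap (L := L) (i := i)).1
      (rfl : ((u : ℝ) - L.s i.castSucc) / (L.s i.succ - L.s i.castSucc) = _)
    rw [hΨα i () ⟨_, hmem⟩ u e, hα]
    exact e.symm
  let δ : Sec g J := ⟨⟨fun u => Ψ ((), u), by fun_prop⟩, hg⟩
  have harc : ∀ i t, arc hJ δ i (L.left_mem i) (L.right_mem i) t = α i t := fun i t =>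
    Subtype.ext (hΨα i () t _ rfl)
  refine ⟨δ, fun j => ?_, harc⟩
  rcases Fin.eq_castSucc_or_eq_last j with ⟨i, rfl⟩ | rfl
  · have := harc i 0
    rw [Path.source, Path.source] at this
    exact Subtype.ext (congrArg (fun z : L.W g i => z.1) this :)
  · obtain ⟨m, rfl⟩ := Nat.exists_eq_succ_of_ne_zero hn.ne'
    have := harc (Fin.last m) 1
    rw [Path.target, Path.target] at this
    exact Subtype.ext (congrArg (fun z : L.W g (Fin.last m) => z.1) this :)

/-- Families of sections over the intervals `[sᵢ, sᵢ₊₁]` glue to a path in the space of sections. -/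
theorem exists_path_of_squares (hn : 0 < n) (hJ' : J ⊆ Icc (L.s 0) (L.s (Fin.last n)))
    (δ δ' : Sec g J) (p : ∀ j, I → L.X g j)
    (S : ∀ i, I × I → L.W g i) (hS : ∀ i, Continuous (S i))
    (hg : ∀ i r t, g (S i (r, t)).1 = AffineMap.lineMap (L.s i.castSucc) (L.s i.succ) (t : ℝ))
    (hl : ∀ i t, S i (0, t) = arc hJ δ i (L.left_mem i) (L.right_mem i) t)
    (hr : ∀ i t, S i (1, t) = arc hJ δ' i (L.left_mem i) (L.right_mem i) t)
    (hb : ∀ i r, S i (r, 0) = inclusion (L.left_mem i) (p i.castSucc r))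
    (ht : ∀ i r, S i (r, 1) = inclusion (L.right_mem i) (p i.succ r)) :
    ∃ P : Path δ δ', ∀ j r, eval hJ j (P r) = p j r := by
  obtain ⟨Ψ, hΨ, hΨS⟩ := exists_glue (L := L) hn hJ' (Z := I)
    (fun i w => (S i w).1) (fun i => by have := hS i; fun_prop) (by
      intro i j hij r
      rw [ht, hb]
      change (p i.succ r).1 = (p j.castSucc r).1
      rw [hij])
  have hex : ∀ u : J, ∃ (i : Fin n) (t : I),
      (u : ℝ) = AffineMap.lineMap (L.s i.castSucc) (L.s i.succ) (t : ℝ) := by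
    intro u
    obtain ⟨i, hi⟩ := exists_mem_interval hn (hJ' u.2)
    have hmem : ((u : ℝ) - L.s i.castSucc) / (L.s i.succ - L.s i.castSucc) ∈ Icc (0 : ℝ) 1 :=
      ⟨div_nonneg (sub_nonneg.2 hi.1) (sub_nonneg.2 (L.lt_succ i).le),
        (div_le_one (sub_pos.2 (L.lt_succ i))).2 (by linarith [hi.2])⟩
    exact ⟨i, ⟨_, hmem⟩, (height_eq_lineMap (L := L) (i := i)).1 rfl⟩
  have hgΨ : ∀ r (u : J), g (Ψ (r, u)) = u := by
    intro r u
    obtain ⟨i, t, e⟩ := hex u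
    rw [hΨS i r t u e, hg, e]
  have hend : ∀ (ε : Sec g J) (r : I),
      (∀ i t, S i (r, t) = arc hJ ε i (L.left_mem i) (L.right_mem i) t) →
      ∀ u, Ψ (r, u) = ε.1 u := by
    intro ε r h u
    obtain ⟨i, t, e⟩ := hex u
    rw [hΨS i r t u e, h]
    exact congrArg ε.1 (Subtype.ext e.symm)
  refine ⟨⟨⟨fun r => ⟨⟨fun u => Ψ (r, u), by fun_prop⟩, hgΨ r⟩, ?_⟩, ?_, ?_⟩, fun j r => ?_⟩
  · exact Continuous.subtype_mk
      (ContinuousMap.continuous_of_continuous_uncurry _ (by exact hΨ)) _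
  · exact Subtype.ext (ContinuousMap.ext (hend δ 0 hl))
  · exact Subtype.ext (ContinuousMap.ext (hend δ' 1 hr))
  · rcases Fin.eq_castSucc_or_eq_last j with ⟨i, rfl⟩ | rfl
    · refine Subtype.ext ((hΨS i r 0 _ (by simp)).trans ?_)
      rw [hb]; rfl
    · obtain ⟨m, rfl⟩ := Nat.exists_eq_succ_of_ne_zero hn.ne'
      refine Subtype.ext ((hΨS (Fin.last m) r 1 _ (by simp)).trans ?_)
      rw [ht]; rfl

end Levels

/-- A bijection from the set of orbits to a set `F`, determined by a surjective parametrisation. -/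
theorem existsUnique_orbit_equiv {G M F D : Type*} [Group G] [MulAction G M] (coll : D → M)
    (cls : D → F) (hcoll : Function.Surjective coll) (hcls : Function.Surjective cls)
    (h : ∀ d d', cls d = cls d' ↔ ∃ a : G, a • coll d' = coll d) :
    ∃! Θ : MulAction.orbitRel.Quotient G M ≃ F, ∀ d, Θ (Quotient.mk _ (coll d)) = cls d := by
  have hq : ∀ d d', (Quotient.mk _ (coll d) : MulAction.orbitRel.Quotient G M) =
      Quotient.mk _ (coll d') ↔ cls d = cls d' := fun d d' => by
    rw [h]; exact Quotient.eq
  -- `Θ₀` sends a label to the class of a chosen preimage; `hq` shows that neither the preimage nor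
  -- the point of the orbit matters.
  choose u hu using hcoll
  let Θ₀ : MulAction.orbitRel.Quotient G M → F := Quotient.lift (fun m => cls (u m)) (by
    intro m m' hm
    refine (hq _ _).1 ?_
    rw [hu, hu]; exact Quotient.sound hm)
  have hΘ₀ : ∀ d, Θ₀ (Quotient.mk _ (coll d)) = cls d := fun d =>
    (hq _ _).1 (by rw [hu])
  have hbij : Function.Bijective Θ₀ := by
    constructor
    · intro c c'
      induction c using Quotient.inductionOn with | _ m
      induction c' using Quotient.inductionOn with | _ m'
      intro e
      have := (hq (u m) (u m')).2 e
      rwa [hu, hu] at this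
    · intro c
      obtain ⟨d, rfl⟩ := hcls c
      exact ⟨_, hΘ₀ d⟩
  refine ⟨Equiv.ofBijective Θ₀ hbij, hΘ₀, fun Θ hΘ => Equiv.ext fun c => ?_⟩
  induction c using Quotient.inductionOn with | _ m
  have h1 := hΘ (u m)
  have h2 := hΘ₀ (u m)
  rw [hu] at h1 h2
  exact h1.trans h2.symm

theorem joined_of_mk_eq {A : Type*} [TopologicalSpace A] {x y : A}
    (h : ZerothHomotopy.mk x = ZerothHomotopy.mk y) : Joined x y :=
  Quotient.exact h

theorem mk_eq_of_joined {A : Type*} [TopologicalSpace A] {x y : A} (h : Joined x y) :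
    ZerothHomotopy.mk x = ZerothHomotopy.mk y :=
  Quotient.sound h

namespace Levels

variable {n : ℕ} {L : Levels n} {Y : Type*} [TopologicalSpace Y] {g : Y → ℝ}
  {J : Set ℝ} (hJ : Icc (L.s 0) (L.s (Fin.last n)) ⊆ J)

/-! ### Collapse of loops and sections in terms of path classes -/

/-- The image of a loop at level `sⱼ` under the collapse map, as a path class. -/
def loopClass (R : L.Retractions g) (i : Fin n) {j : Fin (n + 1)} (hj : L.s j ∈ L.interval i)
    {x : L.X g j} (τ : Pi1 (L.X g j) x) :
    Path.Homotopic.Quotient (collapse R i (inclusion hj x)) (collapse R i (inclusion hj x)) :=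
  Path.Homotopic.Quotient.map (FundamentalGroup.toPath τ.unop) ((collapse R i).comp (inclusion hj))

theorem loopCollapse_unop (R : L.Retractions g) (b : Sec g J) (i : Fin n) {j : Fin (n + 1)}
    (hj : L.s j ∈ L.interval i) (τ : Pi1 (L.X g j) (eval hJ j b)) :
    FundamentalGroup.toPath (loopCollapse hJ R b i hj τ).unop =
      (Path.Homotopic.Quotient.mk (tether hJ R b i hj)).symm.trans
        ((loopClass R i hj τ).trans (.mk (tether hJ R b i hj))) := rfl

/-- The class of the collapse of a section, which agrees with `b` at the levels, over
`[sᵢ, sᵢ₊₁]`. -/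
def arcClass (R : L.Retractions g) (b δ : Sec g J)
    (h : ∀ j, eval (L := L) hJ j δ = eval hJ j b) (i : Fin n) :
    Path.Homotopic.Quotient (collapse R i (inclusion (L.left_mem i) (eval hJ i.castSucc b)))
      (collapse R i (inclusion (L.right_mem i) (eval hJ i.succ b))) :=
  .mk (((arc hJ δ i (L.left_mem i) (L.right_mem i)).cast (by rw [h]) (by rw [h])).map
    (collapse R i).continuous)

theorem sectionCollapse_unop (R : L.Retractions g) (b δ : Sec g J)
    (h : ∀ j, eval (L := L) hJ j δ = eval hJ j b) (i : Fin n) :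
    FundamentalGroup.toPath (sectionCollapse hJ R b δ h i).unop =
      ((Path.Homotopic.Quotient.mk (tether hJ R b i (L.left_mem i))).symm.trans
        (arcClass hJ R b δ h i)).trans (.mk (tether hJ R b i (L.right_mem i))) := rfl

/-- The action on collapsed sections, in terms of path classes. -/
theorem smul_sectionCollapse_eq_iff (R : L.Retractions g) (b δ δ' : Sec g J)
    (h : ∀ j, eval (L := L) hJ j δ = eval hJ j b) (h' : ∀ j, eval (L := L) hJ j δ' = eval hJ j b)
    (τ : LoopGroup (L := L) hJ b) :
    τ • sectionCollapse hJ R b δ' h' = sectionCollapse hJ R b δ h ↔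
      ∀ i, (loopClass R i (L.left_mem i) (τ i.castSucc)).trans (arcClass hJ R b δ' h' i) =
        (arcClass hJ R b δ h i).trans (loopClass R i (L.right_mem i) (τ i.succ)) := by
  -- Moving the inverse to the other side turns the action into an equality of two products, hence
  -- of two concatenated path classes.
  have key : ∀ i, (τ • sectionCollapse hJ R b δ' h') i = sectionCollapse hJ R b δ h i ↔
      loopCollapse hJ R b i (L.left_mem i) (τ i.castSucc) * sectionCollapse hJ R b δ' h' i =
        sectionCollapse hJ R b δ h i * loopCollapse hJ R b i (L.right_mem i) (τ i.succ) :=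
    fun i => mul_inv_eq_iff_eq_mul
  refine Iff.trans ⟨fun e i => congrFun e i, fun e => funext e⟩ (forall_congr' fun i => ?_)
  rw [key, ← MulOpposite.unop_inj]
  have e₁ : FundamentalGroup.toPath (loopCollapse hJ R b i (L.left_mem i) (τ i.castSucc) *
      sectionCollapse hJ R b δ' h' i).unop =
      (FundamentalGroup.toPath (loopCollapse hJ R b i (L.left_mem i) (τ i.castSucc)).unop).trans
        (FundamentalGroup.toPath (sectionCollapse hJ R b δ' h' i).unop) := rfl
  have e₂ : FundamentalGroup.toPath (sectionCollapse hJ R b δ h i *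
      loopCollapse hJ R b i (L.right_mem i) (τ i.succ)).unop =
      (FundamentalGroup.toPath (sectionCollapse hJ R b δ h i).unop).trans
        (FundamentalGroup.toPath
          (loopCollapse hJ R b i (L.right_mem i) (τ i.succ)).unop) := rfl
  change FundamentalGroup.toPath _ = FundamentalGroup.toPath _ ↔ _
  rw [e₁, e₂, loopCollapse_unop, loopCollapse_unop, sectionCollapse_unop, sectionCollapse_unop]
  -- The inner tethers cancel, and the outer ones occur equally on both sides. Nothing about the
  -- tethers is used beyond their end points.
  generalize Path.Homotopic.Quotient.mk (tether hJ R b i (L.left_mem i)) = l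
  generalize Path.Homotopic.Quotient.mk (tether hJ R b i (L.right_mem i)) = r
  have a₁ : ∀ {x : L.X g (L.plus i)}
      (c : Path.Homotopic.Quotient (collapse R i (inclusion (L.left_mem i) (eval hJ i.castSucc b))) x),
      l.trans (l.symm.trans c) = c := fun c => by
    rw [← Path.Homotopic.Quotient.trans_assoc, Path.Homotopic.Quotient.trans_symm,
      Path.Homotopic.Quotient.refl_trans]
  have a₂ : ∀ {x : L.X g (L.plus i)}
      (c : Path.Homotopic.Quotient (collapse R i (inclusion (L.right_mem i) (eval hJ i.succ b))) x),
      r.trans (r.symm.trans c) = c := fun c => by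
    rw [← Path.Homotopic.Quotient.trans_assoc, Path.Homotopic.Quotient.trans_symm,
      Path.Homotopic.Quotient.refl_trans]
  simp only [Path.Homotopic.Quotient.trans_assoc, a₁, a₂]
  constructor
  · intro e
    have e' := pathClass_trans_left_cancel e
    rw [← Path.Homotopic.Quotient.trans_assoc, ← Path.Homotopic.Quotient.trans_assoc] at e'
    exact pathClass_trans_right_cancel e'
  · intro e
    rw [← Path.Homotopic.Quotient.trans_assoc (arcClass hJ R b δ h i), ← e,
      Path.Homotopic.Quotient.trans_assoc]

theorem arc_congr {ε ε' : Sec g J} (h : ε = ε') {i : Fin n} {j k : Fin (n + 1)}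
    (hj : L.s j ∈ L.interval i) (hk : L.s k ∈ L.interval i) (t : I) :
    arc hJ ε i hj hk t = arc hJ ε' i hj hk t := by
  subst h; rfl

/-! ### The three comparison statements -/

theorem continuous_arc (hJ' : J ⊆ Icc (L.s 0) (L.s (Fin.last n))) {Z : Type*}
    [TopologicalSpace Z] {P : Z → Sec g J} (hP : Continuous P) (i : Fin n) :
    Continuous fun w : Z × I => arc hJ (P w.1) i (L.left_mem i) (L.right_mem i) w.2 := by
  -- `J` is now a compact interval, which makes evaluation of maps on `J` jointly continuous.
  obtain rfl : J = Icc (L.s 0) (L.s (Fin.last n)) := hJ'.antisymm hJ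
  refine Continuous.subtype_mk ?_ _
  refine Continuous.eval (f := fun w : Z × I => (P w.1).1) (by fun_prop) ?_
  refine Continuous.subtype_mk ?_ _
  exact AffineMap.lineMap_continuous.comp (continuous_subtype_val.comp continuous_snd)

/-- A path of sections between sections that agree with `b` at the levels relates their collapses
by the action of the loops traced at the levels. -/
theorem smul_eq_of_path (hJ' : J ⊆ Icc (L.s 0) (L.s (Fin.last n))) (R : L.Retractions g)
    (b δ δ' : Sec g J) (h : ∀ j, eval (L := L) hJ j δ = eval hJ j b)
    (h' : ∀ j, eval (L := L) hJ j δ' = eval hJ j b) (P : Path δ δ') :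
    (fun j => MulOpposite.op (FundamentalGroup.fromPath (.mk
      ((P.map (eval (L := L) hJ j).continuous).cast (h j).symm (h' j).symm))) :
        LoopGroup (L := L) hJ b) • sectionCollapse hJ R b δ' h' = sectionCollapse hJ R b δ h := by
  rw [smul_sectionCollapse_eq_iff]
  intro i
  -- One direction of the square is the parameter of `P`, the other runs along `[sᵢ, sᵢ₊₁]`. Its
  -- edges are the two collapsed arcs and the two collapsed loops traced at the levels.
  refine square_relation
    (fun w => collapse R i (arc hJ (P w.1) i (L.left_mem i) (L.right_mem i) w.2)) ?_ _ _ _ _ ?_ ?_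
      ?_ ?_
  · exact (collapse R i).continuous.comp (continuous_arc hJ hJ' P.continuous i)
  · intro r
    simp only [Path.source]
    rfl
  · exact fun t => congrArg (collapse R i) (arc_congr hJ P.target _ _ t)
  · exact fun t => congrArg (collapse R i) (arc_congr hJ P.source _ _ t)
  · intro r
    simp only [Path.target]
    rfl

/-- If loops at the levels relate the collapses of two sections that agree with `b` at the levels,
then the sections are joined by a path of sections that traces these loops. -/
theorem exists_path_of_smul_eq (hn : 0 < n) (hJ' : J ⊆ Icc (L.s 0) (L.s (Fin.last n)))
    (Φ : ∀ i, Nonempty (L.SlabFlow g i)) (R : L.Retractions g)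
    (b δ δ' : Sec g J) (h : ∀ j, eval (L := L) hJ j δ = eval hJ j b)
    (h' : ∀ j, eval (L := L) hJ j δ' = eval hJ j b)
    (ℓ : ∀ j, Path (eval (L := L) hJ j b) (eval hJ j b))
    (e : (fun j => MulOpposite.op (FundamentalGroup.fromPath (.mk (ℓ j))) :
        LoopGroup (L := L) hJ b) • sectionCollapse hJ R b δ' h' = sectionCollapse hJ R b δ h) :
    ∃ P : Path δ δ', ∀ j r, eval hJ j (P r) = ℓ j r := by
  rw [smul_sectionCollapse_eq_iff] at e
  have hS := fun i => exists_arc_square R (Φ i).some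
    ((arc hJ δ i (L.left_mem i) (L.right_mem i)).cast (by rw [h]) (by rw [h]))
    ((arc hJ δ' i (L.left_mem i) (L.right_mem i)).cast (by rw [h']) (by rw [h']))
    (fun t => δ.2 _) (fun t => δ'.2 _) (ℓ i.castSucc) (ℓ i.succ) (e i)
  choose S h1 h2 h3 h4 h5 h6 using hS
  exact exists_path_of_squares hJ hn hJ' δ δ' (fun j => ℓ j) S h1 h2 h3 h4 h5 h6

/-- Every label is the collapse of a section. -/
theorem exists_sectionCollapse_eq (hn : 0 < n) (hJ' : J ⊆ Icc (L.s 0) (L.s (Fin.last n)))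
    (Φ : ∀ i, Nonempty (L.SlabFlow g i)) (R : L.Retractions g) (b : Sec g J)
    (η : Labels hJ R b) :
    ∃ (δ : Sec g J) (h : ∀ j, eval (L := L) hJ j δ = eval hJ j b),
      sectionCollapse hJ R b δ h = η := by
  -- The label with its two tethers undone, so that collapsing the arc gives back `η i`.
  have hα := fun i => exists_arc R (Φ i).some (eval hJ i.castSucc b) (eval hJ i.succ b)
    ((Path.Homotopic.Quotient.mk (tether hJ R b i (L.left_mem i))).trans
      ((FundamentalGroup.toPath (η i).unop).trans
        (Path.Homotopic.Quotient.mk (tether hJ R b i (L.right_mem i))).symm))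
  choose α h1 h2 using hα
  obtain ⟨δ, hδ, hδα⟩ := exists_sec_of_arcs hJ hn hJ' (fun j => eval hJ j b) α h1
  refine ⟨δ, hδ, funext fun i => MulOpposite.unop_injective ?_⟩
  change FundamentalGroup.toPath _ = FundamentalGroup.toPath _
  have e : arcClass hJ R b δ hδ i = .mk ((α i).map (collapse R i).continuous) := by
    refine congrArg _ (Path.ext (funext fun t => congrArg (collapse R i) (hδα i t)))
  rw [sectionCollapse_unop, e, h2]
  generalize Path.Homotopic.Quotient.mk (tether hJ R b i (L.left_mem i)) = l
  generalize Path.Homotopic.Quotient.mk (tether hJ R b i (L.right_mem i)) = r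
  rw [← Path.Homotopic.Quotient.trans_assoc, Path.Homotopic.Quotient.symm_trans,
    Path.Homotopic.Quotient.refl_trans, Path.Homotopic.Quotient.trans_assoc,
    Path.Homotopic.Quotient.symm_trans, Path.Homotopic.Quotient.trans_refl]

/-- A section can be moved such that its values at the levels move along prescribed paths. -/
theorem exists_path_of_eval_paths (hn : 0 < n) (hJ' : J ⊆ Icc (L.s 0) (L.s (Fin.last n)))
    (Φ : ∀ i, Nonempty (L.SlabFlow g i)) (R : L.Retractions g) (δ : Sec g J) {x : ∀ j, L.X g j}
    (p : ∀ j, Path (eval (L := L) hJ j δ) (x j)) :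
    ∃ (δ' : Sec g J) (P : Path δ δ'), (∀ j, eval (L := L) hJ j δ' = x j) ∧
      ∀ j r, eval hJ j (P r) = p j r := by
  -- The class is the one forced by the square with lower edge `p i.castSucc`, upper edge `p i.succ`
  -- and left edge the old arc.
  have hα := fun i => exists_arc R (Φ i).some (x i.castSucc) (x i.succ)
    ((Path.Homotopic.Quotient.mk ((p i.castSucc).map
        ((collapse R i).comp (inclusion (L.left_mem i))).continuous)).symm.trans
      ((Path.Homotopic.Quotient.mk ((arc hJ δ i (L.left_mem i) (L.right_mem i)).map
        (collapse R i).continuous)).trans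
        (Path.Homotopic.Quotient.mk ((p i.succ).map
        ((collapse R i).comp (inclusion (L.right_mem i))).continuous))))
  choose α h1 h2 using hα
  obtain ⟨δ', hδ', hδα⟩ := exists_sec_of_arcs hJ hn hJ' x α h1
  have hS := fun i => exists_arc_square R (Φ i).some
    (arc hJ δ i (L.left_mem i) (L.right_mem i)) (α i) (fun t => δ.2 _) (h1 i)
    (p i.castSucc) (p i.succ) (by
      rw [h2, ← Path.Homotopic.Quotient.trans_assoc, Path.Homotopic.Quotient.trans_symm,
        Path.Homotopic.Quotient.refl_trans])
  choose S h3 h4 h5 h6 h7 h8 using hS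
  obtain ⟨P, hP⟩ := exists_path_of_squares hJ hn hJ' δ δ' (fun j => p j) S h3 h4 h5
    (fun i t => (h6 i t).trans (hδα i t).symm) h7 h8
  exact ⟨δ', P, hδ', hP⟩

/-- The classes of the values of a section belong to the inverse limit. -/
theorem eval_mem_limit (R : L.Retractions g) (δ : Sec g J) :
    (fun j => ZerothHomotopy.mk (eval (L := L) hJ j δ)) ∈ limit R := fun i =>
  mk_eq_of_joined ⟨tether hJ R δ i (L.minus_mem i)⟩

/-- Points in the path components given by an element of the inverse limit are the values of a
section. -/
theorem exists_sec_of_mem_limit (hn : 0 < n) (hJ' : J ⊆ Icc (L.s 0) (L.s (Fin.last n)))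
    (Φ : ∀ i, Nonempty (L.SlabFlow g i)) (R : L.Retractions g) (x : ∀ j, L.X g j)
    (hx : (fun j => ZerothHomotopy.mk (x j)) ∈ limit R) :
    ∃ δ : Sec g J, ∀ j, eval hJ j δ = x j := by
  have hj : ∀ i, Joined (collapse R i (inclusion (L.minus_mem i) (x (L.minus i))))
      (collapse R i (inclusion (L.plus_mem i) (x (L.plus i)))) := by
    intro i
    have h1 : collapse R i (inclusion (L.plus_mem i) (x (L.plus i))) = x (L.plus i) :=
      (R i).collapse_inclusion (L.plus_mem i) _
    rw [h1]
    exact joined_of_mk_eq (hx i)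
  have hγ : ∀ i, Joined (collapse R i (inclusion (L.left_mem i) (x i.castSucc)))
      (collapse R i (inclusion (L.right_mem i) (x i.succ))) := by
    intro i
    -- The levels are kept as variables here because `plus i` and `minus i` equal the two ends of
    -- the interval only after a case distinction, and the points of the fibres depend on them.
    have key : ∀ (j k : Fin (n + 1)) (hj : L.s j ∈ L.interval i) (hk : L.s k ∈ L.interval i)
        (j' k' : Fin (n + 1)) (hj' : L.s j' ∈ L.interval i) (hk' : L.s k' ∈ L.interval i),
        j = j' → k = k' → Joined (collapse R i (inclusion hj (x j)))
          (collapse R i (inclusion hk (x k))) →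
        Joined (collapse R i (inclusion hj' (x j'))) (collapse R i (inclusion hk' (x k'))) := by
      rintro j k hj hk _ _ hj' hk' rfl rfl h
      exact h
    by_cases hD : L.D i
    · exact key _ _ _ _ _ _ _ _ (by simp [plus, hD]) (by simp [minus, hD]) (hj i).symm
    · exact key _ _ _ _ _ _ _ _ (by simp [minus, hD]) (by simp [plus, hD]) (hj i)
  have hα := fun i => exists_arc R (Φ i).some (x i.castSucc) (x i.succ) (.mk (hγ i).some)
  choose α h1 h2 using hα
  obtain ⟨δ, hδ, -⟩ := exists_sec_of_arcs hJ hn hJ' x α h1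
  exact ⟨δ, hδ⟩

end Levels

/-! ### Sections over `[0, 1]` -/

section NoCriticalPoint

variable {Y : Type*} [TopologicalSpace Y] {g : Y → ℝ}

/-- The flow line of an upward retraction as a section. -/
def flowLine (hg : ∀ y, g y ∈ Icc (0 : ℝ) 1) (ρ : FibrewiseRetraction g 0 1 1)
    (y : Fibre g 0) : Sec g (Icc 0 1) :=
  ⟨⟨fun t => (ρ.H (⟨y.1, hg _⟩, ⟨t.1, t.2.1, by simpa using t.2.2⟩)).1, by fun_prop⟩, fun t => by
    change g (ρ.H (⟨y.1, hg _⟩, ⟨t.1, t.2.1, by simpa using t.2.2⟩)).1 = t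
    rw [ρ.speed_up _ _ (hg _).2, y.2, zero_add, min_eq_right t.2.2]⟩

theorem continuous_flowLine (hg : ∀ y, g y ∈ Icc (0 : ℝ) 1) (ρ : FibrewiseRetraction g 0 1 1) :
    Continuous (flowLine hg ρ) := by
  refine Continuous.subtype_mk (ContinuousMap.continuous_of_continuous_uncurry _ ?_) _
  change Continuous fun w : Fibre g 0 × Icc (0 : ℝ) 1 =>
    (ρ.H (⟨w.1.1, hg _⟩, ⟨w.2.1, w.2.2.1, by simpa using w.2.2.2⟩)).1
  fun_prop

/-- At time `u` the section has at level `t` the value reached from `δ(t - min(t,u))` by flowing up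
for time `min(t,u)`. This is `δ` for `u = 0` and the flow line of `δ(0)` for `u = 1`. -/
theorem joined_flowLine (hg : ∀ y, g y ∈ Icc (0 : ℝ) 1) (ρ : FibrewiseRetraction g 0 1 1)
    (δ : Sec g (Icc 0 1)) {y : Fibre g 0} (hy : δ.1 0 = y.1) : Joined δ (flowLine hg ρ y) := by
  have hmem : ∀ u t : Icc (0 : ℝ) 1, (t : ℝ) - min (t : ℝ) u ∈ Icc (0 : ℝ) 1 := fun u t =>
    ⟨by linarith [min_le_left (t : ℝ) u], by
      have : 0 ≤ min (t : ℝ) u := le_min t.2.1 u.2.1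
      linarith [t.2.2]⟩
  have hmem' : ∀ u t : Icc (0 : ℝ) 1, min (t : ℝ) u ∈ Icc (0 : ℝ) (1 - 0) := fun u t =>
    ⟨le_min t.2.1 u.2.1, (min_le_left _ _).trans (by simpa using t.2.2)⟩
  let Q : I × Icc (0 : ℝ) 1 → Y := fun w =>
    (ρ.H (⟨δ.1 ⟨_, hmem w.1 w.2⟩, hg _⟩, ⟨_, hmem' w.1 w.2⟩)).1
  have hQ : Continuous Q := by fun_prop
  have hQg : ∀ u t, g (Q (u, t)) = t := by
    intro u t
    simp only [Q]
    rw [ρ.speed_up _ _ (hg _).2, δ.2]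
    simp [t.2.2]
  refine ⟨⟨⟨fun u => ⟨⟨fun t => Q (u, t), by fun_prop⟩, hQg u⟩, ?_⟩, ?_, ?_⟩⟩
  · exact Continuous.subtype_mk
      (ContinuousMap.continuous_of_continuous_uncurry _ (by exact hQ)) _
  · refine Subtype.ext (ContinuousMap.ext fun t => ?_)
    change Q (0, t) = δ.1 t
    have h0 : ((⟨_, hmem' 0 t⟩ : Icc (0 : ℝ) (1 - 0)) : ℝ) = 0 := by simp [t.2.1]
    simp only [Q]
    rw [ρ.map_zero _ _ h0]
    refine congrArg δ.1 (Subtype.ext ?_)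
    simp [t.2.1]
  · refine Subtype.ext (ContinuousMap.ext fun t => ?_)
    change Q (1, t) = _
    simp only [Q, flowLine, ContinuousMap.coe_mk]
    congr 3
    · apply Subtype.ext
      rw [← hy]
      change δ.1 _ = δ.1 0
      congr 1
      ext
      simp [t.2.2]
    · ext
      simp [t.2.2]

end NoCriticalPoint

section Cobordism

variable {d : ℕ} {X : Type*} [TopologicalSpace X] [ChartedSpace (EuclideanQuadrant (d + 1)) X]
  {W : BoundaryCobordism d X} {f : X → ℝ} {n : ℕ} (S : Subdivision W f n)

namespace Subdivision

theorem subset_symm (hn : 0 < n) :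
    Icc (0 : ℝ) 1 ⊆ Icc (S.levels.s 0) (S.levels.s (Fin.last n)) :=
  Icc_subset_Icc S.s_zero.le (S.s_last hn).ge

theorem range_Pi0_subset (R : S.levels.Retractions f) : range S.Pi0 ⊆ Levels.limit R := by
  rintro _ ⟨c, rfl⟩
  induction c using ZerothHomotopy.rec with | _ δ
  exact Levels.eval_mem_limit S.subset R δ

/-- For `n = 0` the only level is `0`, which does not span `[0,1]`, so gluing arcs says nothing and
the flow line through the given point serves as the section. -/
theorem range_Pi0_eq (Φ : ∀ i, Nonempty (S.levels.SlabFlow f i))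
    (hf : ∀ x, f x ∈ Icc (0 : ℝ) 1) (h0 : n = 0 → Nonempty (FibrewiseRetraction f 0 1 1))
    (R : S.levels.Retractions f) : range S.Pi0 = Levels.limit R := by
  refine (S.range_Pi0_subset R).antisymm fun Ψ hΨ => ?_
  choose x hx using fun j => Quotient.exists_rep (Ψ j)
  obtain rfl : (fun j => ZerothHomotopy.mk (x j)) = Ψ := funext hx
  rcases Nat.eq_zero_or_pos n with rfl | hn
  · obtain ⟨ρ⟩ := h0 rfl
    refine ⟨.mk (flowLine hf ρ ⟨(x 0).1, (x 0).2.trans S.s_zero⟩), funext fun j => ?_⟩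
    obtain rfl : j = 0 := Fin.eq_zero j
    refine congrArg ZerothHomotopy.mk (Subtype.ext ?_)
    have h1 := ρ.map_zero ⟨(x 0).1, hf _⟩ ⟨S.levels.s 0, by
      change S.s 0 ∈ _; rw [S.s_zero]; simp⟩ S.s_zero
    exact (congrArg (fun z : Slab f 0 1 => z.1) h1 :)
  · obtain ⟨δ, hδ⟩ := Levels.exists_sec_of_mem_limit S.subset hn (S.subset_symm hn) Φ R x hΨ
    exact ⟨.mk δ, funext fun j => congrArg ZerothHomotopy.mk (hδ j)⟩

/-- Sections that agree with `b` at the levels parametrise both labels and the fibre, and the two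
induced equivalence relations coincide. For `n = 0` there is just one label, and the fibre is a
point because every section is joined to the flow line of its starting point. -/
theorem existsUnique_equiv (Φ : ∀ i, Nonempty (S.levels.SlabFlow f i))
    (hf : ∀ x, f x ∈ Icc (0 : ℝ) 1) (h0 : n = 0 → Nonempty (FibrewiseRetraction f 0 1 1))
    (R : S.levels.Retractions f) (b : Sec f (Icc 0 1))
    {Ψ : ∀ j, ZerothHomotopy (S.levels.X f j)} (hΨ : S.Pi0 (.mk b) = Ψ) :
    ∃! Θ : MulAction.orbitRel.Quotient (Levels.LoopGroup S.subset b)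
        (Levels.Labels S.subset R b) ≃ {c // S.Pi0 c = Ψ},
      ∀ (δ : Sec f (Icc 0 1)) (h : ∀ j, Levels.eval S.subset j δ = Levels.eval S.subset j b),
        (Θ (Quotient.mk _ (Levels.sectionCollapse S.subset R b δ h))).1 = .mk δ := by
  let D := {δ : Sec f (Icc 0 1) // ∀ j, Levels.eval S.subset j δ = Levels.eval S.subset j b}
  let coll : D → Levels.Labels S.subset R b := fun δ =>
    Levels.sectionCollapse S.subset R b δ.1 δ.2
  let cls : D → {c // S.Pi0 c = Ψ} := fun δ => ⟨.mk δ.1, by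
    rw [← hΨ]; exact funext fun j => congrArg ZerothHomotopy.mk (δ.2 j)⟩
  have main : Function.Surjective coll ∧ Function.Surjective cls ∧
      ∀ d d', cls d = cls d' ↔ ∃ a : Levels.LoopGroup S.subset b, a • coll d' = coll d := by
    rcases Nat.eq_zero_or_pos n with rfl | hn
    · obtain ⟨ρ⟩ := h0 rfl
      have hlab : ∀ η η' : Levels.Labels S.subset R b, η = η' := fun η η' =>
        funext fun i => i.elim0
      have hb0 : S.levels.s 0 = 0 := S.s_zero
      have hev : ∀ δ : Sec f (Icc 0 1),
          ((Levels.eval (L := S.levels) S.subset 0 δ).1 : X) = δ.1 0 := fun δ =>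
        congrArg δ.1 (Subtype.ext hb0)
      have hjoin : ∀ δ : Sec f (Icc 0 1), S.Pi0 (.mk δ) = Ψ → Joined δ b := by
        intro δ hδ
        have h1 := joined_of_mk_eq (congrFun (hδ.trans hΨ.symm) 0)
        obtain ⟨p⟩ := h1
        let ψ : S.levels.X f 0 → Fibre f 0 := fun y => ⟨y.1, y.2.trans hb0⟩
        have hψ : Continuous ψ := by fun_prop
        have h2 : Joined (flowLine hf ρ (ψ (Levels.eval S.subset 0 δ)))
            (flowLine hf ρ (ψ (Levels.eval S.subset 0 b))) :=
          ⟨p.map ((continuous_flowLine hf ρ).comp hψ)⟩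
        exact ((joined_flowLine hf ρ δ (hev δ).symm).trans h2).trans
          (joined_flowLine hf ρ b (hev b).symm).symm
      refine ⟨fun η => ⟨⟨b, fun _ => rfl⟩, hlab _ _⟩, ?_, fun d d' => ⟨fun _ => ⟨1, hlab _ _⟩,
        fun _ => Subtype.ext (mk_eq_of_joined ((hjoin _ (cls d).2).trans (hjoin _ (cls d').2).symm))⟩⟩
      rintro ⟨c, hc⟩
      induction c using ZerothHomotopy.rec with | _ δ
      exact ⟨⟨b, fun _ => rfl⟩, Subtype.ext (mk_eq_of_joined (hjoin δ hc).symm)⟩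
    · have hJ' := S.subset_symm hn
      refine ⟨fun η => ?_, ?_, fun d d' => ⟨fun h => ?_, fun h => ?_⟩⟩
      · obtain ⟨δ, h, e⟩ := Levels.exists_sectionCollapse_eq S.subset hn hJ' Φ R b η
        exact ⟨⟨δ, h⟩, e⟩
      · rintro ⟨c, hc⟩
        induction c using ZerothHomotopy.rec with | _ δ
        have hp := fun j => joined_of_mk_eq (congrFun (hc.trans hΨ.symm) j)
        obtain ⟨δ', P, h, -⟩ := Levels.exists_path_of_eval_paths S.subset hn hJ' Φ R δ
          (x := fun j => Levels.eval S.subset j b) (fun j => (hp j).some)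
        exact ⟨⟨δ', h⟩, Subtype.ext (mk_eq_of_joined ⟨P.symm⟩)⟩
      · obtain ⟨P⟩ := joined_of_mk_eq (congrArg Subtype.val h)
        exact ⟨_, Levels.smul_eq_of_path S.subset hJ' R b d.1 d'.1 d.2 d'.2 P⟩
      · obtain ⟨a, ha⟩ := h
        choose ℓ hℓ using fun j => Path.Homotopic.Quotient.mk_surjective
          (FundamentalGroup.toPath (a j).unop)
        obtain rfl : (fun j => MulOpposite.op (FundamentalGroup.fromPath (.mk (ℓ j)))) = a :=
          funext fun j => MulOpposite.unop_injective (hℓ j)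
        obtain ⟨P, -⟩ := Levels.exists_path_of_smul_eq S.subset hn hJ' Φ R b d.1 d'.1 d.2 d'.2 ℓ ha
        exact Subtype.ext (mk_eq_of_joined ⟨P⟩)
  obtain ⟨Θ, hΘ, huniq⟩ := existsUnique_orbit_equiv coll cls main.1 main.2.1 main.2.2
  refine ⟨Θ, fun δ h => congrArg Subtype.val (hΘ ⟨δ, h⟩), fun Θ' h' => huniq Θ' fun δ => ?_⟩
  exact Subtype.ext (h' δ.1 δ.2)

end Subdivision

end Cobordism

/-! ### Sections over the circle -/

section CircleValued

theorem circleMap_eq_iff {t t' : ℝ} : circleMap t = circleMap t' ↔ ∃ m : ℤ, t = t' + m := by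
  unfold circleMap
  rw [Circle.exp_eq_exp]
  refine exists_congr fun m => ?_
  have := Real.two_pi_pos.ne'
  constructor
  · intro h
    have h' : 2 * Real.pi * t = 2 * Real.pi * (t' + m) := by linarith
    exact mul_left_cancel₀ this h'
  · rintro rfl; ring

theorem exists_circleMap_eq (a : ℝ) (z : Circle) : ∃ t ∈ Ico a (a + 1), circleMap t = z := by
  obtain ⟨r, hr⟩ := Circle.exp_surjective z
  obtain ⟨m, hm, -⟩ := existsUnique_add_zsmul_mem_Ico one_pos (r / (2 * Real.pi)) a
  refine ⟨_, hm, ?_⟩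
  have : circleMap (r / (2 * Real.pi)) = z := by
    rw [← hr]; unfold circleMap
    rw [mul_div_cancel₀ _ Real.two_pi_pos.ne']
  rw [← this, circleMap_eq_iff]
  exact ⟨m, by simp⟩

variable {X : Type*} [TopologicalSpace X] {f : X → Circle}

/-- An interval of length at least `1` already covers the circle. -/
theorem lift_injective_of_le {a b : ℝ} (h : a + 1 ≤ b) :
    Function.Injective (lift f (Icc a b)) := by
  intro ε ε' e
  refine Subtype.ext (ContinuousMap.ext fun z => ?_)
  obtain ⟨t, ht, rfl⟩ := exists_circleMap_eq a z
  have := congrArg (fun δ : Sec (height f) (Icc a b) =>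
    (δ.1 ⟨t, ht.1, ht.2.le.trans h⟩).1.1) e
  exact this

/-- A family of sections over `[a, a + 1]` with equal ends descends to the circle. -/
theorem exists_circle_family {a b : ℝ} (hab : b = a + 1) {Z : Type*} [TopologicalSpace Z]
    [CompactSpace Z] [T2Space Z] (P : Z → Sec (height f) (Icc a b)) (hP : Continuous P)
    (hends : ∀ z, ((P z).1 ⟨a, le_rfl, by linarith⟩).1.1 = ((P z).1 ⟨b, by linarith, le_rfl⟩).1.1) :
    ∃ Q : Z → CircleSec f, Continuous Q ∧ ∀ z, lift f (Icc a b) (Q z) = P z := by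
  let q : C(Z × Icc a b, Z × Circle) := ⟨Prod.map id (fun t => circleMap t),
    continuous_id.prodMap (continuous_circleMap.comp continuous_subtype_val)⟩
  have hqs : Function.Surjective q := by
    rintro ⟨z, c⟩
    obtain ⟨t, ht, rfl⟩ := exists_circleMap_eq a c
    exact ⟨(z, ⟨t, ht.1, ht.2.le.trans hab.ge⟩), rfl⟩
  -- A continuous surjection from a compact space to a Hausdorff space is closed, hence a quotient
  -- map.
  have hqq : IsQuotientMap q := q.continuous.isClosedMap.isQuotientMap q.continuous hqs
  let F : C(Z × Icc a b, X) := ⟨fun w => ((P w.1).1 w.2).1.1, by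
    have : Continuous fun w : Z × Icc a b => (P w.1).1 w.2 :=
      (continuous_subtype_val.comp (hP.comp continuous_fst)).eval continuous_snd
    fun_prop⟩
  have hsec : ∀ w : Z × Icc a b, f (F w) = circleMap w.2 := fun w => by
    have h1 := ((P w.1).1 w.2).2
    have h2 : ((P w.1).1 w.2).1.2 = w.2 := (P w.1).2 w.2
    rw [h2] at h1
    exact h1
  have hF : Function.FactorsThrough F q := by
    rintro ⟨z, t⟩ ⟨z', t'⟩ h
    obtain ⟨h1, h2⟩ := Prod.mk_inj.1 h
    obtain rfl : z = z' := h1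
    -- Two parameters over the same point of the circle differ by an integer. On an interval of
    -- length `1` this is `0`, or `±1` at the two ends, where `hends` applies.
    have key : ∀ t t' : Icc a b, ∀ m : ℤ, (t : ℝ) = t' + m → t ≤ t' → F (z, t) = F (z, t') := by
      intro t t' m hm hle
      have hle' : (t : ℝ) ≤ t' := hle
      have hm0 : m ≤ 0 := by
        have : (m : ℝ) ≤ 0 := by linarith
        exact_mod_cast this
      have hm1 : -1 ≤ m := by
        have : (-1 : ℝ) ≤ m := by linarith [t.2.1, t'.2.2]
        exact_mod_cast this
      rcases (by omega : m = 0 ∨ m = -1) with rfl | rfl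
      · have : t = t' := Subtype.ext (by simpa using hm)
        rw [this]
      · have hm' : (t : ℝ) = t' + -1 := by simpa using hm
        have e1 : t = ⟨a, le_rfl, by linarith⟩ := Subtype.ext (by
          change (t : ℝ) = a; linarith [t.2.1, t'.2.2])
        have e2 : t' = ⟨b, by linarith, le_rfl⟩ := Subtype.ext (by
          change (t' : ℝ) = b; linarith [t.2.1, t'.2.2])
        rw [e1, e2]
        exact hends z
    obtain ⟨m, hm⟩ := circleMap_eq_iff.1 h2
    rcases le_total t t' with hle | hle
    · exact key t t' m hm hle
    · exact (key t' t (-m) (by push_cast; linarith) hle).symm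
  let G : C(Z × Circle, X) := hqq.lift F hF
  have hG : ∀ w, G (q w) = F w := fun w => congrArg (fun φ => φ w) (hqq.lift_comp F hF)
  refine ⟨fun z => ⟨⟨fun c => G (z, c), by fun_prop⟩, fun c => ?_⟩, ?_, fun z => ?_⟩
  · obtain ⟨⟨z', t⟩, h⟩ := hqs (z, c)
    change f (G (z, c)) = c
    rw [← h, hG, hsec]
    exact (Prod.mk_inj.1 h).2
  · exact Continuous.subtype_mk
      (ContinuousMap.continuous_of_continuous_uncurry _ (by exact G.continuous)) _
  · refine Subtype.ext (ContinuousMap.ext fun t => Subtype.ext (Prod.ext ?_ ?_))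
    · exact hG (z, t)
    · exact ((P z).2 t).symm

variable {d : ℕ} [ChartedSpace (EuclideanHalfSpace (d + 1)) X]

namespace CircleSubdivision

variable {n : ℕ} (S : CircleSubdivision d f n)

/-- With `n = 0` the condition on the last level would read `s₀ = s₀ + 1`. -/
theorem pos (S : CircleSubdivision d f n) : 0 < n := by
  rcases Nat.eq_zero_or_pos n with rfl | h
  · have := S.s_last
    simp at this
  · exact h

theorem zero_ne_last (S : CircleSubdivision d f n) : (0 : Fin (n + 1)) ≠ Fin.last n :=
  fun h => S.pos.ne (congrArg Fin.val h)

theorem exists_cut_family {Z : Type*} [TopologicalSpace Z] [CompactSpace Z] [T2Space Z]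
    (P : Z → Sec (height f) S.domain) (hP : Continuous P)
    (h : ∀ z, S.ident (Levels.eval subset_rfl 0 (P z)) =
      Levels.eval (L := S.levels) subset_rfl (Fin.last n) (P z)) :
    ∃ Q : Z → CircleSec f, Continuous Q ∧ ∀ z, S.cut (Q z) = P z :=
  exists_circle_family S.s_last P hP fun z =>
    congrArg (fun w : S.levels.X (height f) (Fin.last n) => w.1.1.1) (h z)

theorem cut_injective : Function.Injective S.cut := lift_injective_of_le S.s_last.ge

theorem joined_of_path {ε ε' : CircleSec f} (P : Path (S.cut ε) (S.cut ε'))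
    (h : ∀ r, S.ident (Levels.eval subset_rfl 0 (P r)) =
      Levels.eval (L := S.levels) subset_rfl (Fin.last n) (P r)) : Joined ε ε' := by
  obtain ⟨Q, hQ, hQP⟩ := S.exists_cut_family P P.continuous h
  exact ⟨⟨⟨Q, hQ⟩, S.cut_injective ((hQP 0).trans P.source),
    S.cut_injective ((hQP 1).trans P.target)⟩⟩

theorem exists_cut_eq (δ : Sec (height f) S.domain)
    (h : S.ident (Levels.eval subset_rfl 0 δ) =
      Levels.eval (L := S.levels) subset_rfl (Fin.last n) δ) : ∃ ε, S.cut ε = δ := by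
  obtain ⟨Q, -, hQ⟩ := S.exists_cut_family (Z := Unit) (fun _ => δ) continuous_const fun _ => h
  exact ⟨Q (), hQ ()⟩

theorem range_Pi0_eq (Φ : ∀ i, Nonempty (S.levels.SlabFlow (height f) i))
    (R : S.levels.Retractions (height f)) : range S.Pi0 = S.limit R := by
  refine Subset.antisymm ?_ fun Ψ hΨ => ?_
  · rintro _ ⟨c, rfl⟩
    induction c using ZerothHomotopy.rec with | _ ε
    exact ⟨Levels.eval_mem_limit subset_rfl R (S.cut ε),
      congrArg ZerothHomotopy.mk (S.ident_eval ε)⟩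
  · obtain ⟨hΨ, hΨ'⟩ := hΨ
    choose x₀ hx₀ using fun j => Quotient.exists_rep (Ψ j)
    have hne : (0 : Fin (n + 1)) ≠ Fin.last n := S.zero_ne_last
    -- The limit condition only says that the chosen points at levels `0` and `n` lie in
    -- corresponding components. Replacing the last one by the transport of the first makes the
    -- section close up exactly.
    let x := Function.update x₀ (Fin.last n) (S.ident (x₀ 0))
    have hx0 : x 0 = x₀ 0 := Function.update_of_ne hne _ _
    have hxl : x (Fin.last n) = S.ident (x₀ 0) := Function.update_self _ _ _
    have hx : (fun j => ZerothHomotopy.mk (x j)) = Ψ := by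
      funext j
      rcases eq_or_ne j (Fin.last n) with rfl | hj
      · rw [hxl, ← hΨ', ← hx₀ 0]; rfl
      · exact (congrArg ZerothHomotopy.mk (show x j = x₀ j from Function.update_of_ne hj _ _)).trans
          (hx₀ j)
    obtain ⟨δ, hδ⟩ := Levels.exists_sec_of_mem_limit subset_rfl S.pos subset_rfl Φ R x (hx ▸ hΨ)
    obtain ⟨ε, rfl⟩ := S.exists_cut_eq δ (by rw [hδ, hδ, hx0, hxl])
    refine ⟨.mk ε, ?_⟩
    rw [← hx]
    exact funext fun j => congrArg ZerothHomotopy.mk (hδ j)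

theorem mem_cyclicLoops_iff {b : CircleSec f}
    {a : Levels.LoopGroup (L := S.levels) subset_rfl (S.cut b)} :
    a ∈ S.cyclicLoops b ↔
      (Path.Homotopic.Quotient.map (FundamentalGroup.toPath (a 0).unop) S.ident).cast
        (S.ident_eval b).symm (S.ident_eval b).symm =
      FundamentalGroup.toPath (a (Fin.last n)).unop := by
  change MulOpposite.op (FundamentalGroup.mapOfEq S.ident (S.ident_eval b) (a 0).unop) =
    a (Fin.last n) ↔ _
  rw [← MulOpposite.unop_inj, MulOpposite.unop_op, FundamentalGroup.mapOfEq_apply]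

/-- Every member of the path is a section over the whole circle, so the loops traced at levels `0`
and `n` correspond pointwise, not merely up to homotopy. -/
theorem mem_cyclicLoops_of_path {b δ δ' : CircleSec f} (P : Path δ δ')
    (h : ∀ j, Levels.eval (L := S.levels) subset_rfl j (S.cut δ) =
      Levels.eval subset_rfl j (S.cut b))
    (h' : ∀ j, Levels.eval (L := S.levels) subset_rfl j (S.cut δ') =
      Levels.eval subset_rfl j (S.cut b)) :
    (fun j => MulOpposite.op (FundamentalGroup.fromPath (.mk
      (((P.map (lift f S.domain).continuous).map (Levels.eval (L := S.levels) subset_rfl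
        j).continuous).cast (h j).symm (h' j).symm))) :
          Levels.LoopGroup (L := S.levels) subset_rfl (S.cut b)) ∈ S.cyclicLoops b := by
  rw [mem_cyclicLoops_iff]
  have : ((((P.map (lift f S.domain).continuous).map (Levels.eval (L := S.levels) subset_rfl
        0).continuous).cast (h 0).symm (h' 0).symm).map S.ident.continuous).cast
        (S.ident_eval b).symm (S.ident_eval b).symm =
      (((P.map (lift f S.domain).continuous).map (Levels.eval (L := S.levels) subset_rfl
        (Fin.last n)).continuous).cast (h (Fin.last n)).symm (h' (Fin.last n)).symm) :=
    Path.ext (funext fun r => S.ident_eval (P r))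
  exact congrArg Path.Homotopic.Quotient.mk this

/-- The interval argument applies to the cut sections, provided that the constructed sections and
each member of the constructed paths close up. This holds once the paths or loops at level `n` are
the transports of those at level `0`. -/
theorem existsUnique_equiv (Φ : ∀ i, Nonempty (S.levels.SlabFlow (height f) i))
    (R : S.levels.Retractions (height f)) (b : CircleSec f)
    {Ψ : ∀ j, ZerothHomotopy (S.levels.X (height f) j)} (hΨ : S.Pi0 (.mk b) = Ψ) :
    ∃! Θ : MulAction.orbitRel.Quotient (S.cyclicLoops b)
        (Levels.Labels subset_rfl R (S.cut b)) ≃ {c // S.Pi0 c = Ψ},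
      ∀ (δ : CircleSec f) (h : ∀ j, Levels.eval subset_rfl j (S.cut δ) =
          Levels.eval subset_rfl j (S.cut b)),
        (Θ (Quotient.mk _ (Levels.sectionCollapse subset_rfl R (S.cut b) (S.cut δ) h))).1 =
          .mk δ := by
  have hne : (0 : Fin (n + 1)) ≠ Fin.last n := S.zero_ne_last
  let D := {δ : CircleSec f // ∀ j, Levels.eval (L := S.levels) subset_rfl j (S.cut δ) =
    Levels.eval subset_rfl j (S.cut b)}
  let coll : D → Levels.Labels subset_rfl R (S.cut b) := fun δ =>
    Levels.sectionCollapse subset_rfl R (S.cut b) (S.cut δ.1) δ.2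
  let cls : D → {c // S.Pi0 c = Ψ} := fun δ => ⟨.mk δ.1, by
    rw [← hΨ]; exact funext fun j => congrArg ZerothHomotopy.mk (δ.2 j)⟩
  have hcoll : Function.Surjective coll := by
    intro η
    obtain ⟨δ, h, e⟩ := Levels.exists_sectionCollapse_eq subset_rfl S.pos subset_rfl Φ R _ η
    obtain ⟨ε, rfl⟩ := S.exists_cut_eq δ (by rw [h, h]; exact S.ident_eval b)
    exact ⟨⟨ε, h⟩, e⟩
  have hcls : Function.Surjective cls := by
    rintro ⟨c, hc⟩
    induction c using ZerothHomotopy.rec with | _ δ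
    have hp₀ := fun j => joined_of_mk_eq (congrFun (hc.trans hΨ.symm) j)
    let p₀ : ∀ j, Path (Levels.eval (L := S.levels) subset_rfl j (S.cut δ))
      (Levels.eval subset_rfl j (S.cut b)) := fun j => (hp₀ j).some
    let p := Function.update p₀ (Fin.last n) (((p₀ 0).map S.ident.continuous).cast
      (S.ident_eval δ).symm (S.ident_eval b).symm)
    have hp0 : p 0 = p₀ 0 := Function.update_of_ne hne _ _
    have hpl : p (Fin.last n) = _ := Function.update_self _ _ _
    obtain ⟨δ', P, h, hP⟩ := Levels.exists_path_of_eval_paths subset_rfl S.pos subset_rfl Φ R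
      (S.cut δ) p
    obtain ⟨ε, rfl⟩ := S.exists_cut_eq δ' (by rw [h, h]; exact S.ident_eval b)
    refine ⟨⟨ε, h⟩, Subtype.ext (mk_eq_of_joined (S.joined_of_path P fun r => ?_).symm)⟩
    rw [hP, hP, hp0, hpl]
    rfl
  have hrel : ∀ d d', cls d = cls d' ↔ ∃ a : S.cyclicLoops b, a • coll d' = coll d := by
    intro d d'
    constructor
    · intro h
      obtain ⟨P⟩ := joined_of_mk_eq (congrArg Subtype.val h)
      exact ⟨⟨_, S.mem_cyclicLoops_of_path P d.2 d'.2⟩,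
        Levels.smul_eq_of_path subset_rfl subset_rfl R (S.cut b) _ _ d.2 d'.2
          (P.map (lift f S.domain).continuous)⟩
    · rintro ⟨⟨a, hmem⟩, ha⟩
      rw [mem_cyclicLoops_iff] at hmem
      choose ℓ₀ hℓ₀ using fun j => Path.Homotopic.Quotient.mk_surjective
        (FundamentalGroup.toPath (a j).unop)
      -- Membership in `cyclicLoops` is an equation of homotopy classes, so the representative at
      -- level `n` may be chosen as the transported one without changing `a`.
      let ℓ := Function.update ℓ₀ (Fin.last n) (((ℓ₀ 0).map S.ident.continuous).cast
        (S.ident_eval b).symm (S.ident_eval b).symm)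
      have hl0 : ℓ 0 = ℓ₀ 0 := Function.update_of_ne hne _ _
      have hll : ℓ (Fin.last n) = _ := Function.update_self _ _ _
      obtain rfl : (fun j => MulOpposite.op (FundamentalGroup.fromPath (.mk (ℓ j)))) = a := by
        refine funext fun j => MulOpposite.unop_injective ?_
        change Path.Homotopic.Quotient.mk (ℓ j) = FundamentalGroup.toPath (a j).unop
        rcases eq_or_ne j (Fin.last n) with rfl | hj
        · rw [hll, ← hmem, ← hℓ₀ 0]; rfl
        · rw [← hℓ₀ j, show ℓ j = ℓ₀ j from Function.update_of_ne hj _ _]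
      obtain ⟨P, hP⟩ := Levels.exists_path_of_smul_eq subset_rfl S.pos subset_rfl Φ R (S.cut b)
        _ _ d.2 d'.2 ℓ ha
      refine Subtype.ext (mk_eq_of_joined (S.joined_of_path P fun r => ?_))
      rw [hP, hP, hl0, hll]
      rfl
  obtain ⟨Θ, hΘ, huniq⟩ := existsUnique_orbit_equiv coll cls hcoll hcls hrel
  refine ⟨Θ, fun δ h => congrArg Subtype.val (hΘ ⟨δ, h⟩), fun Θ' h' => huniq Θ' fun δ => ?_⟩
  exact Subtype.ext (h' δ.1 δ.2)

end CircleSubdivision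

end CircleValued

/-! ### Flows of Lipschitz vector fields and invariant sets -/

section Flow

open Metric
open scoped NNReal

variable {E : Type*} [NormedAddCommGroup E] [NormedSpace ℝ E]

/-- `Φ` is the global flow of the vector field `V`. -/
structure IsFlow (V : E → E) (Φ : E → ℝ → E) : Prop where
  zero : ∀ x, Φ x 0 = x
  hasDerivAt : ∀ x t, HasDerivAt (Φ x) (V (Φ x t)) t
  continuous : Continuous fun p : E × ℝ => Φ p.1 p.2

/-- In time `N` a solution starting in the ball of radius `N` moves by at most `M * N`, so
Picard–Lindelöf applies on the ball of radius `M * N + N`. The solutions for different `N` agree by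
uniqueness and exhaust all points and times. -/
theorem exists_isFlow [CompleteSpace E] {V : E → E} {L M : ℝ≥0} (hV : LipschitzWith L V)
    (hM : ∀ x, ‖V x‖ ≤ M) : ∃ Φ, IsFlow V Φ := by
  have key : ∀ N : ℕ, ∃ α : E × ℝ → E, (∀ x ∈ closedBall (0 : E) N, α (x, 0) = x ∧
      ∀ t ∈ Icc (-N : ℝ) N, HasDerivWithinAt (fun t => α (x, t)) (V (α (x, t)))
        (Icc (-N : ℝ) N) t) ∧ ContinuousOn α (closedBall (0 : E) N ×ˢ Icc (-N : ℝ) N) := by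
    intro N
    have h0 : (0 : ℝ) ∈ Icc (-N : ℝ) N := ⟨by simp, by simp⟩
    have hPL : IsPicardLindelof (fun _ => V) (⟨0, h0⟩ : Icc (-N : ℝ) N) 0 (M * N + N) N M L :=
      .of_time_independent (fun x _ => hM x) hV.lipschitzOnWith (by simp)
    exact hPL.exists_forall_mem_closedBall_eq_hasDerivWithinAt_continuousOn
  choose α hα hαc using key
  have hd : ∀ (N : ℕ) (x : E), ‖x‖ ≤ N → ∀ t ∈ Ioo (-N : ℝ) N,
      HasDerivAt (fun t => α N (x, t)) (V (α N (x, t))) t := fun N x hx t ht =>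
    ((hα N x (by simpa using hx)).2 t (Ioo_subset_Icc_self ht)).hasDerivAt (Icc_mem_nhds ht.1 ht.2)
  have huniq : ∀ (N N' : ℕ) (x : E), N ≤ N' → ‖x‖ ≤ N → ∀ t ∈ Ioo (-N : ℝ) N,
      α N (x, t) = α N' (x, t) := by
    intro N N' x hN hx t ht
    have hN' : (N : ℝ) ≤ N' := by exact_mod_cast hN
    refine ODE_solution_unique_of_mem_Ioo (v := fun _ => V) (s := fun _ => univ) (K := L) (t₀ := 0)
      (fun _ _ => hV.lipschitzOnWith) ⟨by linarith [ht.1, ht.2], by linarith [ht.1, ht.2]⟩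
      (fun s hs => ⟨hd N x hx s hs, mem_univ _⟩)
      (fun s hs => ⟨hd N' x (hx.trans hN') s ⟨by linarith [hs.1], by linarith [hs.2]⟩, mem_univ _⟩)
      ?_ ht
    rw [(hα N x (by simpa using hx)).1, (hα N' x (by simpa using hx.trans hN')).1]
  -- An `N` that exceeds both `‖x‖` and `|t|` strictly, so that the local solution is valid in a
  -- neighbourhood of `(x, t)`.
  let n : E → ℝ → ℕ := fun x t => ⌈max ‖x‖ |t|⌉₊ + 1
  have hn : ∀ x t, ‖x‖ < n x t ∧ t ∈ Ioo (-(n x t : ℝ)) (n x t) := by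
    intro x t
    have h := Nat.le_ceil (max ‖x‖ |t|)
    have h1 := le_max_left ‖x‖ |t|
    have h2 := le_max_right ‖x‖ |t|
    have h3 : (n x t : ℝ) = ⌈max ‖x‖ |t|⌉₊ + 1 := by simp [n]
    refine ⟨by linarith, abs_lt.1 (by linarith)⟩
  have hΦ : ∀ (N : ℕ) x t, ‖x‖ ≤ N → t ∈ Ioo (-N : ℝ) N → α (n x t) (x, t) = α N (x, t) := by
    intro N x t hx ht
    rcases le_total N (n x t) with h | h
    · exact (huniq N _ x h hx t ht).symm
    · exact huniq _ N x h (hn x t).1.le t (hn x t).2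
  refine ⟨fun x t => α (n x t) (x, t), fun x => (hα _ x (by simpa using (hn x 0).1.le)).1, ?_, ?_⟩
  · intro x t
    refine (hd _ x (hn x t).1.le t (hn x t).2).congr_of_eventuallyEq ?_
    filter_upwards [Ioo_mem_nhds (hn x t).2.1 (hn x t).2.2] with s hs
    exact hΦ _ x s (hn x t).1.le hs
  · refine continuous_iff_continuousAt.2 fun ⟨x, t⟩ => ?_
    have hball : closedBall (0 : E) (n x t) ∈ 𝓝 x :=
      closedBall_mem_nhds_of_mem (by simpa using (hn x t).1)
    have hx := prod_mem_nhds hball (Ioo_mem_nhds (hn x t).2.1 (hn x t).2.2)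
    refine ContinuousAt.congr ((hαc (n x t)).continuousAt (Filter.mem_of_superset hx
      (prod_mono_right Ioo_subset_Icc_self))) ?_
    filter_upwards [hx] with p hp
    exact (hΦ _ p.1 p.2 (by simpa using hp.1) hp.2).symm

theorem IsFlow.add {V : E → E} {Φ : E → ℝ → E} {L : ℝ≥0} (h : IsFlow V Φ)
    (hV : LipschitzWith L V) (x : E) (t u : ℝ) : Φ (Φ x t) u = Φ x (t + u) := by
  have := ODE_solution_unique_univ (v := fun _ => V) (s := fun _ => univ) (K := L) (t₀ := 0)
    (f := Φ (Φ x t)) (g := fun u => Φ x (t + u)) (fun _ => hV.lipschitzOnWith)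
    (fun u => ⟨h.hasDerivAt _ u, mem_univ _⟩)
    (fun u => ⟨(h.hasDerivAt x (t + u)).comp_const_add t u, mem_univ _⟩)
    (by rw [h.zero, add_zero])
  exact congrFun this u

theorem IsFlow.neg {V : E → E} {Φ : E → ℝ → E} (h : IsFlow V Φ) :
    IsFlow (fun x => -V x) fun x t => Φ x (-t) where
  zero x := by rw [neg_zero, h.zero]
  hasDerivAt x t := by
    have := (h.hasDerivAt x (-t)).scomp t (hasDerivAt_neg t)
    rwa [neg_one_smul] at this
  continuous := h.continuous.comp (continuous_fst.prodMk continuous_snd.neg)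

/-- `v` is subtangential to the set `S` at `z`. -/
def IsSubtangent (S : Set E) (z v : E) : Prop :=
  (fun h : ℝ => infDist (z + h • v) S) =o[𝓝[>] 0] fun h => h

/-- An integral curve of a vector field that is subtangential to a compact set `S` near a point of
`S` stays in `S` for some time. -/
theorem exists_forall_mem_of_isSubtangent {V : E → E} {L : ℝ≥0} (hV : LipschitzWith L V)
    {S N : Set E} (hS : IsCompact S) (hN : IsOpen N)
    (hSN : ∀ z ∈ S, z ∈ N → IsSubtangent S z (V z)) {γ : ℝ → E} {t₀ : ℝ}
    (hγ : ∀ t, HasDerivAt γ (V (γ t)) t) (hS₀ : γ t₀ ∈ S) (hN₀ : γ t₀ ∈ N) :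
    ∃ t₁ > t₀, ∀ t ∈ Icc t₀ t₁, γ t ∈ S := by
  obtain ⟨r, hr, hrN⟩ := Metric.isOpen_iff.1 hN _ hN₀
  have hcont : Continuous γ := continuous_iff_continuousAt.2 fun t => (hγ t).continuousAt
  obtain ⟨δ, hδ, hγδ⟩ := Metric.continuousAt_iff.1 (hcont.continuousAt (x := t₀)) (r / 2)
    (half_pos hr)
  have hne : S.Nonempty := ⟨_, hS₀⟩
  -- The distance to `S` starts at `0` and grows at rate at most `L` times itself, so by Grönwall it
  -- remains `0`.
  have hle := le_gronwallBound_of_liminf_deriv_right_le (f := fun t => infDist (γ t) S)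
    (f' := fun t => L * infDist (γ t) S) (δ := 0) (K := L) (ε := 0) (a := t₀) (b := t₀ + δ / 2)
    ((continuous_infDist_pt S).comp hcont).continuousOn ?_ (infDist_zero_of_mem hS₀).le
    (fun t _ => by simp)
  · refine ⟨t₀ + δ / 2, by linarith, fun t ht => ?_⟩
    have := hle t ht
    rw [gronwallBound_ε0_δ0] at this
    exact (hS.isClosed.mem_iff_infDist_zero hne).2 (le_antisymm this infDist_nonneg)
  · intro t ht c hc
    -- The field at `γ t` is compared with its value at a nearest point `y` of `S`, where it is
    -- subtangential. The point `y` lies in `N` because both `γ t` and its distance to `S` are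
    -- within `r / 2` of `γ t₀` and `0`.
    obtain ⟨y, hy, hty⟩ := hS.exists_infDist_eq_dist hne (γ t)
    have hd : dist (γ t) (γ t₀) < r / 2 := hγδ (by
      rw [Real.dist_eq, abs_of_nonneg (by linarith [ht.1])]; linarith [ht.2])
    have hyN : y ∈ N := hrN (by
      have h1 : dist (γ t) y ≤ dist (γ t) (γ t₀) := hty ▸ infDist_le_dist_of_mem hS₀
      have h2 := dist_triangle y (γ t) (γ t₀)
      rw [dist_comm y (γ t)] at h2
      rw [mem_ball]; linarith)
    -- The slack is divided by three: one share for subtangency at `y`, one for the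
    -- differentiability of `γ`, one to make the inequality strict.
    set ε := (c - L * infDist (γ t) S) / 3 with hε
    have hε0 : 0 < ε := by rw [hε]; linarith
    have h1 := (hSN y hy hyN).def hε0
    have h2 := (hasDerivAt_iff_isLittleO.1 (hγ t)).def hε0
    have hmap : Filter.Tendsto (fun z => z - t) (𝓝[>] t) (𝓝[>] 0) := by
      refine tendsto_nhdsWithin_iff.2 ⟨?_, ?_⟩
      · have : Filter.Tendsto (fun z : ℝ => z - t) (𝓝 t) (𝓝 (t - t)) := by
          exact (continuous_id.sub continuous_const).tendsto t
        rw [sub_self] at this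
        exact this.mono_left nhdsWithin_le_nhds
      · filter_upwards [self_mem_nhdsWithin] with z hz
        exact mem_Ioi.2 (sub_pos.2 (mem_Ioi.1 hz))
    refine Filter.Eventually.frequently ?_
    filter_upwards [hmap.eventually h1, h2.filter_mono nhdsWithin_le_nhds, self_mem_nhdsWithin]
      with z hz1 hz2 hz3
    have hh : 0 < z - t := sub_pos.2 hz3
    rw [Real.norm_of_nonneg infDist_nonneg, Real.norm_of_nonneg hh.le] at hz1
    rw [Real.norm_of_nonneg hh.le] at hz2
    have h3 : infDist (γ z) S ≤ infDist (y + (z - t) • V y) S + dist (γ z) (y + (z - t) • V y) :=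
      infDist_le_infDist_add_dist
    have h4 : dist (γ z) (y + (z - t) • V y) ≤
        ‖γ z - γ t - (z - t) • V (γ t)‖ + (‖γ t - y‖ + ‖(z - t) • (V (γ t) - V y)‖) := by
      rw [dist_eq_norm]
      refine le_trans (le_of_eq ?_) ((norm_add_le _ _).trans (add_le_add le_rfl (norm_add_le _ _)))
      congr 1
      rw [smul_sub]; abel
    have h5 : ‖(z - t) • (V (γ t) - V y)‖ ≤ (z - t) * (L * infDist (γ t) S) := by
      rw [norm_smul, Real.norm_of_nonneg hh.le, hty, ← dist_eq_norm]
      exact mul_le_mul_of_nonneg_left (hV.dist_le_mul _ _) hh.le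
    rw [← dist_eq_norm (γ t) y, ← hty] at h4
    rw [inv_mul_lt_iff₀ hh]
    have : c = 3 * ε + L * infDist (γ t) S := by rw [hε]; ring
    rw [this]
    nlinarith [mul_pos hh hε0]

/-- An integral curve of a vector field stays in the compact set `S` as long as the vector field is
subtangential to `S` near the points that it reaches. -/
theorem forall_mem_of_isSubtangent {V : E → E} {L : ℝ≥0} (hV : LipschitzWith L V)
    {S : Set E} (hS : IsCompact S) {γ : ℝ → E} {T : ℝ} (hγ : ∀ t, HasDerivAt γ (V (γ t)) t)
    (h₀ : γ 0 ∈ S) (h : ∀ t ∈ Ico 0 T, (∀ s ∈ Icc 0 t, γ s ∈ S) → ∃ N, IsOpen N ∧ γ t ∈ N ∧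
      ∀ z ∈ S, z ∈ N → IsSubtangent S z (V z)) : ∀ t ∈ Icc 0 T, γ t ∈ S := by
  have hcont : Continuous γ := continuous_iff_continuousAt.2 fun t => (hγ t).continuousAt
  intro t ht
  have hT : (0 : ℝ) ≤ T := ht.1.trans ht.2
  -- Continuous induction on the times up to which the curve has stayed in `S`; the hypothesis `h`
  -- may use precisely this past.
  let A : Set ℝ := {t | ∀ s ∈ Icc 0 t, γ s ∈ S}
  have hA : Icc 0 T ⊆ A := by
    refine IsClosed.Icc_subset_of_forall_exists_gt (s := A) ?_ ?_ ?_
    · refine IsClosed.inter ?_ isClosed_Icc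
      refine isClosed_of_closure_subset fun t ht s hs => ?_
      rcases hs.2.eq_or_lt with rfl | hlt
      · have hs' : s ∈ closure (γ ⁻¹' S) := by
          rcases hs.1.eq_or_lt with rfl | hpos
          · exact subset_closure h₀
          · refine mem_closure_iff_nhds.2 fun U hU => ?_
            obtain ⟨u, ⟨hu1, hu2⟩, huA⟩ := mem_closure_iff_nhds.1 ht (U ∩ Ioi 0)
              (Filter.inter_mem hU (Ioi_mem_nhds hpos))
            exact ⟨u, hu1, huA u ⟨le_of_lt hu2, le_rfl⟩⟩
        exact (hS.isClosed.preimage hcont).closure_subset hs'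
      · obtain ⟨u, hu1, huA⟩ := mem_closure_iff_nhds.1 ht (Ioi s) (Ioi_mem_nhds hlt)
        exact huA s ⟨hs.1, le_of_lt hu1⟩
    · intro s hs
      rwa [le_antisymm hs.2 hs.1]
    · rintro u ⟨huA, hu⟩ y hy
      obtain ⟨N, hN, huN, hSN⟩ := h u hu huA
      obtain ⟨t₁, ht₁, hmem⟩ := exists_forall_mem_of_isSubtangent hV hS hN hSN hγ
        (huA u ⟨hu.1, le_rfl⟩) huN
      refine ⟨min t₁ y, fun s hs => ?_, lt_min ht₁ hy, min_le_right _ _⟩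
      rcases le_total s u with hsu | hsu
      · exact huA s ⟨hs.1, hsu⟩
      · exact hmem s ⟨hsu, hs.2.trans (min_le_left _ _)⟩
  exact hA ht t ⟨ht.1, le_rfl⟩

end Flow

/-! ### From a flow to a fibrewise retraction and a collared flow -/

section Collapsing

variable {Y F : Type*} [TopologicalSpace Y] [TopologicalSpace F]

/-- The flow `Φ` on `F` moves the points of the slab `g⁻¹([a,b])`, embedded by `(j, g)`, to the end
`g⁻¹(c)` at speed `ς = ±1`, and can be reversed near that end. -/
structure IsCollapsing (g : Y → ℝ) (j : Y → F) (Φ : F → ℝ → F) (a b c ς : ℝ) : Prop where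
  isEmbedding : IsEmbedding fun y => (j y, g y)
  continuous : Continuous fun p : F × ℝ => Φ p.1 p.2
  zero : ∀ x, Φ x 0 = x
  add : ∀ x t u, Φ (Φ x t) u = Φ x (t + u)
  lt : a < b
  sign : ς = 1 ∧ c = b ∨ ς = -1 ∧ c = a
  forward : ∀ y, g y ∈ Icc a b → ∀ u, 0 ≤ u → u ≤ ς * (c - g y) →
    ∃ y', j y' = Φ (j y) u ∧ g y' = g y + ς * u
  backward : ∃ ε > 0, ∀ y, g y = c → ∀ u, 0 ≤ u → u ≤ ε →
    ∃ y', j y' = Φ (j y) (-u) ∧ g y' = g y - ς * u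

namespace IsCollapsing

variable {g : Y → ℝ} {j : Y → F} {Φ : F → ℝ → F} {a b c ς : ℝ}

/-- The time until a point reaches the end. -/
def remaining (_ : IsCollapsing g j Φ a b c ς) (x : Slab g a b) : ℝ := ς * (c - g x.1)

variable (h : IsCollapsing g j Φ a b c ς)

theorem sq_sign (h : IsCollapsing g j Φ a b c ς) : ς * ς = 1 := by
  rcases h.sign with ⟨rfl, -⟩ | ⟨rfl, -⟩ <;> norm_num

theorem remaining_mem (x : Slab g a b) : h.remaining x ∈ Icc 0 (b - a) := by
  have hx := x.2
  unfold remaining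
  rcases h.sign with ⟨rfl, rfl⟩ | ⟨rfl, rfl⟩
  · exact ⟨by linarith [hx.2], by linarith [hx.1]⟩
  · exact ⟨by linarith [hx.1], by linarith [hx.2]⟩

theorem apply_eq (x : Slab g a b) : g x.1 = c - ς * h.remaining x := by
  unfold remaining
  rw [← mul_assoc, h.sq_sign]; ring

theorem mem_of_remaining {v r : ℝ} (h : IsCollapsing g j Φ a b c ς) (hv : v = c - ς * r)
    (hr : r ∈ Icc 0 (b - a)) : v ∈ Icc a b := by
  subst hv
  rcases h.sign with ⟨rfl, rfl⟩ | ⟨rfl, rfl⟩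
  · exact ⟨by linarith [hr.2], by linarith [hr.1]⟩
  · exact ⟨by linarith [hr.1], by linarith [hr.2]⟩

theorem remaining_of_eq {v : Slab g a b} {r : ℝ} (hv : g v.1 = c - ς * r) :
    h.remaining v = r := by
  unfold remaining
  rw [hv, sub_sub_cancel, ← mul_assoc, h.sq_sign, one_mul]

theorem continuous_slab_iff (h : IsCollapsing g j Φ a b c ς) {Z : Type*} [TopologicalSpace Z]
    {φ : Z → Slab g a b} :
    Continuous φ ↔ (Continuous fun z => j (φ z).1) ∧ Continuous fun z => g (φ z).1 := by
  have h1 : Continuous φ ↔ Continuous fun z => (φ z).1 := IsInducing.subtypeVal.continuous_iff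
  exact h1.trans (h.isEmbedding.isInducing.continuous_iff.trans continuous_prodMk)

theorem slab_ext {x y : Slab g a b} (hj : j x.1 = j y.1)
    (hr : h.remaining x = h.remaining y) : x = y := by
  refine Subtype.ext (h.isEmbedding.injective (Prod.ext hj ?_))
  change g x.1 = g y.1
  rw [h.apply_eq, h.apply_eq, hr]

theorem continuous_j (h : IsCollapsing g j Φ a b c ς) : Continuous j :=
  continuous_fst.comp h.isEmbedding.continuous

theorem continuous_g (h : IsCollapsing g j Φ a b c ς) : Continuous g :=
  continuous_snd.comp h.isEmbedding.continuous

theorem continuous_remaining : Continuous h.remaining := by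
  have := h.continuous_g
  unfold remaining
  fun_prop

/-- The time by which a point moves when asked to move by time `s`. -/
def elapsed (x : Slab g a b) (s : ℝ) : ℝ := min (max s 0) (h.remaining x)

theorem elapsed_nonneg (x : Slab g a b) (s : ℝ) : 0 ≤ h.elapsed x s :=
  le_min (le_max_right _ _) (h.remaining_mem x).1

theorem exists_advance (x : Slab g a b) (s : ℝ) : ∃ y : Slab g a b,
    j y.1 = Φ (j x.1) (h.elapsed x s) ∧ h.remaining y = h.remaining x - h.elapsed x s := by
  obtain ⟨y, hy, hgy⟩ := h.forward x.1 x.2 (h.elapsed x s) (h.elapsed_nonneg x s) (min_le_right _ _)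
  have hgy' : g y = c - ς * (h.remaining x - h.elapsed x s) := by
    rw [hgy, h.apply_eq]; ring
  have hx := h.remaining_mem x
  have h0 := h.elapsed_nonneg x s
  have h1 : h.elapsed x s ≤ h.remaining x := min_le_right _ _
  exact ⟨⟨y, h.mem_of_remaining hgy' ⟨by linarith, by linarith [hx.2]⟩⟩, hy, h.remaining_of_eq hgy'⟩

/-- The semiflow on the slab, which stops at the end. -/
def advance (x : Slab g a b) (s : ℝ) : Slab g a b := (h.exists_advance x s).choose

theorem j_advance (x : Slab g a b) (s : ℝ) :
    j (h.advance x s).1 = Φ (j x.1) (h.elapsed x s) := (h.exists_advance x s).choose_spec.1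

theorem remaining_advance (x : Slab g a b) (s : ℝ) :
    h.remaining (h.advance x s) = h.remaining x - h.elapsed x s :=
  (h.exists_advance x s).choose_spec.2

theorem g_advance (x : Slab g a b) (s : ℝ) :
    g (h.advance x s).1 = g x.1 + ς * h.elapsed x s := by
  rw [h.apply_eq, h.remaining_advance, h.apply_eq x]; ring

theorem continuous_advance : Continuous fun w : Slab g a b × ℝ => h.advance w.1 w.2 := by
  have hr := h.continuous_remaining
  have hu : Continuous fun w : Slab g a b × ℝ => h.elapsed w.1 w.2 := by
    unfold elapsed; fun_prop
  have hj := h.continuous_j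
  have hg := h.continuous_g
  refine h.continuous_slab_iff.2 ⟨?_, ?_⟩
  · simp only [h.j_advance]
    exact h.continuous.comp (f := fun w : Slab g a b × ℝ => (j w.1.1, h.elapsed w.1 w.2))
      (by fun_prop)
  · simp only [h.g_advance]
    fun_prop

theorem advance_eq_self {x : Slab g a b} {s : ℝ} (hs : h.elapsed x s = 0) : h.advance x s = x :=
  h.slab_ext (by rw [h.j_advance, hs, h.zero]) (by rw [h.remaining_advance, hs, sub_zero])

theorem advance_advance (x : Slab g a b) {s t : ℝ} (hs : 0 ≤ s) (ht : 0 ≤ t) :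
    h.advance (h.advance x s) t = h.advance x (s + t) := by
  have e : h.elapsed x s + h.elapsed (h.advance x s) t = h.elapsed x (s + t) := by
    unfold elapsed
    rw [h.remaining_advance]
    unfold elapsed
    rw [max_eq_left hs, max_eq_left ht, max_eq_left (add_nonneg hs ht)]
    rcases le_total s (h.remaining x) with h1 | h1
    · rw [min_eq_left h1, ← min_add_add_left]; congr 1; ring
    · rw [min_eq_right h1, sub_self, min_eq_right ht, min_eq_right (by linarith), add_zero]
  exact h.slab_ext (by rw [h.j_advance, h.j_advance, h.j_advance, h.add, e])
    (by rw [h.remaining_advance, h.remaining_advance, h.remaining_advance, ← e]; ring)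

theorem remaining_eq_zero_iff {x : Slab g a b} : h.remaining x = 0 ↔ g x.1 = c := by
  refine ⟨fun e => by rw [h.apply_eq, e]; ring, fun e => h.remaining_of_eq (by rw [e]; ring)⟩

theorem elapsed_of_le {x : Slab g a b} {s : ℝ} (hs : h.remaining x ≤ s) :
    h.elapsed x s = h.remaining x :=
  min_eq_right (hs.trans (le_max_left _ _))

theorem nonempty_fibrewiseRetraction (h : IsCollapsing g j Φ a b c ς) :
    Nonempty (FibrewiseRetraction g a b c) := by
  refine ⟨⟨⟨fun w => h.advance w.1 w.2, ?_⟩, ?_, ?_, ?_, ?_, ?_⟩⟩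
  · exact h.continuous_advance.comp (f := fun w : Slab g a b × Icc (0 : ℝ) (b - a) =>
      (w.1, (w.2 : ℝ))) (by fun_prop)
  · intro x t ht
    refine h.advance_eq_self ?_
    rw [elapsed, ht, max_self, min_eq_left (h.remaining_mem x).1]
  · intro x t hx
    refine h.advance_eq_self ?_
    rw [elapsed, h.remaining_eq_zero_iff.2 hx, min_eq_right (le_max_right _ _)]
  · intro x t hx
    change g (h.advance x t).1 = _
    rw [h.g_advance, elapsed, max_eq_left t.2.1, remaining]
    have := x.2
    rcases h.sign with ⟨rfl, rfl⟩ | ⟨rfl, rfl⟩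
    -- For sign `+1` the end is the top of the slab, so a point at or above the end level lies on it
    -- and does not move.
    · have e : g x.1 = c := le_antisymm this.2 hx
      rw [e, sub_self, mul_zero, min_eq_right t.2.1, max_eq_left (by linarith [t.2.1])]; ring
    · rcases le_total (t : ℝ) (-1 * (c - g x.1)) with h1 | h1
      · rw [min_eq_left h1, max_eq_right (by linarith)]; ring
      · rw [min_eq_right h1, max_eq_left (by linarith)]; ring
  · intro x t hx
    change g (h.advance x t).1 = _
    rw [h.g_advance, elapsed, max_eq_left t.2.1, remaining]
    have := x.2
    rcases h.sign with ⟨rfl, rfl⟩ | ⟨rfl, rfl⟩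
    · rcases le_total (t : ℝ) (1 * (c - g x.1)) with h1 | h1
      · rw [min_eq_left h1, min_eq_right (by linarith)]; ring
      · rw [min_eq_right h1, min_eq_left (by linarith)]; ring
    · have e : g x.1 = c := le_antisymm hx this.1
      rw [e, sub_self, mul_zero, min_eq_right t.2.1, min_eq_left (by linarith [t.2.1])]; ring
  · intro x t u v hv
    change h.advance (h.advance x t) u = h.advance x v
    rw [h.advance_advance x t.2.1 u.2.1, hv]

/-- Running to the end gives `C`, running for time `ℓ * s` gives the semiflow, and running backwards
from the end gives the collar. The collar maps are mutually inverse since `Φ` is a flow of the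
ambient space. -/
theorem nonempty_collaredFlow (h : IsCollapsing g j Φ a b c ς) {k : Slab g a b → ℝ}
    (hk : ∀ x, k x = 1 - ς * (c - g x.1) / (b - a)) (hc : c ∈ Icc a b) :
    Nonempty (CollaredFlow k (inclusion (g := g) hc)) := by
  set ℓ := b - a with hℓ
  have hℓ0 : 0 < ℓ := sub_pos.2 h.lt
  have hk' : ∀ x, k x = 1 - h.remaining x / ℓ := hk
  have hrk : ∀ x, h.remaining x = ℓ * (1 - k x) := fun x => by
    rw [hk']; field_simp; ring
  obtain ⟨ε, hε, hback⟩ := h.backward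
  have hend : ∀ x, g (h.advance x ℓ).1 = c := fun x => h.remaining_eq_zero_iff.1 (by
    rw [h.remaining_advance, h.elapsed_of_le (h.remaining_mem x).2, sub_self])
  let C : C(Slab g a b, Fibre g c) := ⟨fun x => ⟨(h.advance x ℓ).1, hend x⟩, by
    have : Continuous fun x => h.advance x ℓ :=
      h.continuous_advance.comp (f := fun x : Slab g a b => (x, ℓ)) (by fun_prop)
    fun_prop⟩
  -- Height `t` means remaining time `ℓ * (1 - t)`, which is at most `ε` for `t ≥ 1 - ε / ℓ`. The
  -- maximum with `0` keeps the collar inside the slab.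
  let A := max 0 (1 - ε / ℓ)
  have hAlt : A < 1 := max_lt one_pos (by have := div_pos hε hℓ0; linarith)
  have hA : ∀ t ∈ Icc A 1, ℓ * (1 - t) ∈ Icc 0 ε := by
    intro t ht
    have h1 : 1 - ε / ℓ ≤ t := (le_max_right _ _).trans ht.1
    refine ⟨mul_nonneg hℓ0.le (by linarith [ht.2]), ?_⟩
    have : 1 - t ≤ ε / ℓ := by linarith
    rwa [le_div_iff₀ hℓ0, mul_comm] at this
  have hK : ∀ w : Fibre g c × Icc A 1, ∃ y : Slab g a b,
      j y.1 = Φ (j w.1.1) (-(ℓ * (1 - w.2))) ∧ h.remaining y = ℓ * (1 - w.2) := by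
    rintro ⟨y, t, ht⟩
    obtain ⟨z, hz, hgz⟩ := hback y.1 y.2 _ (hA t ht).1 (hA t ht).2
    have hgz' : g z = c - ς * (ℓ * (1 - t)) := by rw [hgz, y.2]
    have ht0 : 0 ≤ t := (le_max_left _ _).trans ht.1
    exact ⟨⟨z, h.mem_of_remaining hgz' ⟨(hA t ht).1, by nlinarith⟩⟩, hz, h.remaining_of_eq hgz'⟩
  choose K hKj hKr using hK
  have hKc : Continuous K := by
    refine h.continuous_slab_iff.2 ⟨?_, ?_⟩
    · simp only [hKj]
      have := h.continuous_j
      exact h.continuous.comp (f := fun w : Fibre g c × Icc A 1 =>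
        (j w.1.1, -(ℓ * (1 - (w.2 : ℝ))))) (by fun_prop)
    · simp only [h.apply_eq, hKr]
      fun_prop
  refine ⟨⟨⟨fun w => h.advance w.1 (ℓ * w.2), ?_⟩, C, ?_, ?_, ?_, ?_, A, le_max_left _ _, hAlt,
    ⟨K, hKc⟩, ?_, ?_, ?_⟩⟩
  · exact h.continuous_advance.comp (f := fun w : Slab g a b × I =>
      (w.1, ℓ * (w.2 : ℝ))) (by fun_prop)
  · intro x
    refine h.advance_eq_self ?_
    simp [elapsed, (h.remaining_mem x).1]
  · intro x s
    change k (h.advance x (ℓ * s)) = _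
    rw [hk', h.remaining_advance, elapsed, max_eq_left (mul_nonneg hℓ0.le s.2.1), hk' x]
    rcases le_total (ℓ * (s : ℝ)) (h.remaining x) with h1 | h1
    · have h2 : (s : ℝ) ≤ h.remaining x / ℓ := by rwa [le_div_iff₀ hℓ0, mul_comm]
      rw [min_eq_left h1, min_eq_right (by linarith), sub_div, mul_div_cancel_left₀ _ hℓ0.ne']
      ring
    · have h2 : h.remaining x / ℓ ≤ s := by rwa [div_le_iff₀ hℓ0, mul_comm]
      rw [min_eq_right h1, min_eq_left (by linarith)]
      simp
  · intro x s
    refine Subtype.ext (congrArg Subtype.val ?_ : (h.advance (h.advance x (ℓ * s)) ℓ).1 =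
      (h.advance x ℓ).1)
    rw [h.advance_advance x (mul_nonneg hℓ0.le s.2.1) hℓ0.le]
    have h1 : h.elapsed x (ℓ * s + ℓ) = h.elapsed x ℓ := by
      rw [h.elapsed_of_le (h.remaining_mem x).2, h.elapsed_of_le
        ((h.remaining_mem x).2.trans (by have := mul_nonneg hℓ0.le s.2.1; linarith))]
    exact h.slab_ext (by rw [h.j_advance, h.j_advance, h1])
      (by rw [h.remaining_advance, h.remaining_advance, h1])
  · intro x
    refine Subtype.ext ?_
    change (h.advance x (ℓ * ((1 : I) : ℝ))).1 = (h.advance x ℓ).1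
    simp
  · intro y t
    change k (K (y, t)) = t
    rw [hk', hKr]; field_simp; ring
  · intro y t
    have hle : h.remaining (K (y, t)) ≤ ℓ := (h.remaining_mem _).2
    refine Subtype.ext (h.isEmbedding.injective (Prod.ext ?_ ?_))
    · change j (h.advance (K (y, t)) ℓ).1 = j y.1
      rw [h.j_advance, h.elapsed_of_le hle, hKj, hKr, h.add, neg_add_cancel, h.zero]
    · exact (hend _).trans y.2.symm
  · intro x hx
    refine h.slab_ext ?_ ?_
    · change j (K (C x, ⟨k x, hx⟩)).1 = _
      rw [hKj]
      change Φ (j (h.advance x ℓ).1) (-(ℓ * (1 - k x))) = _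
      rw [h.j_advance, h.elapsed_of_le (h.remaining_mem x).2, ← hrk, h.add, add_neg_cancel, h.zero]
    · change h.remaining (K (C x, ⟨k x, hx⟩)) = _
      rw [hKr, ← hrk]

end IsCollapsing

theorem Levels.nonempty_slabFlow_of_isCollapsing {n : ℕ} {L : Levels n} {g : Y → ℝ} {j : Y → F}
    {Φ : F → ℝ → F} {i : Fin n} {ς : ℝ}
    (h : IsCollapsing g j Φ (L.s i.castSucc) (L.s i.succ) (L.s (L.plus i)) ς) :
    Nonempty (L.SlabFlow g i) := by
  have hlt := h.lt
  have hne : L.s i.succ - L.s i.castSucc ≠ 0 := (sub_pos.2 hlt).ne'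
  refine h.nonempty_collaredFlow (fun x => ?_) _
  by_cases hD : L.D i
  · rw [slabHeight_of_D hD]
    have hp : L.plus i = i.castSucc := by simp [plus, hD]
    have hs := h.sign
    rw [hp] at hs ⊢
    rcases hs with ⟨-, hs⟩ | ⟨rfl, -⟩
    · exact absurd hs hlt.ne
    · ring
  · rw [slabHeight_of_not hD]
    have hp : L.plus i = i.succ := by simp [plus, hD]
    have hs := h.sign
    rw [hp] at hs ⊢
    rcases hs with ⟨rfl, -⟩ | ⟨-, hs⟩
    · field_simp; ring
    · exact absurd hs hlt.ne'

end Collapsing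

end

/-! ### Rays and inward vectors in coordinates -/

section Rays

variable {m : ℕ} {H : Type*} [TopologicalSpace H]
  {J : ModelWithCorners ℝ (EuclideanSpace ℝ (Fin m)) H} {X : Type*} [TopologicalSpace X]
  {φ : OpenPartialHomeomorph X H} {q : X} {K : Set (Fin m)}

variable (J) in
/-- The curve in `X` which is the ray from `q` in the direction `w` in the chart `φ`. -/
def ray (φ : OpenPartialHomeomorph X H) (q : X) (w : EuclideanSpace ℝ (Fin m)) (h : ℝ) : X :=
  (φ.extend J).symm (φ.extend J q + h • w)

theorem ray_zero (hq : q ∈ φ.source) (w : EuclideanSpace ℝ (Fin m)) : ray J φ q w 0 = q := by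
  rw [ray, zero_smul, add_zero, φ.extend_left_inv hq]

/-- The coordinate vector `w` at `q` does not point out of the model corner. -/
def IsInward (K : Set (Fin m)) (x w : EuclideanSpace ℝ (Fin m)) : Prop :=
  ∀ k ∈ K, x k = 0 → 0 ≤ w k

theorem extend_mem (hK : range J = {x | ∀ k ∈ K, 0 ≤ x k}) (φ : OpenPartialHomeomorph X H) (q : X)
    {k : Fin m} (hk : k ∈ K) : 0 ≤ φ.extend J q k := by
  have : φ.extend J q ∈ range J := by rw [φ.extend_coe]; exact mem_range_self _
  rw [hK] at this
  exact this k hk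

theorem eventually_add_smul_mem (hK : range J = {x | ∀ k ∈ K, 0 ≤ x k})
    {w : EuclideanSpace ℝ (Fin m)} (hw : IsInward K (φ.extend J q) w) :
    ∀ᶠ h in 𝓝[≥] (0 : ℝ), φ.extend J q + h • w ∈ range J := by
  rw [hK]
  have : ∀ k : Fin m, ∀ᶠ h in 𝓝[≥] (0 : ℝ), k ∈ K → 0 ≤ (φ.extend J q + h • w) k := by
    intro k
    by_cases hk : k ∈ K
    · rcases (extend_mem hK φ q hk).eq_or_lt with h0 | h0
      · filter_upwards [self_mem_nhdsWithin] with h hh _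
        have : (φ.extend J q + h • w) k = φ.extend J q k + h * w k := rfl
        rw [this, ← h0, zero_add]
        exact mul_nonneg hh (hw k hk h0.symm)
      · have hc : Continuous fun h : ℝ => (φ.extend J q + h • w) k := by
          change Continuous fun h : ℝ => φ.extend J q k + h * w k
          fun_prop
        have : ∀ᶠ h in 𝓝 (0 : ℝ), 0 < (φ.extend J q + h • w) k :=
          hc.continuousAt.eventually (Ioi_mem_nhds (by simpa using h0))
        exact (this.filter_mono nhdsWithin_le_nhds).mono fun h hh _ => hh.le
    · exact Filter.Eventually.of_forall fun h hk' => absurd hk' hk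
  filter_upwards [Filter.eventually_all.2 this] with h hh k hk
  exact hh k hk

theorem eventually_extend_ray (hK : range J = {x | ∀ k ∈ K, 0 ≤ x k}) (hq : q ∈ φ.source)
    {w : EuclideanSpace ℝ (Fin m)} (hw : IsInward K (φ.extend J q) w) :
    ∀ᶠ h in 𝓝[≥] (0 : ℝ), ray J φ q w h ∈ φ.source ∧
      φ.extend J (ray J φ q w h) = φ.extend J q + h • w := by
  have h1 := φ.extend_target_mem_nhdsWithin (I := J) hq
  have hc : Filter.Tendsto (fun h : ℝ => φ.extend J q + h • w) (𝓝[≥] 0)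
      (𝓝[range J] (φ.extend J q)) := by
    refine tendsto_nhdsWithin_iff.2 ⟨?_, eventually_add_smul_mem hK hw⟩
    have : Continuous fun h : ℝ => φ.extend J q + h • w := by fun_prop
    simpa using (this.tendsto 0).mono_left nhdsWithin_le_nhds
  filter_upwards [hc h1] with h hh
  exact ⟨φ.extend_source (I := J) ▸ (φ.extend J).map_target hh, (φ.extend J).right_inv hh⟩

end Rays

/-! ### Calculus in charts of a manifold with corners -/

section ChartCalculus

variable {m : ℕ} {H : Type*} [TopologicalSpace H]
  {J : ModelWithCorners ℝ (EuclideanSpace ℝ (Fin m)) H}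
  {X : Type*} [TopologicalSpace X] [ChartedSpace H X]
  {F : Type*} [NormedAddCommGroup F] [NormedSpace ℝ F]

variable (J) in
/-- The differential of the chart `φ`. -/
def coordDeriv (φ : OpenPartialHomeomorph X H) (q : X) :
    TangentSpace J q →L[ℝ] EuclideanSpace ℝ (Fin m) :=
  mfderiv J 𝓘(ℝ, EuclideanSpace ℝ (Fin m)) (φ.extend J) q

variable (J) in
/-- The differential of `g` in the chart `φ`. -/
def chartFDeriv (φ : OpenPartialHomeomorph X H) (g : X → F) (q : X) :
    EuclideanSpace ℝ (Fin m) →L[ℝ] F :=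
  fderivWithin ℝ (g ∘ (φ.extend J).symm) (range J) (φ.extend J q)

variable {φ ψ : OpenPartialHomeomorph X H} {q : X}

theorem contMDiffWithinAt_extend_symm (hφ : φ ∈ IsManifold.maximalAtlas J ∞ X)
    (hq : q ∈ φ.source) :
    ContMDiffWithinAt 𝓘(ℝ, EuclideanSpace ℝ (Fin m)) J ∞ (φ.extend J).symm (range J)
      (φ.extend J q) := by
  have h := contMDiffOn_extend_symm hφ
  rw [← φ.extend_target'] at h
  have hq' : φ.extend J q ∈ (φ.extend J).target :=
    (φ.extend J).map_source (by rwa [φ.extend_source])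
  exact (h _ hq').mono_of_mem_nhdsWithin (φ.extend_target_mem_nhdsWithin hq)

theorem mdifferentiableAt_extend (hφ : φ ∈ IsManifold.maximalAtlas J ∞ X) (hq : q ∈ φ.source) :
    MDifferentiableAt J 𝓘(ℝ, EuclideanSpace ℝ (Fin m)) (φ.extend J) q :=
  (φ.contMDiffAt_extend hφ hq).mdifferentiableAt (by simp)

theorem hasFDerivWithinAt_chart (hφ : φ ∈ IsManifold.maximalAtlas J ∞ X) (hq : q ∈ φ.source)
    {g : X → F} (hg : MDifferentiableAt J 𝓘(ℝ, F) g q) :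
    HasFDerivWithinAt (g ∘ (φ.extend J).symm) (chartFDeriv J φ g q) (range J) (φ.extend J q) := by
  refine DifferentiableWithinAt.hasFDerivWithinAt
    (mdifferentiableWithinAt_iff_differentiableWithinAt.1 ?_)
  have h1 := (contMDiffWithinAt_extend_symm (J := J) hφ hq).mdifferentiableWithinAt (by simp)
  refine MDifferentiableAt.comp_mdifferentiableWithinAt (φ.extend J q) ?_ h1
  rwa [φ.extend_left_inv hq]

theorem mfderiv_eq_chartFDeriv (hφ : φ ∈ IsManifold.maximalAtlas J ∞ X) (hq : q ∈ φ.source)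
    {g : X → F} (hg : MDifferentiableAt J 𝓘(ℝ, F) g q) (v : TangentSpace J q) :
    mfderiv J 𝓘(ℝ, F) g q v = chartFDeriv J φ g q (coordDeriv J φ q v) := by
  have h1 := (hasFDerivWithinAt_chart hφ hq hg).hasMFDerivWithinAt
  have h2 := (mdifferentiableAt_extend (J := J) hφ hq).hasMFDerivAt
  have h3 := h1.comp q h2.hasMFDerivWithinAt (s := univ) (fun x _ => by
    rw [mem_preimage, φ.extend_coe]; exact mem_range_self _)
  rw [hasMFDerivWithinAt_univ] at h3
  have h4 := h3.congr_of_eventuallyEq (f₁ := g) (by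
    filter_upwards [φ.open_source.mem_nhds hq] with x hx
    simp only [Function.comp_apply, φ.extend_left_inv hx])
  rw [h4.mfderiv]
  rfl

/-- The differential of the preferred chart at `q`, which is the identity, factors through that of
`φ`. -/
theorem coordDeriv_injective [IsManifold J ∞ X] (hφ : φ ∈ IsManifold.maximalAtlas J ∞ X)
    (hq : q ∈ φ.source) : Function.Injective (coordDeriv J φ q) := by
  have h1 := fun v => mfderiv_eq_chartFDeriv hφ hq
    ((contMDiffAt_extChartAt (I := J) (n := ∞) (x := q)).mdifferentiableAt (by simp)) v
  have : IsManifold J 1 X := IsManifold.of_le (n := ∞) (by simp)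
  intro v w h
  have e : mfderiv J 𝓘(ℝ, EuclideanSpace ℝ (Fin m)) (extChartAt J q) q v =
      mfderiv J 𝓘(ℝ, EuclideanSpace ℝ (Fin m)) (extChartAt J q) q w := by rw [h1, h1, h]
  rw [mfderiv_extChartAt_self] at e
  exact e

/-- The tangent space is the model vector space itself, so this is an injective endomorphism in
finite dimension. -/
theorem coordDeriv_surjective [IsManifold J ∞ X] (hφ : φ ∈ IsManifold.maximalAtlas J ∞ X)
    (hq : q ∈ φ.source) : Function.Surjective (coordDeriv J φ q) := by
  let A : EuclideanSpace ℝ (Fin m) →ₗ[ℝ] EuclideanSpace ℝ (Fin m) :=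
    { toFun := fun v => coordDeriv J φ q v
      map_add' := fun v w => (coordDeriv J φ q).map_add v w
      map_smul' := fun c v => (coordDeriv J φ q).map_smul c v }
  exact (LinearMap.injective_iff_surjective (f := A)).1 (coordDeriv_injective hφ hq)

theorem contMDiffOn_chartFDeriv (hφ : φ ∈ IsManifold.maximalAtlas J ∞ X) {g : X → F}
    (hg : ContMDiff J 𝓘(ℝ, F) ∞ g) (w : EuclideanSpace ℝ (Fin m)) :
    ContMDiffOn J 𝓘(ℝ, F) ∞ (fun q => chartFDeriv J φ g q w) φ.source := by
  intro q hq
  have h1 : ContDiffWithinAt ℝ ∞ (g ∘ (φ.extend J).symm) (range J) (φ.extend J q) :=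
    contMDiffWithinAt_iff_contDiffWithinAt.1
      (hg.contMDiffAt.comp_contMDiffWithinAt _ (contMDiffWithinAt_extend_symm (J := J) hφ hq))
  have h2 := (h1.fderivWithin_right (m := ∞) J.uniqueDiffOn (by simp)
    (by rw [φ.extend_coe]; exact mem_range_self _)).clm_apply contDiffWithinAt_const (g := fun _ => w)
  refine ContMDiffAt.contMDiffWithinAt ?_
  have h3 : ContMDiffWithinAt J 𝓘(ℝ, F) ∞ ((fun z => fderivWithin ℝ (g ∘ (φ.extend J).symm)
      (range J) z w) ∘ φ.extend J) univ q :=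
    h2.contMDiffWithinAt.comp q (φ.contMDiffAt_extend hφ hq).contMDiffWithinAt (fun x _ => by
      rw [φ.extend_coe]; exact mem_range_self _)
  exact h3

/-! ### The inward cone -/

variable {K : Set (Fin m)}

theorem hasDerivWithinAt_ray (hφ : φ ∈ IsManifold.maximalAtlas J ∞ X)
    (hK : range J = {x | ∀ k ∈ K, 0 ≤ x k}) (hq : q ∈ φ.source)
    {w : EuclideanSpace ℝ (Fin m)} (hw : IsInward K (φ.extend J q) w)
    {g : X → F} (hg : MDifferentiableAt J 𝓘(ℝ, F) g q) :
    HasDerivWithinAt (fun h => g (ray J φ q w h)) (chartFDeriv J φ g q w) (Ici 0) 0 := by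
  let s : Set ℝ := {h | φ.extend J q + h • w ∈ range J} ∩ Ici 0
  have hs : s ∈ 𝓝[≥] (0 : ℝ) :=
    Filter.inter_mem (eventually_add_smul_mem hK hw) self_mem_nhdsWithin
  have h1 : HasDerivWithinAt (fun h : ℝ => φ.extend J q + h • w) w s 0 := by
    have := ((hasDerivAt_id (0 : ℝ)).smul_const w).const_add (φ.extend J q)
    rw [one_smul] at this
    exact this.hasDerivWithinAt
  have h2 : HasFDerivWithinAt (g ∘ (φ.extend J).symm) (chartFDeriv J φ g q) (range J)
      (φ.extend J q + (0 : ℝ) • w) := by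
    rw [zero_smul, add_zero]; exact hasFDerivWithinAt_chart hφ hq hg
  exact (h2.comp_hasDerivWithinAt (0 : ℝ) h1 fun h hh => hh.1).mono_of_mem_nhdsWithin hs

theorem tendsto_ray (hφ : φ ∈ IsManifold.maximalAtlas J ∞ X)
    (hK : range J = {x | ∀ k ∈ K, 0 ≤ x k}) (hq : q ∈ φ.source)
    {w : EuclideanSpace ℝ (Fin m)} (hw : IsInward K (φ.extend J q) w) :
    Filter.Tendsto (ray J φ q w) (𝓝[≥] 0) (𝓝 q) := by
  have h1 : Filter.Tendsto (fun h : ℝ => φ.extend J q + h • w) (𝓝[≥] 0)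
      (𝓝[range J] (φ.extend J q)) := by
    refine tendsto_nhdsWithin_iff.2 ⟨?_, eventually_add_smul_mem hK hw⟩
    have : Continuous fun h : ℝ => φ.extend J q + h • w := by fun_prop
    simpa using (this.tendsto 0).mono_left nhdsWithin_le_nhds
  have h2 := (contMDiffWithinAt_extend_symm (J := J) hφ hq).continuousWithinAt.tendsto
  rw [φ.extend_left_inv hq] at h2
  exact h2.comp h1

theorem nonneg_of_hasDerivWithinAt {u : ℝ → ℝ} {u' : ℝ} (hu : HasDerivWithinAt u u' (Ici 0) 0)
    (h : ∀ᶠ t in 𝓝[≥] (0 : ℝ), u 0 ≤ u t) : 0 ≤ u' := by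
  have h1 := (hasDerivWithinAt_iff_tendsto_slope' (s := Ioi 0) (by simp)).1
    (hu.mono Ioi_subset_Ici_self)
  refine ge_of_tendsto h1 ?_
  filter_upwards [h.filter_mono (nhdsWithin_mono _ Ioi_subset_Ici_self), self_mem_nhdsWithin]
    with t ht h0
  rw [slope_def_field, sub_zero]
  exact div_nonneg (sub_nonneg.2 ht) (le_of_lt h0)

/-- Whether a tangent vector points inward does not depend on the chart. -/
theorem isInward_of_isInward (hφ : φ ∈ IsManifold.maximalAtlas J ∞ X)
    (hψ : ψ ∈ IsManifold.maximalAtlas J ∞ X) (hK : range J = {x | ∀ k ∈ K, 0 ≤ x k})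
    (hq : q ∈ φ.source) (hq' : q ∈ ψ.source) {v : TangentSpace J q}
    (hv : IsInward K (φ.extend J q) (coordDeriv J φ q v)) :
    IsInward K (ψ.extend J q) (coordDeriv J ψ q v) := by
  intro k hk h0
  have h1 := hasDerivWithinAt_ray hφ hK hq hv (mdifferentiableAt_extend (J := J) hψ hq')
  rw [← mfderiv_eq_chartFDeriv hφ hq (mdifferentiableAt_extend (J := J) hψ hq')] at h1
  have h2 : HasDerivWithinAt (fun h => ψ.extend J (ray J φ q (coordDeriv J φ q v) h) k)
      (coordDeriv J ψ q v k) (Ici 0) 0 :=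
    (EuclideanSpace.proj (𝕜 := ℝ) k).hasFDerivAt.comp_hasDerivWithinAt (0 : ℝ) h1
  -- Along the ray the coordinate of `ψ` starts at `0` and stays nonnegative, because the ray runs
  -- inside `X`.
  refine nonneg_of_hasDerivWithinAt h2 (Filter.Eventually.of_forall fun t => ?_)
  rw [ray_zero hq, h0]
  exact extend_mem hK ψ _ hk

theorem isInward_iff (hφ : φ ∈ IsManifold.maximalAtlas J ∞ X)
    (hψ : ψ ∈ IsManifold.maximalAtlas J ∞ X) (hK : range J = {x | ∀ k ∈ K, 0 ≤ x k})
    (hq : q ∈ φ.source) (hq' : q ∈ ψ.source) {v : TangentSpace J q} :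
    IsInward K (φ.extend J q) (coordDeriv J φ q v) ↔
      IsInward K (ψ.extend J q) (coordDeriv J ψ q v) :=
  ⟨isInward_of_isInward hφ hψ hK hq hq', isInward_of_isInward hψ hφ hK hq' hq⟩

theorem mem_interior_iff_of_range (hK : range J = {x | ∀ k ∈ K, 0 ≤ x k})
    {x : EuclideanSpace ℝ (Fin m)} : x ∈ interior (range J) ↔ ∀ k ∈ K, 0 < x k := by
  constructor
  · intro hx k hk
    have hc : Continuous fun h : ℝ => x - h • EuclideanSpace.single k (1 : ℝ) := by fun_prop
    have h1 : ∀ᶠ h in 𝓝 (0 : ℝ), x - h • EuclideanSpace.single k (1 : ℝ) ∈ range J :=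
      hc.continuousAt.preimage_mem_nhds (by
        rw [zero_smul, sub_zero]; exact mem_interior_iff_mem_nhds.1 hx)
    obtain ⟨h, hh, h0⟩ := ((h1.filter_mono nhdsWithin_le_nhds).and
      (self_mem_nhdsWithin : Ioi (0 : ℝ) ∈ 𝓝[>] 0)).exists
    rw [hK] at hh
    have := hh k hk
    have e : (x - h • EuclideanSpace.single k (1 : ℝ)) k = x k - h := by simp
    rw [e] at this
    have h0' : 0 < h := h0
    linarith
  · intro hx
    have ho : IsOpen {y : EuclideanSpace ℝ (Fin m) | ∀ k ∈ K, 0 < y k} := by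
      have : {y : EuclideanSpace ℝ (Fin m) | ∀ k ∈ K, 0 < y k} =
          ⋂ k ∈ K, {y : EuclideanSpace ℝ (Fin m) | 0 < y k} := by ext; simp
      rw [this]
      exact K.toFinite.isOpen_biInter fun k _ => isOpen_lt continuous_const (by fun_prop)
    refine mem_interior.2 ⟨_, ?_, ho, hx⟩
    rw [hK]
    exact fun y hy k hk => (hy k hk).le

/-- If a coordinate in `K` vanishes in one chart, the opposite coordinate vector is not inward. If
none vanished in the other chart, every vector would be inward there, contradicting the invariance
of inwardness. -/
theorem mem_boundary_iff [IsManifold J ∞ X] (hφ : φ ∈ IsManifold.maximalAtlas J ∞ X)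
    (hK : range J = {x | ∀ k ∈ K, 0 ≤ x k}) (hq : q ∈ φ.source) :
    q ∈ J.boundary X ↔ ∃ k ∈ K, φ.extend J q k = 0 := by
  have key : ∀ {φ ψ : OpenPartialHomeomorph X H}, φ ∈ IsManifold.maximalAtlas J ∞ X →
      ψ ∈ IsManifold.maximalAtlas J ∞ X → q ∈ φ.source → q ∈ ψ.source →
      (∃ k ∈ K, φ.extend J q k = 0) → ∃ k ∈ K, ψ.extend J q k = 0 := by
    rintro φ ψ hφ hψ hq hq' ⟨k, hk, h0⟩
    by_contra hcon
    push Not at hcon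
    obtain ⟨v, hv⟩ := coordDeriv_surjective hφ hq (EuclideanSpace.single k (-1 : ℝ))
    have h1 : IsInward K (ψ.extend J q) (coordDeriv J ψ q v) :=
      fun k' hk' h => absurd h (hcon k' hk')
    have h2 := (isInward_iff hφ hψ hK hq hq').2 h1 k hk h0
    rw [hv] at h2
    simp at h2
    linarith
  have hχ := IsManifold.chart_mem_maximalAtlas (I := J) (n := ∞) q
  have h1 : q ∈ J.boundary X ↔ ∃ k ∈ K, (chartAt H q).extend J q k = 0 := by
    rw [← J.compl_interior, mem_compl_iff]
    change ¬ ((chartAt H q).extend J q ∈ interior (range J)) ↔ _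
    rw [mem_interior_iff_of_range hK]
    push Not
    exact exists_congr fun k => and_congr_right fun hk =>
      ⟨fun h => le_antisymm h (extend_mem hK _ q hk), fun h => h.le⟩
  rw [h1]
  exact ⟨key hχ hφ (mem_chart_source H q) hq, key hφ hχ hq (mem_chart_source H q)⟩

/-- Inward vectors are subtangential to the image of `X`. -/
theorem isSubtangent_of_isInward (hφ : φ ∈ IsManifold.maximalAtlas J ∞ X)
    (hK : range J = {x | ∀ k ∈ K, 0 ≤ x k}) (hq : q ∈ φ.source) {e : X → F}
    (he : MDifferentiableAt J 𝓘(ℝ, F) e q) {v : TangentSpace J q}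
    (hv : IsInward K (φ.extend J q) (coordDeriv J φ q v)) :
    IsSubtangent (range e) (e q) (mfderiv J 𝓘(ℝ, F) e q v) := by
  have h1 := hasDerivWithinAt_ray hφ hK hq hv he
  rw [← mfderiv_eq_chartFDeriv hφ hq he] at h1
  have h2 := hasDerivWithinAt_iff_isLittleO.1 (h1.mono Ioi_subset_Ici_self)
  simp only [sub_zero, ray_zero hq] at h2
  refine Asymptotics.IsBigO.trans_isLittleO (Asymptotics.isBigO_of_le _ fun h => ?_) h2
  rw [Real.norm_of_nonneg Metric.infDist_nonneg]
  refine (Metric.infDist_le_dist_of_mem (mem_range_self (ray J φ q (coordDeriv J φ q v) h))).trans ?_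
  rw [dist_eq_norm, ← norm_neg]
  refine le_of_eq (congrArg norm ?_)
  abel

end ChartCalculus

/-! ### Smooth maps are Lipschitz with respect to an immersive embedding -/

section Lipschitz

variable {m : ℕ} {H : Type*} [TopologicalSpace H]
  {J : ModelWithCorners ℝ (EuclideanSpace ℝ (Fin m)) H}
  {X : Type*} [TopologicalSpace X] [ChartedSpace H X]
  {F F' : Type*} [NormedAddCommGroup F'] [NormedSpace ℝ F'] [NormedAddCommGroup F]
  [NormedSpace ℝ F]

/-- In a small neighbourhood of `p`, a smooth map is close to its linear approximation. -/
theorem exists_nhds_norm_sub_le {φ : OpenPartialHomeomorph X H} {p : X}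
    (hφ : φ ∈ IsManifold.maximalAtlas J ∞ X) (hp : p ∈ φ.source) {g : X → F}
    (hg : ContMDiff J 𝓘(ℝ, F) ∞ g) {c : ℝ} (hc : 0 < c) :
    ∃ U ∈ 𝓝 p, ∀ x ∈ U, ∀ y ∈ U,
      ‖g x - g y - chartFDeriv J φ g p (φ.extend J x - φ.extend J y)‖ ≤
        c * ‖φ.extend J x - φ.extend J y‖ := by
  have hmem : ∀ q : X, φ.extend J q ∈ range J := fun q => by
    rw [φ.extend_coe]; exact mem_range_self _
  have h1 : ContDiffWithinAt ℝ ∞ (g ∘ (φ.extend J).symm) (range J) (φ.extend J p) :=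
    contMDiffWithinAt_iff_contDiffWithinAt.1
      (hg.contMDiffAt.comp_contMDiffWithinAt _ (contMDiffWithinAt_extend_symm (J := J) hφ hp))
  have h2 : ContinuousWithinAt (fderivWithin ℝ (g ∘ (φ.extend J).symm) (range J)) (range J)
      (φ.extend J p) :=
    (h1.fderivWithin_right (m := ∞) J.uniqueDiffOn (by simp) (hmem p)).continuousWithinAt
  have h3 : ∀ᶠ z in 𝓝[range J] (φ.extend J p), z ∈ (φ.extend J).target ∧
      ‖fderivWithin ℝ (g ∘ (φ.extend J).symm) (range J) z - chartFDeriv J φ g p‖ ≤ c := by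
    have h4 := Metric.tendsto_nhds.1 h2.tendsto c hc
    filter_upwards [φ.extend_target_mem_nhdsWithin hp, h4] with z hz hz'
    rw [dist_eq_norm] at hz'
    exact ⟨hz, hz'.le⟩
  obtain ⟨r, hr, hball⟩ := Metric.mem_nhdsWithin_iff.1 h3
  refine ⟨φ.source ∩ φ.extend J ⁻¹' Metric.ball (φ.extend J p) r,
    Filter.inter_mem (φ.open_source.mem_nhds hp)
      ((φ.continuousAt_extend hp).preimage_mem_nhds (Metric.ball_mem_nhds _ hr)), ?_⟩
  rintro x ⟨hx, hxr⟩ y ⟨hy, hyr⟩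
  have h5 := Convex.norm_image_sub_le_of_norm_hasFDerivWithin_le' (𝕜 := ℝ)
    (f := g ∘ (φ.extend J).symm)
    (f' := fun z => fderivWithin ℝ (g ∘ (φ.extend J).symm) (range J) z)
    (s := Metric.ball (φ.extend J p) r ∩ range J) (φ := chartFDeriv J φ g p) (C := c)
    (fun z hz => ?_) (fun z hz => (hball hz).2)
    ((convex_ball _ _).inter J.convex_range) ⟨hyr, hmem y⟩ ⟨hxr, hmem x⟩
  · simpa only [Function.comp_apply, φ.extend_left_inv hx, φ.extend_left_inv hy] using h5
  · have hzt := (hball hz).1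
    have hzs : (φ.extend J).symm z ∈ φ.source :=
      φ.extend_source (I := J) ▸ (φ.extend J).map_target hzt
    have h6 := hasFDerivWithinAt_chart (J := J) hφ hzs
      ((hg.contMDiffAt (x := (φ.extend J).symm z)).mdifferentiableAt (by simp))
    rw [chartFDeriv, (φ.extend J).right_inv hzt] at h6
    exact h6.mono inter_subset_right

/-- The injective differential of `e` is bounded below, and near `p` both `e` and `g` are close to
linear in the chart, so chart distances bound `g` from above and `e` from below. -/
theorem exists_nhds_norm_sub_le_mul [IsManifold J ∞ X] {e : X → F} (he : ContMDiff J 𝓘(ℝ, F) ∞ e)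
    (he' : ∀ x, Function.Injective (mfderiv J 𝓘(ℝ, F) e x)) {g : X → F'}
    (hg : ContMDiff J 𝓘(ℝ, F') ∞ g) (p : X) :
    ∃ U ∈ 𝓝 p, ∃ C : ℝ, 0 ≤ C ∧ ∀ x ∈ U, ∀ y ∈ U, ‖g x - g y‖ ≤ C * ‖e x - e y‖ := by
  have hφ := IsManifold.chart_mem_maximalAtlas (I := J) (n := ∞) p
  have hp := mem_chart_source H p
  set φ := chartAt H p
  have hinj : Function.Injective (chartFDeriv J φ e p) := by
    intro w w' h
    obtain ⟨v, rfl⟩ := coordDeriv_surjective (J := J) hφ hp w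
    obtain ⟨v', rfl⟩ := coordDeriv_surjective (J := J) hφ hp w'
    have hd := (he.contMDiffAt (x := p)).mdifferentiableAt (by simp)
    rw [← mfderiv_eq_chartFDeriv hφ hp hd, ← mfderiv_eq_chartFDeriv hφ hp hd] at h
    rw [he' p h]
  obtain ⟨κ, hκ, hanti⟩ := (chartFDeriv J φ e p).toLinearMap.exists_antilipschitzWith
    (LinearMap.ker_eq_bot.2 hinj)
  have hκ' : (0 : ℝ) < κ := hκ
  -- Since `‖w‖ ≤ κ * ‖De w‖`, an error of `‖w‖ / (2κ)` loses only half of the lower bound.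
  obtain ⟨U, hU, hUe⟩ := exists_nhds_norm_sub_le (J := J) hφ hp he (c := 1 / (2 * κ)) (by positivity)
  obtain ⟨U', hU', hUg⟩ := exists_nhds_norm_sub_le (J := J) hφ hp hg one_pos
  refine ⟨U ∩ U', Filter.inter_mem hU hU', (‖chartFDeriv J φ g p‖ + 1) * (2 * κ), by positivity,
    fun x hx y hy => ?_⟩
  set w := φ.extend J x - φ.extend J y with hw
  have h1 : ‖w‖ ≤ κ * ‖chartFDeriv J φ e p w‖ := by
    have := hanti.le_mul_norm_sub w 0
    simpa using this
  have h2 := hUe x hx.1 y hy.1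
  have h3 : ‖chartFDeriv J φ e p w‖ ≤ ‖e x - e y‖ + 1 / (2 * κ) * ‖w‖ := by
    have := norm_sub_norm_le (chartFDeriv J φ e p w) (e x - e y)
    rw [norm_sub_rev (chartFDeriv J φ e p w)] at this
    rw [← hw] at h2
    linarith
  have h4 : ‖w‖ ≤ 2 * κ * ‖e x - e y‖ := by
    have h5 : κ * ‖chartFDeriv J φ e p w‖ ≤ κ * (‖e x - e y‖ + 1 / (2 * κ) * ‖w‖) :=
      mul_le_mul_of_nonneg_left h3 hκ'.le
    have h6 : κ * (‖e x - e y‖ + 1 / (2 * κ) * ‖w‖) = κ * ‖e x - e y‖ + ‖w‖ / 2 := by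
      field_simp
    linarith
  have h7 := hUg x hx.2 y hy.2
  rw [← hw] at h7
  have h8 : ‖g x - g y‖ ≤ (‖chartFDeriv J φ g p‖ + 1) * ‖w‖ := by
    have h9 := norm_sub_norm_le (g x - g y) (chartFDeriv J φ g p w)
    have h10 := (chartFDeriv J φ g p).le_opNorm w
    linarith
  calc ‖g x - g y‖ ≤ (‖chartFDeriv J φ g p‖ + 1) * ‖w‖ := h8
    _ ≤ (‖chartFDeriv J φ g p‖ + 1) * (2 * κ * ‖e x - e y‖) := by gcongr
    _ = _ := by ring

/-- Compactness of `X × X`: the local estimate covers the diagonal, and off it `‖e p - e q‖` is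
bounded away from `0`. Applied to a vector field, this makes it a Lipschitz function on the image of
`X`. -/
theorem exists_norm_sub_le_mul [IsManifold J ∞ X] [CompactSpace X] {e : X → F} (he : ContMDiff J 𝓘(ℝ, F) ∞ e)
    (hinj : Function.Injective e) (he' : ∀ x, Function.Injective (mfderiv J 𝓘(ℝ, F) e x))
    {g : X → F'} (hg : ContMDiff J 𝓘(ℝ, F') ∞ g) :
    ∃ C : ℝ, 0 ≤ C ∧ ∀ x y, ‖g x - g y‖ ≤ C * ‖e x - e y‖ := by
  have hec := he.continuous
  have hgc := hg.continuous
  have key := isCompact_univ.induction_on (X := X × X)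
    (p := fun S => ∃ C : ℝ, 0 ≤ C ∧ ∀ w ∈ S, ‖g w.1 - g w.2‖ ≤ C * ‖e w.1 - e w.2‖) ?_ ?_ ?_ ?_
  · obtain ⟨C, hC, h⟩ := key
    exact ⟨C, hC, fun x y => h (x, y) (mem_univ _)⟩
  · exact ⟨0, le_rfl, fun w hw => hw.elim⟩
  · rintro S T hST ⟨C, hC, h⟩
    exact ⟨C, hC, fun w hw => h w (hST hw)⟩
  · rintro S T ⟨C, hC, h⟩ ⟨C', hC', h'⟩
    refine ⟨max C C', hC.trans (le_max_left _ _), ?_⟩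
    rintro w (hw | hw)
    · exact (h w hw).trans (by gcongr; exact le_max_left _ _)
    · exact (h' w hw).trans (by gcongr; exact le_max_right _ _)
  · rintro ⟨p, q⟩ -
    rcases eq_or_ne p q with rfl | hpq
    · obtain ⟨U, hU, C, hC, h⟩ := exists_nhds_norm_sub_le_mul he he' hg p
      exact ⟨U ×ˢ U, mem_nhdsWithin_of_mem_nhds (prod_mem_nhds hU hU), C, hC,
        fun w hw => h w.1 hw.1 w.2 hw.2⟩
    · have hpos : 0 < ‖e p - e q‖ := norm_pos_iff.2 (sub_ne_zero.2 (hinj.ne hpq))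
      have h1 : ∀ᶠ w : X × X in 𝓝 (p, q), ‖e p - e q‖ / 2 < ‖e w.1 - e w.2‖ :=
        (show Continuous fun w : X × X => ‖e w.1 - e w.2‖ by fun_prop).continuousAt.eventually
          (Ioi_mem_nhds (by simpa using hpos))
      have h2 : ∀ᶠ w : X × X in 𝓝 (p, q), ‖g w.1 - g w.2‖ < ‖g p - g q‖ + 1 :=
        (show Continuous fun w : X × X => ‖g w.1 - g w.2‖ by fun_prop).continuousAt.eventually
          (Iio_mem_nhds (by simp))
      refine ⟨_, mem_nhdsWithin_of_mem_nhds (h1.and h2), (‖g p - g q‖ + 1) / (‖e p - e q‖ / 2),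
        by positivity, ?_⟩
      rintro w ⟨hw1, hw2⟩
      rw [div_mul_eq_mul_div, le_div_iff₀ (by positivity)]
      exact mul_le_mul hw2.le hw1.le (by positivity) (by positivity)

end Lipschitz

/-! ### Vector fields with prescribed behaviour on the boundary -/

section Field

variable {m : ℕ} {H : Type*} [TopologicalSpace H]
  {J : ModelWithCorners ℝ (EuclideanSpace ℝ (Fin m)) H}
  {X : Type*} [TopologicalSpace X] [ChartedSpace H X]
  {F P : Type*} [NormedAddCommGroup F] [NormedSpace ℝ F] [NormedAddCommGroup P] [NormedSpace ℝ P]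

/-- A curve `ν` in `P` which is an integral curve of the vector field `G`, with a `1`-form `form` that
is dual to `G` on the curve. -/
structure Clock (P : Type*) [NormedAddCommGroup P] [NormedSpace ℝ P] where
  ν : ℝ → P
  G : P → P
  form : P → P →L[ℝ] ℝ
  hasDerivAt : ∀ t, HasDerivAt ν (G (ν t)) t
  lipschitz : ∃ L, LipschitzWith L G
  smooth_form : ContDiff ℝ ∞ form

variable (J) in
/-- The rate at which the clock `f` changes in the direction of a tangent vector. -/
def Clock.rate (c : Clock P) (f : X → P) (x : X) : TangentSpace J x →L[ℝ] ℝ :=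
  (c.form (f x)).comp (mfderiv J 𝓘(ℝ, P) f x)

theorem Clock.rate_apply (c : Clock P) (f : X → P) (x : X) (v : TangentSpace J x) :
    c.rate J f x v = c.form (f x) (mfderiv J 𝓘(ℝ, P) f x v) := rfl

theorem Clock.rate_eq_chartFDeriv {φ : OpenPartialHomeomorph X H}
    (hφ : φ ∈ IsManifold.maximalAtlas J ∞ X) {q : X} (hq : q ∈ φ.source) (c : Clock P) {f : X → P}
    (hf : ContMDiff J 𝓘(ℝ, P) ∞ f) (v : TangentSpace J q) :
    c.rate J f q v = c.form (f q) (chartFDeriv J φ f q (coordDeriv J φ q v)) := by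
  rw [c.rate_apply, mfderiv_eq_chartFDeriv hφ hq
    ((hf.contMDiffAt (x := q)).mdifferentiableAt (by simp))]

variable (J) in
/-- The tangent vector `v` at `x` does not point out of `X`. -/
def PointsInward (K : Set (Fin m)) (x : X) (v : TangentSpace J x) : Prop :=
  IsInward K ((chartAt H x).extend J x) (coordDeriv J (chartAt H x) x v)

variable {K : Set (Fin m)}

theorem PointsInward.combo {x : X} {v w : TangentSpace J x} {a b : ℝ} (hv : PointsInward J K x v)
    (hw : PointsInward J K x w) (ha : 0 ≤ a) (hb : 0 ≤ b) :
    PointsInward J K x (a • v + b • w) := by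
  intro k hk h0
  rw [map_add, map_smul, map_smul]
  exact add_nonneg (mul_nonneg ha (hv k hk h0)) (mul_nonneg hb (hw k hk h0))

theorem PointsInward.smul {x : X} {v : TangentSpace J x} {a : ℝ} (hv : PointsInward J K x v)
    (ha : 0 ≤ a) : PointsInward J K x (a • v) := by
  intro k hk h0
  rw [map_smul]
  exact mul_nonneg ha (hv k hk h0)

theorem pointsInward_iff [IsManifold J ∞ X] {φ : OpenPartialHomeomorph X H} {q : X}
    (hφ : φ ∈ IsManifold.maximalAtlas J ∞ X) (hK : range J = {x | ∀ k ∈ K, 0 ≤ x k})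
    (hq : q ∈ φ.source) {v : TangentSpace J q} :
    PointsInward J K q v ↔ IsInward K (φ.extend J q) (coordDeriv J φ q v) :=
  isInward_iff (IsManifold.chart_mem_maximalAtlas q) hφ hK (mem_chart_source H q) hq

/-- Locally constant vector fields in charts can be combined to a global vector field of speed
`σ = ±1` with respect to `f`, which points inward on `O` and whose negative points inward on
`O'`. -/
theorem exists_field [IsManifold J ∞ X] [CompactSpace X] [T2Space X]
    (hK : range J = {x | ∀ k ∈ K, 0 ≤ x k}) (c : Clock P) {e : X → F}
    (he : ContMDiff J 𝓘(ℝ, F) ∞ e) {f : X → P} (hf : ContMDiff J 𝓘(ℝ, P) ∞ f) {σ : ℝ}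
    (O O' : Set X)
    (hloc : ∀ p, ∃ φ ∈ IsManifold.maximalAtlas J ∞ X, p ∈ φ.source ∧ ∃ w,
      0 < σ * c.form (f p) (chartFDeriv J φ f p w) ∧ ∀ᶠ q in 𝓝 p,
        (q ∈ O → IsInward K (φ.extend J q) w) ∧ (q ∈ O' → IsInward K (φ.extend J q) (-w))) :
    ∃ V : X → F, ContMDiff J 𝓘(ℝ, F) ∞ V ∧ ∀ x, ∃ v : TangentSpace J x,
      mfderiv J 𝓘(ℝ, F) e x v = V x ∧ c.rate J f x v = σ ∧
        (x ∈ O → PointsInward J K x v) ∧ (x ∈ O' → PointsInward J K x (-v)) := by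
  -- All requirements on a value of the field are convex, so a partition of unity reduces the global
  -- problem to a local one.
  let t : X → Set F := fun x => {W | ∃ v : TangentSpace J x,
      mfderiv J 𝓘(ℝ, F) e x v = W ∧ c.rate J f x v = σ ∧
        (x ∈ O → PointsInward J K x v) ∧ (x ∈ O' → PointsInward J K x (-v))}
  have ht : ∀ x, Convex ℝ (t x) := by
    rintro x _ ⟨v, rfl, hv, hvO, hvO'⟩ _ ⟨w, rfl, hw, hwO, hwO'⟩ a b ha hb hab
    refine ⟨a • v + b • w, by rw [map_add, map_smul, map_smul]; rfl, ?_,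
      fun hx => (hvO hx).combo (hwO hx) ha hb, fun hx => ?_⟩
    · rw [map_add, map_smul, map_smul, hv, hw, ← add_smul, hab, one_smul]
    · have := (hvO' hx).combo (hwO' hx) ha hb
      rwa [smul_neg, smul_neg, ← neg_add] at this
  obtain ⟨V, hV⟩ := exists_contMDiffMap_forall_mem_convex_of_local J (n := ⊤) ht fun p => by
    obtain ⟨φ, hφ, hp, w, hw, hq⟩ := hloc p
    -- The rate of the constant coordinate vector `w`. Dividing by it makes the speed exactly `σ`,
    -- and the factor `σ / A` is nonnegative, so inward vectors remain inward.
    let A : X → ℝ := fun q => c.form (f q) (chartFDeriv J φ f q w)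
    have hA : ContMDiffOn J 𝓘(ℝ, ℝ) ∞ A φ.source :=
      ((c.smooth_form.contMDiff.comp hf).contMDiffOn).clm_apply (contMDiffOn_chartFDeriv hφ hf w)
    have hApos : ∀ᶠ q in 𝓝 p, 0 < σ * A q :=
      (((hA.continuousOn.continuousAt (φ.open_source.mem_nhds hp)).const_smul σ)).eventually
        (Ioi_mem_nhds hw)
    refine ⟨_, (φ.open_source.eventually_mem hp).and (hq.and hApos),
      fun q => (σ / A q) • chartFDeriv J φ e q w, ?_, ?_⟩
    · have hne : ∀ q ∈ {q | q ∈ φ.source ∧ ((q ∈ O → IsInward K (φ.extend J q) w) ∧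
          (q ∈ O' → IsInward K (φ.extend J q) (-w))) ∧ 0 < σ * A q}, A q ≠ 0 := by
        rintro q ⟨-, -, h⟩ h0
        rw [h0, mul_zero] at h
        exact lt_irrefl _ h
      refine ContMDiffOn.smul (ContMDiffOn.div₀ contMDiffOn_const (hA.mono fun q hq => hq.1) hne)
        ((contMDiffOn_chartFDeriv hφ he w).mono fun q hq => hq.1)
    · rintro q ⟨hqs, ⟨hO, hO'⟩, hpos⟩
      obtain ⟨v, hv⟩ := coordDeriv_surjective (J := J) hφ hqs w
      have hA0 : A q ≠ 0 := fun h0 => by rw [h0, mul_zero] at hpos; exact lt_irrefl _ hpos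
      have hcoef : 0 ≤ σ / A q := by
        have : σ / A q = (σ * A q) / (A q * A q) := by field_simp
        rw [this]; exact div_nonneg hpos.le (mul_self_nonneg _)
      have hde := mfderiv_eq_chartFDeriv hφ hqs ((he.contMDiffAt (x := q)).mdifferentiableAt
        (by simp)) v
      have hdf := mfderiv_eq_chartFDeriv hφ hqs ((hf.contMDiffAt (x := q)).mdifferentiableAt
        (by simp)) v
      rw [hv] at hde hdf
      refine ⟨(σ / A q) • v, ?_, ?_, fun hx => ?_, fun hx => ?_⟩
      · rw [map_smul, hde]; rfl
      · rw [map_smul, c.rate_apply, hdf]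
        exact div_mul_cancel₀ σ hA0
      · refine PointsInward.smul ((pointsInward_iff hφ hK hqs).2 ?_) hcoef
        rw [hv]; exact hO hx
      · rw [← smul_neg]
        refine PointsInward.smul ((pointsInward_iff hφ hK hqs).2 ?_) hcoef
        rw [map_neg, hv]; exact hO' hx
  exact ⟨V, V.contMDiff, hV⟩

/-! ### The flow of the field -/

open scoped NNReal

/-- Extend the real coordinates of `g` separately and then clip them, which is a `1`-Lipschitz
operation. Boundedness is what gives the extended field a global flow. -/
theorem exists_bounded_lipschitz_extension [FiniteDimensional ℝ F] {E : Type*}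
    [PseudoMetricSpace E] {s : Set E} {g : E → F} {C : ℝ≥0} (hg : LipschitzOnWith C g s) {M : ℝ}
    (hM : ∀ x ∈ s, ‖g x‖ ≤ M) :
    ∃ (g' : E → F) (L M' : ℝ≥0), LipschitzWith L g' ∧ (∀ x, ‖g' x‖ ≤ M') ∧ EqOn g' g s := by
  let A : F ≃L[ℝ] (Fin (Module.finrank ℝ F) → ℝ) := (Module.finBasis ℝ F).equivFunL
  have hA := (A : F →L[ℝ] (Fin (Module.finrank ℝ F) → ℝ)).lipschitz
  have hA' := (A.symm : (Fin (Module.finrank ℝ F) → ℝ) →L[ℝ] F).lipschitz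
  obtain ⟨h, hh, heq⟩ := (hA.comp_lipschitzOnWith hg).extend_pi
  -- A bound for all coordinates of `g` on `s`, so clipping changes nothing there. The absolute
  -- value keeps `R` nonnegative if `s` is empty and `M` is negative.
  let R : ℝ := ‖(A : F →L[ℝ] (Fin (Module.finrank ℝ F) → ℝ))‖ * |M|
  have hR : 0 ≤ R := by positivity
  let clip : (Fin (Module.finrank ℝ F) → ℝ) → Fin (Module.finrank ℝ F) → ℝ :=
    fun y i => max (-R) (min R (y i))
  have hclip : LipschitzWith 1 clip := by
    refine LipschitzWith.of_dist_le_mul fun y z => ?_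
    rw [NNReal.coe_one, one_mul]
    refine (dist_pi_le_iff dist_nonneg).2 fun i => ?_
    have h1 := ((LipschitzWith.id (α := ℝ)).const_min R).const_max (-R)
    have h2 := h1.dist_le_mul (y i) (z i)
    rw [NNReal.coe_one, one_mul] at h2
    exact h2.trans (dist_le_pi_dist y z i)
  have hclipR : ∀ y, ‖clip y‖ ≤ R := fun y => (pi_norm_le_iff_of_nonneg hR).2 fun i =>
    abs_le.2 ⟨le_max_left _ _, max_le (by linarith) (min_le_left _ _)⟩
  refine ⟨fun x => A.symm (clip (h x)), _, ‖(A.symm : (Fin (Module.finrank ℝ F) → ℝ) →L[ℝ] F)‖₊ * R.toNNReal,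
    hA'.comp (hclip.comp hh), fun x => ?_, fun x hx => ?_⟩
  · refine ((A.symm : (Fin (Module.finrank ℝ F) → ℝ) →L[ℝ] F).le_opNorm _).trans ?_
    rw [NNReal.coe_mul, Real.coe_toNNReal _ hR]
    exact mul_le_mul_of_nonneg_left (hclipR _) (norm_nonneg _)
  · have h1 : h x = A (g x) := (heq hx).symm
    have h2 : clip (h x) = h x := by
      funext i
      have h3 : ‖A (g x)‖ ≤ R := ((A : F →L[ℝ] (Fin (Module.finrank ℝ F) → ℝ)).le_opNorm _).trans
        (mul_le_mul_of_nonneg_left ((hM x hx).trans (le_abs_self M)) (norm_nonneg _))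
      have h4 := abs_le.1 ((norm_le_pi_norm (A (g x)) i).trans h3)
      change max (-R) (min R (h x i)) = h x i
      rw [h1, min_eq_right h4.2, max_eq_right h4.1]
    change A.symm (clip (h x)) = g x
    rw [h2, h1, A.symm_apply_apply]

/-- The flow of a field of speed `σ` that points inward on `O` preserves the image of `X` as long as
the clock `f` shows times over `O`. -/
theorem exists_flow_eq [IsManifold J ∞ X] [CompactSpace X] [T2Space X]
    (hK : range J = {x | ∀ k ∈ K, 0 ≤ x k}) (c : Clock P) {e : X → F}
    (he : ContMDiff J 𝓘(ℝ, F) ∞ e) (hinj : Function.Injective e) {f : X → P} (pr : F →L[ℝ] P)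
    (hpr : ∀ x, pr (e x) = f x) {V : F → F} {L : ℝ≥0} (hV : LipschitzWith L V) {Φ : F → ℝ → F}
    (hΦ : IsFlow V Φ) {σ : ℝ} {O : Set X} (hO : IsOpen O)
    (hv : ∀ x, ∃ v : TangentSpace J x, mfderiv J 𝓘(ℝ, F) e x v = V (e x) ∧
      pr (V (e x)) = σ • c.G (f x) ∧ (x ∈ O → PointsInward J K x v))
    {x : X} {t₀ T : ℝ} (hx : f x = c.ν t₀)
    (hT : ∀ u ∈ Ico 0 T, ∀ y, f y = c.ν (t₀ + σ * u) → y ∈ O) :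
    ∀ u ∈ Icc 0 T, ∃ y, e y = Φ (e x) u ∧ f y = c.ν (t₀ + σ * u) := by
  -- While the curve lies in the image of `X`, its projection solves `p' = σ • G p`, as does the
  -- clock, so they agree. This tells over which times the curve is.
  have hclock : ∀ u, (∀ s ∈ Icc 0 u, Φ (e x) s ∈ range e) → 0 ≤ u →
      pr (Φ (e x) u) = c.ν (t₀ + σ * u) := by
    intro u hu hu0
    obtain ⟨L', hG⟩ := c.lipschitz
    have hσG : LipschitzWith (‖σ‖₊ * L') fun p => σ • c.G p := by
      exact (lipschitzWith_smul σ).comp hG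
    refine ODE_solution_unique (v := fun _ p => σ • c.G p) (f := fun s => pr (Φ (e x) s))
      (g := fun s => c.ν (t₀ + σ * s)) (a := 0) (b := u) (fun _ => hσG) ?_ (fun s hs => ?_) ?_
      (fun s hs => ?_) ?_ ⟨hu0, le_rfl⟩
    · exact (continuous_iff_continuousAt.2 fun s =>
        (pr.hasFDerivAt.comp_hasDerivAt s (hΦ.hasDerivAt (e x) s)).continuousAt).continuousOn
    · obtain ⟨y, hy⟩ := hu s (Ico_subset_Icc_self hs)
      obtain ⟨v, -, h2, -⟩ := hv y
      have h3 := (pr.hasFDerivAt.comp_hasDerivAt s (hΦ.hasDerivAt (e x) s)).hasDerivWithinAt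
        (s := Ici s)
      rw [← hy, h2, ← hpr, hy] at h3
      exact h3
    · refine (continuous_iff_continuousAt.2 fun s => ?_).continuousOn
      exact ((c.hasDerivAt (t₀ + σ * s)).continuousAt).comp
        (f := fun s => t₀ + σ * s) (by fun_prop)
    · have h1 : HasDerivAt (fun s => t₀ + σ * s) σ s := by
        simpa using ((hasDerivAt_id s).const_mul σ).const_add t₀
      exact ((c.hasDerivAt (t₀ + σ * s)).scomp s h1).hasDerivWithinAt
    · rw [hΦ.zero, hpr, hx, mul_zero, add_zero]
  have hcomp : IsCompact (range e) := isCompact_range he.continuous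
  have hmem : ∀ u ∈ Icc 0 T, Φ (e x) u ∈ range e := by
    refine forall_mem_of_isSubtangent hV hcomp (hΦ.hasDerivAt (e x))
      (by rw [hΦ.zero]; exact mem_range_self x) fun u hu hus => ?_
    obtain ⟨y, hy⟩ := hus u ⟨hu.1, le_rfl⟩
    have hyO : y ∈ O := hT u hu y (by rw [← hpr, hy]; exact hclock u hus hu.1)
    -- The image of `X` minus `O` is compact, so its complement is an open neighbourhood whose
    -- points of `range e` all come from `O`.
    refine ⟨(e '' Oᶜ)ᶜ, ?_, ?_, ?_⟩
    · exact (hO.isClosed_compl.isCompact.image he.continuous).isClosed.isOpen_compl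
    · rw [← hy]
      rintro ⟨z, hz, hzy⟩
      exact hz (hinj hzy ▸ hyO)
    · rintro _ ⟨z, rfl⟩ hz
      have hzO : z ∈ O := by
        by_contra hzO
        exact hz ⟨z, hzO, rfl⟩
      obtain ⟨v, h1, -, h3⟩ := hv z
      rw [← h1]
      exact isSubtangent_of_isInward (IsManifold.chart_mem_maximalAtlas z) hK (mem_chart_source H z)
        ((he.contMDiffAt (x := z)).mdifferentiableAt (by simp)) (h3 hzO)
  intro u hu
  obtain ⟨y, hy⟩ := hmem u hu
  refine ⟨y, hy, ?_⟩
  rw [← hpr, hy]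
  exact hclock u (fun s hs => hmem s ⟨hs.1, hs.2.trans hu.2⟩) hu.1

end Field

/-! ### Collapsing flows from local vector fields -/

section CollapsingFlow

open scoped NNReal

variable {m : ℕ} {H : Type*} [TopologicalSpace H]
  {J : ModelWithCorners ℝ (EuclideanSpace ℝ (Fin m)) H}
  {X : Type*} [TopologicalSpace X] [ChartedSpace H X]

theorem mfderiv_clm_comp {F F' : Type*} [NormedAddCommGroup F] [NormedSpace ℝ F]
    [NormedAddCommGroup F'] [NormedSpace ℝ F'] (A : F →L[ℝ] F') {g : X → F} {x : X}
    (hg : MDifferentiableAt J 𝓘(ℝ, F) g x) (v : TangentSpace J x) :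
    mfderiv J 𝓘(ℝ, F') (fun x => A (g x)) x v = A (mfderiv J 𝓘(ℝ, F) g x v) := by
  have h := (A.hasMFDerivAt (x := g x)).comp x hg.hasMFDerivAt
  have h' : mfderiv J 𝓘(ℝ, F') (fun x => A (g x)) x = _ := h.mfderiv
  rw [h']
  rfl

variable {P : Type*} [NormedAddCommGroup P] [NormedSpace ℝ P] [FiniteDimensional ℝ P]
  {K : Set (Fin m)}

/-- If locally constant vector fields with the required properties exist, then the slab
`g⁻¹([a,b])` of the pullback of `f` along the clock has a collapsing flow. -/
theorem exists_isCollapsing_of_local [IsManifold J ∞ X] [CompactSpace X] [T2Space X]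
    (hK : range J = {x | ∀ k ∈ K, 0 ≤ x k}) (c : Clock P) {f : X → P}
    (hf : ContMDiff J 𝓘(ℝ, P) ∞ f)
    (hrate : ∀ x (v : TangentSpace J x), mfderiv J 𝓘(ℝ, P) f x v = c.rate J f x v • c.G (f x))
    {σ : ℝ} {O O' : Set X} (hO : IsOpen O) (hO' : IsOpen O')
    (hloc : ∀ p, ∃ φ ∈ IsManifold.maximalAtlas J ∞ X, p ∈ φ.source ∧ ∃ w,
      0 < σ * c.form (f p) (chartFDeriv J φ f p w) ∧ ∀ᶠ q in 𝓝 p,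
        (q ∈ O → IsInward K (φ.extend J q) w) ∧ (q ∈ O' → IsInward K (φ.extend J q) (-w)))
    {Y : Type*} [TopologicalSpace Y] {g : Y → ℝ} {π : Y → X}
    (hπ : IsEmbedding fun y => (π y, g y)) (hπf : ∀ y, f (π y) = c.ν (g y))
    (hπs : ∀ x t, f x = c.ν t → ∃ y, π y = x ∧ g y = t) {a b t₁ : ℝ} (hab : a < b)
    (hσ : σ = 1 ∧ t₁ = b ∨ σ = -1 ∧ t₁ = a)
    (hOab : ∀ t ∈ Icc a b, t ≠ t₁ → ∀ x, f x = c.ν t → x ∈ O)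
    (hOε : ∃ ε > 0, ∀ t ∈ Ioo (t₁ - ε) (t₁ + ε), ∀ x, f x = c.ν t → x ∈ O') :
    ∃ (n : ℕ) (j : Y → EuclideanSpace ℝ (Fin n) × P) (Φ : _ → ℝ → _),
      IsCollapsing g j Φ a b t₁ σ := by
  -- Pairing the embedding with `f` makes `f` the restriction of a linear projection, so the clock
  -- can be read off along ambient curves.
  obtain ⟨n, e₀, he₀, hemb, hinj₀⟩ := exists_embedding_euclidean_of_compact (I := J) (M := X)
  let e : X → EuclideanSpace ℝ (Fin n) × P := fun x => (e₀ x, f x)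
  have he : ContMDiff J 𝓘(ℝ, EuclideanSpace ℝ (Fin n) × P) ∞ e := he₀.prodMk_space hf
  have hed : ∀ x, MDifferentiableAt J 𝓘(ℝ, EuclideanSpace ℝ (Fin n) × P) e x := fun x =>
    (he.contMDiffAt (x := x)).mdifferentiableAt (by simp)
  have hinj : Function.Injective e := fun x y h => hemb.injective (congrArg Prod.fst h)
  have hinj' : ∀ x, Function.Injective
      (mfderiv J 𝓘(ℝ, EuclideanSpace ℝ (Fin n) × P) e x) := by
    intro x v w h
    have h1 := mfderiv_clm_comp (ContinuousLinearMap.fst ℝ (EuclideanSpace ℝ (Fin n)) P) (hed x)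
    exact hinj₀ x ((h1 v).trans ((congrArg _ h).trans (h1 w).symm))
  have hsnd : ∀ x (v : TangentSpace J x), ContinuousLinearMap.snd ℝ (EuclideanSpace ℝ (Fin n)) P
      (mfderiv J 𝓘(ℝ, EuclideanSpace ℝ (Fin n) × P) e x v) = mfderiv J 𝓘(ℝ, P) f x v := fun x v =>
    (mfderiv_clm_comp (ContinuousLinearMap.snd ℝ (EuclideanSpace ℝ (Fin n)) P) (hed x) v).symm
  obtain ⟨V₀, hV₀, hV₀v⟩ := exists_field hK c he hf O O' hloc
  obtain ⟨C, hC, hlip⟩ := exists_norm_sub_le_mul he hinj hinj' hV₀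
  obtain ⟨M, hM⟩ : ∃ M, ∀ x, ‖V₀ x‖ ≤ M := by
    obtain ⟨M, hM⟩ := (isCompact_range hV₀.continuous).isBounded.exists_norm_le
    exact ⟨M, fun x => hM _ (mem_range_self x)⟩
  obtain ⟨V, L, M', hV, hM', hVe⟩ : ∃ (V : EuclideanSpace ℝ (Fin n) × P → _) (L M' : ℝ≥0),
      LipschitzWith L V ∧ (∀ z, ‖V z‖ ≤ M') ∧ ∀ x, V (e x) = V₀ x := by
    -- `Function.invFun` requires a point of `X`.
    rcases isEmpty_or_nonempty X with hX | hX
    · exact ⟨fun _ => 0, 0, 0, LipschitzWith.const 0, by simp, fun x => (hX.false x).elim⟩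
    · have h1 : LipschitzOnWith ⟨C, hC⟩ (fun z => V₀ (Function.invFun e z)) (range e) := by
        refine LipschitzOnWith.of_dist_le_mul ?_
        rintro _ ⟨x, rfl⟩ _ ⟨y, rfl⟩
        rw [Function.leftInverse_invFun hinj, Function.leftInverse_invFun hinj, dist_eq_norm,
          dist_eq_norm]
        exact hlip x y
      obtain ⟨V, L, M', hV, hM', hVe⟩ := exists_bounded_lipschitz_extension h1 (M := M) (by
        rintro _ ⟨x, rfl⟩; exact hM _)
      refine ⟨V, L, M', hV, hM', fun x => ?_⟩
      exact (hVe (mem_range_self x)).trans (congrArg V₀ (Function.leftInverse_invFun hinj x))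
  obtain ⟨Φ, hΦ⟩ := exists_isFlow hV hM'
  have hfwd := fun {x t₀ T} => exists_flow_eq hK c he hinj (f := f)
    (ContinuousLinearMap.snd ℝ (EuclideanSpace ℝ (Fin n)) P) (fun _ => rfl) hV hΦ (σ := σ) hO
    (fun x => by
      obtain ⟨v, h1, h2, h3, -⟩ := hV₀v x
      refine ⟨v, h1.trans (hVe x).symm, ?_, h3⟩
      rw [hVe, ← h1, hsnd, hrate, h2]) (x := x) (t₀ := t₀) (T := T)
  have hV' : LipschitzWith L fun z => -V z := hV.neg
  -- The backward flow is the flow of `-V`, of speed `-σ`, which points inward on `O'`.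
  have hbwd := fun {x t₀ T} => exists_flow_eq hK c he hinj (f := f)
    (ContinuousLinearMap.snd ℝ (EuclideanSpace ℝ (Fin n)) P) (fun _ => rfl) hV' hΦ.neg
    (σ := -σ) hO' (fun x => by
      obtain ⟨v, h1, h2, -, h3⟩ := hV₀v x
      refine ⟨-v, ?_, ?_, h3⟩
      · rw [map_neg, h1, hVe]; rfl
      · rw [map_neg, neg_smul, hVe, ← h1, hsnd, hrate, h2]) (x := x) (t₀ := t₀) (T := T)
  refine ⟨n, fun y => e (π y), Φ, ?_, hΦ.continuous, hΦ.zero, hΦ.add hV, hab, hσ, ?_, ?_⟩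
  · exact ((he.continuous.isClosedEmbedding hinj).isEmbedding.prodMap IsEmbedding.id).comp hπ
  · intro y hy u hu0 hu
    obtain ⟨x', h1, h2⟩ := hfwd (x := π y) (t₀ := g y) (T := u) (hπf y) (fun s hs x hx => by
      refine hOab _ ?_ ?_ x hx
      · rcases hσ with ⟨rfl, rfl⟩ | ⟨rfl, rfl⟩
        · exact ⟨by linarith [hy.1, hs.1], by linarith [hs.2]⟩
        · exact ⟨by linarith [hs.2], by linarith [hy.2, hs.1]⟩
      · rcases hσ with ⟨rfl, rfl⟩ | ⟨rfl, rfl⟩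
        · exact (by linarith [hs.2] : g y + 1 * s < t₁).ne
        · exact (by linarith [hs.2] : t₁ < g y + -1 * s).ne') u ⟨hu0, le_rfl⟩
    obtain ⟨y', rfl, hy'⟩ := hπs x' _ h2
    exact ⟨y', h1, hy'⟩
  · obtain ⟨ε, hε, hεO⟩ := hOε
    refine ⟨ε, hε, fun y hy u hu0 hu => ?_⟩
    obtain ⟨x', h1, h2⟩ := hbwd (x := π y) (t₀ := g y) (T := u) (hπf y) (fun s hs x hx => by
      refine hεO _ ?_ x hx
      rw [hy]
      rcases hσ with ⟨rfl, -⟩ | ⟨rfl, -⟩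
      · exact ⟨by linarith [hs.2], by linarith [hs.1]⟩
      · exact ⟨by linarith [hs.1], by linarith [hs.2]⟩) u ⟨hu0, le_rfl⟩
    obtain ⟨y', rfl, hy'⟩ := hπs x' _ h2
    exact ⟨y', h1, by rw [hy']; ring⟩

end CollapsingFlow

/-! ### Local vector fields near the faces -/

section LocalField

variable {m : ℕ} {H : Type*} [TopologicalSpace H]
  {J : ModelWithCorners ℝ (EuclideanSpace ℝ (Fin m)) H}
  {X : Type*} [TopologicalSpace X] [ChartedSpace H X] [IsManifold J ∞ X]
  {P : Type*} [NormedAddCommGroup P] [NormedSpace ℝ P]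
  {K : Set (Fin m)}

/-- Points of the face `{xₖ = 0}` of a chart lie in `S` if all nearby boundary points in the relative
interior of the face do. -/
theorem eventually_ray_mem {φ : OpenPartialHomeomorph X H}
    (hφ : φ ∈ IsManifold.maximalAtlas J ∞ X) (hK : range J = {x | ∀ k ∈ K, 0 ≤ x k})
    {B S : Set X} (hBS : J.boundary X ⊆ B ∪ S) {q : X} (hq : q ∈ φ.source) {k : Fin m} (hk : k ∈ K)
    (h0 : φ.extend J q k = 0) (hB : ∀ᶠ x in 𝓝 q, x ∈ B → ∃ l, l ≠ k ∧ φ.extend J x l = 0)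
    {u : EuclideanSpace ℝ (Fin m)} (huk : u k = 0) (hu : ∀ l, l ≠ k → 0 < u l) :
    IsInward K (φ.extend J q) u ∧ ∀ᶠ h in 𝓝[>] (0 : ℝ), ray J φ q u h ∈ S := by
  have hin : IsInward K (φ.extend J q) u := by
    intro l _ _
    rcases eq_or_ne l k with rfl | hl
    · exact huk.ge
    · exact (hu l hl).le
  refine ⟨hin, ?_⟩
  have hle : 𝓝[>] (0 : ℝ) ≤ 𝓝[≥] 0 := nhdsWithin_mono _ Ioi_subset_Ici_self
  have h1 := (eventually_extend_ray hK hq hin).filter_mono hle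
  have h2 := ((tendsto_ray hφ hK hq hin).mono_left hle).eventually hB
  have h3 : ∀ l, ∀ᶠ h in 𝓝[>] (0 : ℝ), l ≠ k → (φ.extend J q + h • u) l ≠ 0 := by
    intro l
    by_cases hl : φ.extend J q l = 0
    · filter_upwards [self_mem_nhdsWithin] with h hh hlk
      have e : (φ.extend J q + h • u) l = φ.extend J q l + h * u l := rfl
      rw [e, hl, zero_add]
      exact (mul_pos hh (hu l hlk)).ne'
    · have hc : Continuous fun h : ℝ => (φ.extend J q + h • u) l := by
        change Continuous fun h : ℝ => φ.extend J q l + h * u l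
        fun_prop
      have : ∀ᶠ h in 𝓝 (0 : ℝ), (φ.extend J q + h • u) l ≠ 0 :=
        hc.continuousAt.eventually_ne (by simpa using hl)
      exact (this.filter_mono nhdsWithin_le_nhds).mono fun h hh _ => hh
  filter_upwards [h1, h2, Filter.eventually_all.2 h3] with h ⟨hs, he⟩ hB' hne
  have hb : ray J φ q u h ∈ J.boundary X := by
    refine (mem_boundary_iff hφ hK hs).2 ⟨k, hk, ?_⟩
    have e : (φ.extend J q + h • u) k = φ.extend J q k + h * u k := rfl
    rw [he, e, h0, huk, mul_zero, add_zero]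
  refine (hBS hb).resolve_left fun hb' => ?_
  obtain ⟨l, hl, hl0⟩ := hB' hb'
  rw [he] at hl0
  exact hne l hl hl0

/-- A linear form that vanishes on the vectors `u` with `uₖ = 0` and other coordinates positive is a
multiple of the `k`-th coordinate. -/
theorem apply_eq_mul_of_forall_pos (α : EuclideanSpace ℝ (Fin m) →L[ℝ] ℝ) (k : Fin m)
    (h : ∀ u : EuclideanSpace ℝ (Fin m), u k = 0 → (∀ l, l ≠ k → 0 < u l) → α u = 0)
    (w : EuclideanSpace ℝ (Fin m)) : α w = α (EuclideanSpace.single k 1) * w k := by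
  -- Off the `k`-th coordinate `s` dominates `w`, so both `s` and `s` plus the part of `w` without
  -- its `k`-th coordinate are admissible.
  let s : EuclideanSpace ℝ (Fin m) := WithLp.toLp 2 fun l => if l = k then 0 else |w l| + 1
  have hs : α s = 0 := h s (by simp [s]) fun l hl => by simp [s, hl]; positivity
  have hs' : α (s + w - w k • EuclideanSpace.single k 1) = 0 := by
    refine h _ (by simp [s]) fun l hl => ?_
    have : (s + w - w k • EuclideanSpace.single k (1 : ℝ)) l = |w l| + 1 + w l := by simp [s, hl]
    rw [this]
    linarith [neg_abs_le (w l)]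
  rw [map_sub, map_add, hs, zero_add, map_smul, smul_eq_mul] at hs'
  linarith

/-- A function which is constant on the cap `S` changes on a face in `S` only in the direction of the
transverse coordinate. -/
theorem chartFDeriv_eq_mul_of_cap {φ : OpenPartialHomeomorph X H}
    (hφ : φ ∈ IsManifold.maximalAtlas J ∞ X) (hK : range J = {x | ∀ k ∈ K, 0 ≤ x k})
    {B S : Set X} (hBS : J.boundary X ⊆ B ∪ S) {q : X} (hq : q ∈ φ.source) {k : Fin m} (hk : k ∈ K)
    (h0 : φ.extend J q k = 0) (hB : ∀ᶠ x in 𝓝 q, x ∈ B → ∃ l, l ≠ k ∧ φ.extend J x l = 0)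
    {g : X → ℝ} (hg : MDifferentiableAt J 𝓘(ℝ, ℝ) g q) (hS : ∀ᶠ x in 𝓝 q, x ∈ S → g x = g q)
    (w : EuclideanSpace ℝ (Fin m)) :
    chartFDeriv J φ g q w = chartFDeriv J φ g q (EuclideanSpace.single k 1) * w k := by
  refine apply_eq_mul_of_forall_pos _ k (fun u huk hu => ?_) w
  obtain ⟨hin, hray⟩ := eventually_ray_mem hφ hK hBS hq hk h0 hB huk hu
  have h1 := (hasDerivWithinAt_ray hφ hK hq hin hg).mono Ioi_subset_Ici_self
  have hle : 𝓝[>] (0 : ℝ) ≤ 𝓝[≥] 0 := nhdsWithin_mono _ Ioi_subset_Ici_self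
  have h2 : HasDerivWithinAt (fun h => g (ray J φ q u h)) 0 (Ioi 0) 0 := by
    refine (hasDerivWithinAt_const (0 : ℝ) (Ioi 0) (g q)).congr_of_eventuallyEq ?_
      (by rw [ray_zero hq])
    filter_upwards [hray, ((tendsto_ray hφ hK hq hin).mono_left hle).eventually hS] with h h3 h4
    exact h4 h3
  exact (uniqueDiffWithinAt_Ioi (0 : ℝ)).eq_deriv _ h1 h2

/-- The point `q` has a cap of `f` in `S`: near `q` the clock is constant on `S`, and `q` is an
extremal point of the clock. -/
structure IsCapPoint (J : ModelWithCorners ℝ (EuclideanSpace ℝ (Fin m)) H) (c : Clock P)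
    (f : X → P) (S : Set X) (ς : ℝ) (q : X) (g : X → ℝ) : Prop where
  mdifferentiableAt : MDifferentiableAt J 𝓘(ℝ, ℝ) g q
  mfderiv_eq : ∀ v : TangentSpace J q, mfderiv J 𝓘(ℝ, ℝ) g q v = c.rate J f q v
  eq_of_mem : ∀ᶠ x in 𝓝 q, x ∈ S → g x = g q
  le : ∀ᶠ x in 𝓝 q, 0 ≤ ς * (g x - g q)

/-- Near an initial cap, a vector along which the clock increases points inward. -/
theorem IsCapPoint.coord_nonneg {φ : OpenPartialHomeomorph X H}
    (hφ : φ ∈ IsManifold.maximalAtlas J ∞ X) (hK : range J = {x | ∀ k ∈ K, 0 ≤ x k})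
    {B S : Set X} (hBS : J.boundary X ⊆ B ∪ S) {q : X} (hq : q ∈ φ.source) {k : Fin m} (hk : k ∈ K)
    (h0 : φ.extend J q k = 0) (hB : ∀ᶠ x in 𝓝 q, x ∈ B → ∃ l, l ≠ k ∧ φ.extend J x l = 0)
    {c : Clock P} {f : X → P} (hf : ContMDiff J 𝓘(ℝ, P) ∞ f) {ς : ℝ} {g : X → ℝ}
    (h : IsCapPoint J c f S ς q g) {w : EuclideanSpace ℝ (Fin m)}
    (hw : 0 < ς * c.form (f q) (chartFDeriv J φ f q w)) : 0 ≤ w k := by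
  have hgf : ∀ w, chartFDeriv J φ g q w = c.form (f q) (chartFDeriv J φ f q w) := by
    intro w
    obtain ⟨v, rfl⟩ := coordDeriv_surjective (J := J) hφ hq w
    rw [← mfderiv_eq_chartFDeriv hφ hq h.mdifferentiableAt, h.mfderiv_eq,
      c.rate_eq_chartFDeriv hφ hq hf]
  have h1 := chartFDeriv_eq_mul_of_cap hφ hK hBS hq hk h0 hB h.mdifferentiableAt h.eq_of_mem w
  have hin : IsInward K (φ.extend J q) (EuclideanSpace.single k 1) := by
    intro l _ _
    rw [PiLp.single_apply]
    split_ifs <;> norm_num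
  have h2 := ((hasDerivWithinAt_ray hφ hK hq hin h.mdifferentiableAt).sub_const (g q)).const_mul ς
  have h3 : 0 ≤ ς * chartFDeriv J φ g q (EuclideanSpace.single k 1) := by
    refine nonneg_of_hasDerivWithinAt h2 ?_
    filter_upwards [(tendsto_ray hφ hK hq hin).eventually h.le] with t ht
    rwa [ray_zero hq, sub_self, mul_zero]
  -- The rate of `w` is that of the `k`-th coordinate vector times `w k`. As `q` is extremal, the
  -- former has the sign of `ς` or vanishes, so `w k < 0` is impossible.
  rw [← hgf, h1, ← mul_assoc] at hw
  by_contra hneg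
  push Not at hneg
  nlinarith [mul_nonneg h3 (neg_nonneg.2 hneg.le)]

/-- Locally constant vector fields with the properties needed for a collapsing flow exist if they
exist pointwise. -/
theorem exists_local_field (hK : range J = {x | ∀ k ∈ K, 0 ≤ x k}) {c : Clock P} {f : X → P}
    (hf : ContMDiff J 𝓘(ℝ, P) ∞ f) {σ : ℝ} (hσ : σ ≠ 0) {B S O O' : Set X} (hBc : IsClosed B)
    (hSc : IsClosed S) (hBS : J.boundary X ⊆ B ∪ S) (hne : ∀ x, c.rate J f x ≠ 0)
    (hcap : ∀ q ∈ S, ∃ g, (q ∈ O → IsCapPoint J c f S σ q g) ∧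
      (q ∈ O' → IsCapPoint J c f S (-σ) q g))
    (hB : ∀ p ∈ B, p ∈ closure O ∪ closure O' → ∃ φ i, IsFaceChart J B p φ i ∧
      ∃ v, 0 < σ * c.rate J f p v ∧ 0 ≤ tangentCoord J φ i p v ∧
        (tangentCoord J φ i p v = 0 ∨ p ∉ closure O')) (p : X) :
    ∃ φ ∈ IsManifold.maximalAtlas J ∞ X, p ∈ φ.source ∧ ∃ w,
      0 < σ * c.form (f p) (chartFDeriv J φ f p w) ∧ ∀ᶠ q in 𝓝 p,
        (q ∈ O → IsInward K (φ.extend J q) w) ∧ (q ∈ O' → IsInward K (φ.extend J q) (-w)) := by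
  -- Handles the vanishing coordinates whose face is not locally a face of `B`. Such a face belongs
  -- to the caps, where the sign of the rate alone decides inwardness.
  have key : ∀ φ ∈ IsManifold.maximalAtlas J ∞ X, p ∈ φ.source → ∀ w,
      0 < σ * c.form (f p) (chartFDeriv J φ f p w) → ∀ᶠ q in 𝓝 p, ∀ k ∈ K, φ.extend J q k = 0 →
        (∀ᶠ x in 𝓝 q, x ∈ B → ∃ l, l ≠ k ∧ φ.extend J x l = 0) →
        (q ∈ O → 0 ≤ w k) ∧ (q ∈ O' → 0 ≤ (-w) k) := by
    intro φ hφ hp w hw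
    have hA : ContMDiffOn J 𝓘(ℝ, ℝ) ∞ (fun q => c.form (f q) (chartFDeriv J φ f q w)) φ.source :=
      ((c.smooth_form.contMDiff.comp hf).contMDiffOn).clm_apply (contMDiffOn_chartFDeriv hφ hf w)
    have hpos : ∀ᶠ q in 𝓝 p, 0 < σ * c.form (f q) (chartFDeriv J φ f q w) :=
      (((hA.continuousOn.continuousAt (φ.open_source.mem_nhds hp)).const_smul σ)).eventually
        (Ioi_mem_nhds hw)
    filter_upwards [hpos, φ.open_source.mem_nhds hp] with q hq hqs k hk h0 hl
    -- `q` is a limit of points in the relative interior of the face, which lie in `S`, and `S` is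
    -- closed.
    have hqS : q ∈ S := by
      have hu := eventually_ray_mem hφ hK hBS hqs hk h0 hl
        (u := WithLp.toLp 2 fun l => if l = k then 0 else 1) (by simp) (fun l hlk => by simp [hlk])
      have hle : 𝓝[>] (0 : ℝ) ≤ 𝓝[≥] 0 := nhdsWithin_mono _ Ioi_subset_Ici_self
      exact hSc.mem_of_tendsto ((tendsto_ray hφ hK hqs hu.1).mono_left hle) hu.2
    obtain ⟨g, hg, hg'⟩ := hcap q hqS
    refine ⟨fun hqO => (hg hqO).coord_nonneg hφ hK hBS hqs hk h0 hl hf hq, fun hqO => ?_⟩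
    refine (hg' hqO).coord_nonneg hφ hK hBS hqs hk h0 hl hf ?_
    rw [map_neg, map_neg, neg_mul_neg]
    exact hq
  have hex : ∃ v, 0 < σ * c.rate J f p v := by
    obtain ⟨v, hv⟩ := DFunLike.ne_iff.1 (hne p)
    have hv' : c.rate J f p v ≠ 0 := hv
    rcases lt_or_gt_of_ne (mul_ne_zero hσ hv') with h | h
    · exact ⟨-v, by rw [map_neg, mul_neg]; linarith⟩
    · exact ⟨v, h⟩
  by_cases hpB : p ∈ B
  · by_cases hpO : p ∈ closure O ∪ closure O'
    · obtain ⟨φ, i, ⟨hφ, hp, hface⟩, v, hv, hvi, hvO⟩ := hB p hpB hpO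
      rw [c.rate_eq_chartFDeriv hφ hp hf] at hv
      refine ⟨φ, hφ, hp, coordDeriv J φ p v, hv, ?_⟩
      -- On `O'` the negative must be inward as well, which at the face `B` forces tangency. A
      -- transverse vector is allowed only away from `O'`.
      have hO' : ∀ᶠ q in 𝓝 p, tangentCoord J φ i p v = 0 ∨ q ∉ O' := by
        rcases hvO with h | h
        · exact Filter.Eventually.of_forall fun _ => Or.inl h
        · filter_upwards [isClosed_closure.isOpen_compl.mem_nhds h] with q hq
          exact Or.inr fun h' => hq (subset_closure h')
      filter_upwards [key φ hφ hp _ hv, φ.open_source.mem_nhds hp, hO'] with q hq hqs hqO'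
      have hl : ∀ k, k ≠ i → ∀ᶠ x in 𝓝 q, x ∈ B → ∃ l, l ≠ k ∧ φ.extend J x l = 0 := by
        intro k hki
        filter_upwards [φ.open_source.mem_nhds hqs] with x hx hxB
        exact ⟨i, hki.symm, (hface x hx).1 hxB⟩
      constructor
      · intro hqO k hk h0
        rcases eq_or_ne k i with rfl | hki
        · exact hvi
        · exact (hq k hk h0 (hl k hki)).1 hqO
      · intro hqO k hk h0
        rcases eq_or_ne k i with rfl | hki
        · have h1 : coordDeriv J φ p v k = 0 := hqO'.resolve_right fun h => h hqO
          exact (by rw [PiLp.neg_apply, h1, neg_zero] : (-coordDeriv J φ p v) k = 0).ge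
        · exact (hq k hk h0 (hl k hki)).2 hqO
    · obtain ⟨v, hv⟩ := hex
      have hφ := IsManifold.chart_mem_maximalAtlas (I := J) (n := ∞) p
      refine ⟨chartAt H p, hφ, mem_chart_source H p, _,
        (c.rate_eq_chartFDeriv hφ (mem_chart_source H p) hf v) ▸ hv, ?_⟩
      filter_upwards [(isClosed_closure.union isClosed_closure).isOpen_compl.mem_nhds hpO] with q hq
      exact ⟨fun h => (hq (Or.inl (subset_closure h))).elim,
        fun h => (hq (Or.inr (subset_closure h))).elim⟩
  · obtain ⟨v, hv⟩ := hex
    have hφ := IsManifold.chart_mem_maximalAtlas (I := J) (n := ∞) p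
    have hp := mem_chart_source H p
    rw [c.rate_eq_chartFDeriv hφ hp hf] at hv
    refine ⟨chartAt H p, hφ, hp, _, hv, ?_⟩
    filter_upwards [key _ hφ hp _ hv, hBc.isOpen_compl.mem_nhds hpB] with q hq hqB
    have hl : ∀ k, ∀ᶠ x in 𝓝 q, x ∈ B → ∃ l, l ≠ k ∧ (chartAt H p).extend J x l = 0 := by
      intro k
      filter_upwards [hBc.isOpen_compl.mem_nhds hqB] with x hx hxB
      exact absurd hxB hx
    exact ⟨fun hqO k hk h0 => (hq k hk h0 (hl k)).1 hqO,
      fun hqO k hk h0 => (hq k hk h0 (hl k)).2 hqO⟩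

end LocalField

/-! ### Collapsing flows between regular levels -/

section Regular

variable {m : ℕ} {H : Type*} [TopologicalSpace H]
  {J : ModelWithCorners ℝ (EuclideanSpace ℝ (Fin m)) H}
  {X : Type*} [TopologicalSpace X] [ChartedSpace H X] [IsManifold J ∞ X]
  {P : Type*} [NormedAddCommGroup P] [NormedSpace ℝ P]
  {K : Set (Fin m)}

theorem Clock.continuous (c : Clock P) : Continuous c.ν :=
  continuous_iff_continuousAt.2 fun t => (c.hasDerivAt t).continuousAt

theorem exists_forall_abs_sub_le_notMem {Q : Set ℝ} (hQ : IsClosed Q) {t₁ : ℝ} (h : t₁ ∉ Q) :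
    ∃ ε > 0, ∀ t, |t - t₁| ≤ ε → t ∉ Q := by
  obtain ⟨ε, hε, hb⟩ := Metric.isOpen_iff.1 hQ.isOpen_compl t₁ h
  refine ⟨ε / 2, half_pos hε, fun t ht => hb ?_⟩
  rw [Metric.mem_ball, Real.dist_eq]
  linarith

/-- A slab between regular levels, in which all critical points have the right type, has a collapsing
flow. -/
theorem exists_isCollapsing [CompactSpace X] [T2Space X] [FiniteDimensional ℝ P]
    (hK : range J = {x | ∀ k ∈ K, 0 ≤ x k}) (c : Clock P) {f : X → P}
    (hf : ContMDiff J 𝓘(ℝ, P) ∞ f)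
    (hrate : ∀ x (v : TangentSpace J x), mfderiv J 𝓘(ℝ, P) f x v = c.rate J f x v • c.G (f x))
    (hne : ∀ x, c.rate J f x ≠ 0)
    (hopen : ∀ U : Set ℝ, IsOpen U → IsOpen {x | ∃ t ∈ U, f x = c.ν t})
    {B S Z : Set X} (hBc : IsClosed B) (hSc : IsClosed S) (hBS : J.boundary X ⊆ B ∪ S)
    (hZ : Z.Finite) (hBZ : ∀ p ∈ B, p ∉ Z → ∃ v, IsTangentTo J B p v ∧ c.rate J f p v ≠ 0)
    {Y : Type*} [TopologicalSpace Y] {g : Y → ℝ} {π : Y → X}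
    (hπ : IsEmbedding fun y => (π y, g y)) (hπf : ∀ y, f (π y) = c.ν (g y))
    (hπs : ∀ x t, f x = c.ν t → ∃ y, π y = x ∧ g y = t) {a b t₁ σ : ℝ} (hab : a < b)
    (hσ : σ = 1 ∧ t₁ = b ∨ σ = -1 ∧ t₁ = a)
    (hgood : ∀ p ∈ Z, (∃ t ∈ Icc a b, f p = c.ν t) → ∃ φ i v, IsFaceChart J B p φ i ∧
      0 < σ * c.rate J f p v ∧ 0 ≤ tangentCoord J φ i p v)
    {Q : Set P} (hQ : IsClosed Q) (hQt : c.ν t₁ ∉ Q) (hZQ : ∀ p ∈ Z, f p ∈ Q)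
    (hcap : ∀ q ∈ S, ∃ g, (IsCapPoint J c f S σ q g ∧ f q ∈ Q) ∨
      (IsCapPoint J c f S (-σ) q g ∧ ∀ t, f q = c.ν t → 0 ≤ σ * (t - t₁))) :
    ∃ (n : ℕ) (j : Y → EuclideanSpace ℝ (Fin n) × P) (Φ : _ → ℝ → _),
      IsCollapsing g j Φ a b t₁ σ := by
  have hσ0 : σ ≠ 0 := by rcases hσ with ⟨rfl, -⟩ | ⟨rfl, -⟩ <;> norm_num
  -- The points of `Z` over no time in `[a,b]`. `ε` is chosen such that the enlarged interval avoids
  -- their values and the times near `t₁` avoid `Q`.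
  let Zb : Set X := {p ∈ Z | ¬ ∃ t ∈ Icc a b, f p = c.ν t}
  have hZb : IsClosed (c.ν ⁻¹' (f '' Zb)) :=
    (((hZ.subset (sep_subset _ _)).image f).isClosed).preimage c.continuous
  have hZb' : ∀ t ∈ Icc a b, t ∉ c.ν ⁻¹' (f '' Zb) := by
    rintro t ht ⟨p, ⟨-, hp⟩, hpt⟩
    exact hp ⟨t, ht, hpt⟩
  obtain ⟨ε₁, hε₁, hQε⟩ := exists_forall_abs_sub_le_notMem (hQ.preimage c.continuous) hQt
  obtain ⟨ε₂, hε₂, hZa⟩ := exists_forall_abs_sub_le_notMem hZb (hZb' a ⟨le_rfl, hab.le⟩)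
  obtain ⟨ε₃, hε₃, hZb⟩ := exists_forall_abs_sub_le_notMem hZb (hZb' b ⟨hab.le, le_rfl⟩)
  set ε := min ε₁ (min ε₂ ε₃) with hε
  have hε0 : 0 < ε := lt_min hε₁ (lt_min hε₂ hε₃)
  have hle₁ : ε ≤ ε₁ := min_le_left _ _
  have hle₂ : ε ≤ ε₂ := (min_le_right _ _).trans (min_le_left _ _)
  have hle₃ : ε ≤ ε₃ := (min_le_right _ _).trans (min_le_right _ _)
  have hZε : ∀ t ∈ Icc (a - ε) (b + ε), t ∉ c.ν ⁻¹' (f '' Zb) := by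
    intro t ht
    rcases lt_or_ge t a with h1 | h1
    · exact hZa t (abs_le.2 ⟨by linarith [ht.1], by linarith⟩)
    rcases lt_or_ge b t with h2 | h2
    · exact hZb t (abs_le.2 ⟨by linarith, by linarith [ht.2]⟩)
    · exact hZb' t ⟨h1, h2⟩
  -- Where the forward flow has to stay in `X`: times slightly beyond `[a,b]`, to have an open set,
  -- but strictly before `t₁`. Below, `O'` surrounds the end level, where the flow must be
  -- reversible.
  let O : Set X := {x | ∃ t ∈ Ioo (a - ε) (b + ε) ∩ {t | σ * (t - t₁) < 0}, f x = c.ν t}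
  let O' : Set X := {x | ∃ t ∈ Ioo (t₁ - ε) (t₁ + ε), f x = c.ν t}
  have hO : IsOpen O := hopen _ (isOpen_Ioo.inter (isOpen_lt (by fun_prop) continuous_const))
  have hO' : IsOpen O' := hopen _ isOpen_Ioo
  have hclosed : ∀ α β, IsClosed {x | ∃ t ∈ Icc α β, f x = c.ν t} := by
    intro α β
    have : {x | ∃ t ∈ Icc α β, f x = c.ν t} = f ⁻¹' (c.ν '' Icc α β) := by
      ext x; exact ⟨fun ⟨t, ht, h⟩ => ⟨t, ht, h.symm⟩, fun ⟨t, ht, h⟩ => ⟨t, ht, h.symm⟩⟩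
    rw [this]
    exact (isCompact_Icc.image c.continuous).isClosed.preimage hf.continuous
  have hOcl : closure O ⊆ {x | ∃ t ∈ Icc (a - ε) (b + ε), f x = c.ν t} :=
    closure_minimal (fun x ⟨t, ht, hx⟩ => ⟨t, Ioo_subset_Icc_self ht.1, hx⟩) (hclosed _ _)
  have hOcl' : closure O' ⊆ {x | ∃ t ∈ Icc (t₁ - ε) (t₁ + ε), f x = c.ν t} :=
    closure_minimal (fun x ⟨t, ht, hx⟩ => ⟨t, Ioo_subset_Icc_self ht, hx⟩) (hclosed _ _)
  have hQO' : ∀ x, f x ∈ Q → x ∉ closure O' := by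
    intro x hx hxO
    obtain ⟨t, ht, hxt⟩ := hOcl' hxO
    refine hQε t (abs_le.2 ⟨by linarith [ht.1], by linarith [ht.2]⟩) ?_
    rw [mem_preimage, ← hxt]
    exact hx
  refine exists_isCollapsing_of_local hK c hf hrate hO hO'
    (exists_local_field hK hf hσ0 hBc hSc hBS hne ?_ ?_) hπ hπf hπs hab hσ ?_ ?_
  · intro q hq
    obtain ⟨g, h | h⟩ := hcap q hq
    · exact ⟨g, fun _ => h.1, fun hqO => (hQO' q h.2 (subset_closure hqO)).elim⟩
    · refine ⟨g, fun ⟨t, ht, hqt⟩ => ?_, fun _ => h.1⟩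
      exact ((h.2 t hqt).not_gt ht.2).elim
  · intro p hpB hpO
    -- At a point of `Z` the field may be transverse to `B`, as such points are away from `O'`; at
    -- all others a tangent vector of the right speed is available, up to sign.
    by_cases hpZ : p ∈ Z
    · have hpO' : p ∉ closure O' := hQO' p (hZQ p hpZ)
      obtain ⟨t, ht, hpt⟩ := hOcl (hpO.resolve_right hpO')
      have hpg : ∃ t ∈ Icc a b, f p = c.ν t := by
        by_contra hcon
        exact hZε t ht ⟨p, ⟨hpZ, hcon⟩, hpt⟩
      obtain ⟨φ, i, v, h1, h2, h3⟩ := hgood p hpZ hpg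
      exact ⟨φ, i, h1, v, h2, h3, Or.inr hpO'⟩
    · obtain ⟨v, ⟨φ, i, h1, h2⟩, h3⟩ := hBZ p hpB hpZ
      rcases lt_or_gt_of_ne (mul_ne_zero hσ0 h3) with h | h
      · have h4 : tangentCoord J φ i p (-v) = 0 := by
          change coordDeriv J φ p (-v) i = 0
          have h5 : coordDeriv J φ p v i = 0 := h2
          rw [map_neg, PiLp.neg_apply, h5, neg_zero]
        exact ⟨φ, i, h1, -v, by rw [map_neg, mul_neg]; linarith, h4.ge, Or.inl h4⟩
      · exact ⟨φ, i, h1, v, h, h2.ge, Or.inl h2⟩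
  · intro t ht htne x hx
    refine ⟨t, ⟨⟨by linarith [ht.1], by linarith [ht.2]⟩, ?_⟩, hx⟩
    rcases hσ with ⟨rfl, rfl⟩ | ⟨rfl, rfl⟩
    · have := lt_of_le_of_ne ht.2 htne
      change 1 * (t - t₁) < 0
      linarith
    · have := lt_of_le_of_ne ht.1 htne.symm
      change -1 * (t - t₁) < 0
      linarith
  · exact ⟨ε, hε0, fun t ht x hx => ⟨t, ht, hx⟩⟩

/-- At a critical point of the face `B`, the clock does not change along `B`, so it changes in the
direction that points inward. -/
theorem exists_inward_of_critical {B : Set X} {c : Clock P} {f : X → P} {p : X}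
    (hne : c.rate J f p ≠ 0) (hface : ∃ φ i, IsFaceChart J B p φ i)
    (hcrit : ∀ v, IsTangentTo J B p v → c.rate J f p v = 0)
    (hD : ¬ ∃ η : TangentSpace J p, IsOutward J B p η ∧ 0 < c.rate J f p η) :
    ∃ φ i v, IsFaceChart J B p φ i ∧ 0 < (1 : ℝ) * c.rate J f p v ∧ 0 ≤ tangentCoord J φ i p v := by
  obtain ⟨φ, i, hφ⟩ := hface
  obtain ⟨v, hv⟩ := coordDeriv_surjective (J := J) hφ.1 hφ.2.1 (EuclideanSpace.single i 1)
  have hvi : tangentCoord J φ i p v = 1 := by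
    change coordDeriv J φ p v i = 1
    rw [hv]; simp
  have hle : 0 ≤ c.rate J f p v := by
    by_contra hlt
    push Not at hlt
    refine hD ⟨-v, ⟨φ, i, hφ, ?_⟩, by rw [map_neg]; linarith⟩
    change coordDeriv J φ p (-v) i < 0
    have : coordDeriv J φ p v i = 1 := hvi
    rw [map_neg, PiLp.neg_apply, this]
    norm_num
  -- Otherwise the rate would vanish on `v` and on all vectors tangent to `B`, which together span
  -- the tangent space.
  have hv0 : c.rate J f p v ≠ 0 := by
    intro h0
    refine hne (ContinuousLinearMap.ext fun u => ?_)
    have h1 : c.rate J f p (u - tangentCoord J φ i p u • v) = 0 := by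
      refine hcrit _ ⟨φ, i, hφ, ?_⟩
      change coordDeriv J φ p (u - coordDeriv J φ p u i • v) i = 0
      have : coordDeriv J φ p v i = 1 := hvi
      rw [map_sub, map_smul, PiLp.sub_apply, PiLp.smul_apply, this]
      simp
    rw [map_sub, map_smul, h0, smul_zero, sub_zero] at h1
    exact h1
  exact ⟨φ, i, v, hφ, by rw [one_mul]; exact lt_of_le_of_ne hle hv0.symm, by rw [hvi]; norm_num⟩

end Regular

theorem exists_inward_of_outward {m : ℕ} {H : Type*} [TopologicalSpace H]
    {J : ModelWithCorners ℝ (EuclideanSpace ℝ (Fin m)) H} {X : Type*} [TopologicalSpace X]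
    [ChartedSpace H X] {P : Type*} [NormedAddCommGroup P] [NormedSpace ℝ P] {B : Set X} {c : Clock P} {f : X → P} {p : X}
    (hD : ∃ η : TangentSpace J p, IsOutward J B p η ∧ 0 < c.rate J f p η) :
    ∃ φ i v, IsFaceChart J B p φ i ∧ 0 < (-1 : ℝ) * c.rate J f p v ∧ 0 ≤ tangentCoord J φ i p v := by
  obtain ⟨η, ⟨φ, i, hφ, hη⟩, hpos⟩ := hD
  refine ⟨φ, i, -η, hφ, by rw [map_neg]; linarith, ?_⟩
  have h : coordDeriv J φ p η i < 0 := hη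
  change 0 ≤ coordDeriv J φ p (-η) i
  rw [map_neg, PiLp.neg_apply]
  linarith

/-! ### Critical points on a face -/

section Critical

variable {m : ℕ} {H : Type*} [TopologicalSpace H]
  {J : ModelWithCorners ℝ (EuclideanSpace ℝ (Fin m)) H}
  {X : Type*} [TopologicalSpace X] [ChartedSpace H X]
  {P : Type*} [NormedAddCommGroup P] [NormedSpace ℝ P]

/-- A closed subset of a compact space is compact, and a compact discrete set is finite. -/
theorem HasIsolatedPoints.finite [CompactSpace X] {A : Set X} (h : HasIsolatedPoints A)
    (hA : IsClosed A) : A.Finite := by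
  refine hA.isCompact.finite (isDiscrete_iff_nhdsNE.2 fun p hp => ?_)
  obtain ⟨U, hU, hUA⟩ := h p hp
  rw [← disjoint_iff, Filter.disjoint_principal_right, mem_nhdsWithin_iff_exists_mem_nhds_inter]
  refine ⟨U, hU, fun x hx hxA => hx.2 ?_⟩
  have : x ∈ U ∩ A := ⟨hx.1, hxA⟩
  rwa [hUA] at this

/-- The points of the face `B` at which the clock is constant along `B` to first order form a closed
set. -/
theorem isClosed_setOf_critical [IsManifold J ∞ X] {B : Set X} (hB : IsClosed B) (c : Clock P)
    {f : X → P} (hf : ContMDiff J 𝓘(ℝ, P) ∞ f) :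
    IsClosed {p | p ∈ B ∧ ∀ v, IsTangentTo J B p v → c.rate J f p v = 0} := by
  rw [← isOpen_compl_iff, isOpen_iff_mem_nhds]
  intro p hp
  by_cases hpB : p ∈ B
  swap
  · filter_upwards [hB.isOpen_compl.mem_nhds hpB] with x hx hx' using hx hx'.1
  have : ∃ v, IsTangentTo J B p v ∧ c.rate J f p v ≠ 0 := by
    by_contra hcon
    push Not at hcon
    exact hp ⟨hpB, hcon⟩
  obtain ⟨v, ⟨φ, i, hφ, hvi⟩, hv⟩ := this
  have hs : φ.source ∈ 𝓝 p := φ.open_source.mem_nhds hφ.2.1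
  have hc : ContinuousAt
      (fun q => c.form (f q) (chartFDeriv J φ f q (coordDeriv J φ p v))) p :=
    ((c.smooth_form.continuous.comp hf.continuous).continuousAt).clm_apply
      ((contMDiffOn_chartFDeriv hφ.1 hf _).continuousOn.continuousAt hs)
  rw [c.rate_eq_chartFDeriv hφ.1 hφ.2.1 hf] at hv
  filter_upwards [hs, hc.eventually_ne hv] with q hq hne hq'
  -- The same coordinate vector is tangent to `B` at all nearby points of `B`, since one face chart
  -- serves them all.
  obtain ⟨u, hu⟩ := coordDeriv_surjective (J := J) hφ.1 hq (coordDeriv J φ p v)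
  refine hne ?_
  rw [← hu, ← c.rate_eq_chartFDeriv hφ.1 hq hf]
  refine hq'.2 u ⟨φ, i, ⟨hφ.1, hq, hφ.2.2⟩, ?_⟩
  change coordDeriv J φ q u i = 0
  rw [hu]
  exact hvi

end Critical

/-! ### Tame functions -/

section Tame

/-- The clock of a real valued function. -/
def realClock : Clock ℝ where
  ν := id
  G := fun _ => 1
  form := fun _ => ContinuousLinearMap.id ℝ ℝ
  hasDerivAt := hasDerivAt_id
  lipschitz := ⟨0, LipschitzWith.const 1⟩
  smooth_form := contDiff_const

variable {d : ℕ} {X : Type*} [TopologicalSpace X] [ChartedSpace (EuclideanQuadrant (d + 1)) X]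
  {W : BoundaryCobordism d X} {f : X → ℝ}

theorem range_corners (m : ℕ) : range (Corners m) = {x | ∀ k ∈ (univ : Set (Fin m)), 0 ≤ x k} := by
  simp only [mem_univ, true_imp_iff]
  exact range_euclideanQuadrant m

namespace IsTame

theorem finite_crit (hf : IsTame W f) [CompactSpace X] [IsManifold (Corners (d + 1)) ∞ X] : (W.crit f).Finite :=
  hf.isolated.finite (isClosed_setOf_critical W.isFace_side.1 realClock hf.smooth)

theorem rate_ne_zero (hf : IsTame W f) (x : X) : realClock.rate (Corners (d + 1)) f x ≠ 0 := by
  intro h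
  obtain ⟨v, hv⟩ := hf.submersive x (1 : ℝ)
  have h1 : realClock.rate (Corners (d + 1)) f x v = (1 : ℝ) := hv
  rw [h] at h1
  exact zero_ne_one h1

/-- `0` is the minimal value of `f`, and near `q` the upper cap is out of reach, so `f` is constant
on the caps. -/
theorem isCapPoint_of_eq_zero (hf : IsTame W f) {q : X} (hq : f q = 0) :
    IsCapPoint (Corners (d + 1)) realClock f (W.bottom ∪ W.top) 1 q f where
  mdifferentiableAt := (hf.smooth.contMDiffAt (x := q)).mdifferentiableAt (by simp)
  mfderiv_eq _ := rfl
  eq_of_mem := by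
    have h1 : ∀ᶠ x in 𝓝 q, f x ≠ 1 :=
      hf.smooth.continuous.continuousAt.eventually_ne (by rw [hq]; norm_num)
    filter_upwards [h1] with x hx
    rw [hf.bottom_eq, hf.top_eq, hq]
    rintro (h | h)
    exacts [h, (hx h).elim]
  le := .of_forall fun x => by linarith [(hf.mem_Icc x).1]

theorem isCapPoint_of_eq_one (hf : IsTame W f) {q : X} (hq : f q = 1) :
    IsCapPoint (Corners (d + 1)) realClock f (W.bottom ∪ W.top) (-1) q f where
  mdifferentiableAt := (hf.smooth.contMDiffAt (x := q)).mdifferentiableAt (by simp)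
  mfderiv_eq _ := rfl
  eq_of_mem := by
    have h1 : ∀ᶠ x in 𝓝 q, f x ≠ 0 :=
      hf.smooth.continuous.continuousAt.eventually_ne (by rw [hq]; norm_num)
    filter_upwards [h1] with x hx
    rw [hf.bottom_eq, hf.top_eq, hq]
    rintro (h | h)
    exacts [(hx h).elim, h]
  le := .of_forall fun x => by linarith [(hf.mem_Icc x).2]

theorem exists_isCollapsing (hf : IsTame W f) [CompactSpace X] [T2Space X] [IsManifold (Corners (d + 1)) ∞ X]
    {a b t₁ ς : ℝ} (hab : a < b) (h0 : 0 ≤ a) (h1 : b ≤ 1)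
    (hς : ς = 1 ∧ t₁ = b ∨ ς = -1 ∧ t₁ = a) (ht₁ : ∀ p ∈ W.crit f, f p ≠ t₁)
    (hN : ∀ p ∈ W.crit f, f p ∈ Icc a b → ς = 1 → ¬ IsTypeD W f p)
    (hD : ∀ p ∈ W.crit f, f p ∈ Icc a b → ς = -1 → IsTypeD W f p) :
    ∃ (n : ℕ) (j : X → EuclideanSpace ℝ (Fin n) × ℝ) (Φ : _ → ℝ → _),
      IsCollapsing f j Φ a b t₁ ς := by
  have hfin := hf.finite_crit
  refine SectionSpace.exists_isCollapsing (range_corners _) realClock hf.smooth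
    (fun x v => (mul_one (realClock.rate (Corners (d + 1)) f x v)).symm) hf.rate_ne_zero ?_ W.isFace_side.1
    (W.isFace_bottom.1.union W.isFace_top.1) ?_ hfin ?_ (π := id)
    (.of_leftInverse (f := Prod.fst) (fun _ => rfl) continuous_fst
      (continuous_id.prodMk hf.smooth.continuous))
    (fun _ => rfl) (fun x t h => ⟨x, rfl, h⟩) hab hς ?_
    -- The values that the neighbourhood of the end level must avoid: critical values, and the cap
    -- values unless the end level is itself a cap.
    (Q := f '' W.crit f ∪ {0, 1} \ {t₁}) ?_ ?_ (fun p hp => .inl (mem_image_of_mem f hp)) ?_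
  · intro U hU
    convert hU.preimage hf.smooth.continuous using 1
    ext x
    exact ⟨fun ⟨t, ht, hx⟩ => by rw [mem_preimage, hx]; exact ht, fun hx => ⟨f x, hx, rfl⟩⟩
  · rw [W.boundary_eq]
    rintro x ((h | h) | h)
    exacts [.inr (.inl h), .inl h, .inr (.inr h)]
  · intro p hp hpZ
    by_contra hcon
    push Not at hcon
    exact hpZ ⟨hp, hcon⟩
  · rintro p hp ⟨t, ht, hpt⟩
    have hpt : f p ∈ Icc a b := by rw [hpt]; exact ht
    rcases hς with ⟨rfl, -⟩ | ⟨rfl, -⟩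
    · exact exists_inward_of_critical (hf.rate_ne_zero p) (W.isFace_side.2 p hp.1) hp.2
        (hN p hp hpt rfl)
    · exact exists_inward_of_outward (hD p hp hpt rfl)
  · exact ((hfin.image f).union ((toFinite _).subset sdiff_subset)).isClosed
  · rintro (⟨p, hp, hpt⟩ | h)
    exacts [ht₁ p hp hpt, h.2 rfl]
  -- The cap which the flow leaves is an inward cap and is away from the end level; the cap which it
  -- approaches is at or beyond the end, so only the backward flow has to enter `X` there.
  · rintro q (hq | hq)
    · rw [hf.bottom_eq] at hq
      have hq : f q = 0 := hq
      refine ⟨f, ?_⟩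
      rcases hς with ⟨rfl, rfl⟩ | ⟨rfl, rfl⟩
      · exact .inl ⟨hf.isCapPoint_of_eq_zero hq, .inr ⟨.inl hq, fun h => by
          have : f q = t₁ := h
          linarith⟩⟩
      · refine .inr ⟨by rw [neg_neg]; exact hf.isCapPoint_of_eq_zero hq, fun t ht => ?_⟩
        have : f q = t := ht
        linarith
    · rw [hf.top_eq] at hq
      have hq : f q = 1 := hq
      refine ⟨f, ?_⟩
      rcases hς with ⟨rfl, rfl⟩ | ⟨rfl, rfl⟩
      · refine .inr ⟨hf.isCapPoint_of_eq_one hq, fun t ht => ?_⟩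
        have : f q = t := ht
        linarith
      · exact .inl ⟨hf.isCapPoint_of_eq_one hq, .inr ⟨.inr hq, fun h => by
          have : f q = t₁ := h
          linarith⟩⟩

end IsTame

namespace Subdivision

variable {n : ℕ} (S : Subdivision W f n)

theorem s_mem (j : Fin (n + 1)) : S.s j ∈ Icc (0 : ℝ) 1 := S.subset (S.levels.mem j)

theorem apply_notMem_of_ne {i j : Fin n} (h : j ≠ i) :
    f (S.p j) ∉ Icc (S.s i.castSucc) (S.s i.succ) := by
  have hm : Monotone S.s := S.levels.strictMono.monotone
  rcases lt_or_gt_of_ne h with h | h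
  · intro hj
    have h1 := hm (show j.succ ≤ i.castSucc by rw [Fin.le_def]; simpa using h)
    linarith [S.lt_right j, hj.1]
  · intro hj
    have h1 := hm (show i.succ ≤ j.castSucc by rw [Fin.le_def]; simpa using h)
    linarith [S.left_lt j, hj.2]

/-- The only critical value in the slab is that of `S.p i`, strictly between the levels, so its type
alone fixes the direction of the flow. -/
theorem exists_isCollapsing [CompactSpace X] [T2Space X] [IsManifold (Corners (d + 1)) ∞ X]
    (hf : IsTame W f) (i : Fin n) :
    ∃ (ς : ℝ) (k : ℕ) (j : X → EuclideanSpace ℝ (Fin k) × ℝ) (Φ : _ → ℝ → _),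
      IsCollapsing f j Φ (S.levels.s i.castSucc) (S.levels.s i.succ)
        (S.levels.s (S.levels.plus i)) ς := by
  have hlt : S.s i.castSucc < S.s i.succ := (S.left_lt i).trans (S.lt_right i)
  have hp : ∀ p ∈ W.crit f, f p ∈ Icc (S.s i.castSucc) (S.s i.succ) → p = S.p i := by
    intro p hp hpi
    rw [← S.range_p] at hp
    obtain ⟨j, rfl⟩ := hp
    by_contra hne
    exact S.apply_notMem_of_ne (fun h => hne (by rw [h])) hpi
  by_cases hD : IsTypeD W f (S.p i)
  · have hplus : S.levels.plus i = i.castSucc := by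
      have : S.levels.D i := hD
      simp [Levels.plus, this]
    rw [hplus]
    refine ⟨-1, hf.exists_isCollapsing hlt (S.s_mem _).1 (S.s_mem _).2 (.inr ⟨rfl, rfl⟩) ?_
      (fun _ _ _ h => by norm_num at h) fun p hpc h _ => by rwa [hp p hpc h]⟩
    rintro p hpc h
    have := hp p hpc (by rw [h]; exact ⟨le_rfl, hlt.le⟩)
    subst this
    exact (S.left_lt i).ne' h
  · have hplus : S.levels.plus i = i.succ := by
      have : ¬ S.levels.D i := hD
      simp [Levels.plus, this]
    rw [hplus]
    refine ⟨1, hf.exists_isCollapsing hlt (S.s_mem _).1 (S.s_mem _).2 (.inl ⟨rfl, rfl⟩) ?_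
      (fun p hpc h _ => by rwa [hp p hpc h]) fun _ _ _ h => by norm_num at h⟩
    rintro p hpc h
    have := hp p hpc (by rw [h]; exact ⟨hlt.le, le_rfl⟩)
    subst this
    exact (S.lt_right i).ne h

/-- Without critical points all of `X` is one slab on which no type has to be respected. -/
theorem nonempty_fibrewiseRetraction_of_isEmpty [CompactSpace X] [T2Space X]
    [IsManifold (Corners (d + 1)) ∞ X] (hf : IsTame W f) (S : Subdivision W f 0) :
    Nonempty (FibrewiseRetraction f 0 1 1) := by
  have he : ∀ p, p ∉ W.crit f := by
    intro p hp
    rw [← S.range_p] at hp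
    obtain ⟨i, -⟩ := hp
    exact i.elim0
  obtain ⟨n, j, Φ, h⟩ := hf.exists_isCollapsing zero_lt_one le_rfl le_rfl (.inl ⟨rfl, rfl⟩)
    (fun p hp => (he p hp).elim) (fun p hp => (he p hp).elim) fun p hp => (he p hp).elim
  exact h.nonempty_fibrewiseRetraction

end Subdivision

end Tame

/-! ### Tame maps to the circle -/

section CircleTame

theorem isOpenMap_circleMap : IsOpenMap circleMap := by
  refine isLocalHomeomorph_circleExp.isOpenMap.comp ?_
  exact (Homeomorph.mulLeft₀ (2 * Real.pi) (by positivity)).isOpenMap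

/-- The clock of a circle valued function. -/
def circleClock : Clock ℂ where
  ν t := circleMap t
  -- The rotation field of unit angular period, and below the form `dθ / 2π`, which takes the value
  -- `1` on it along the circle.
  G z := ContinuousLinearMap.mul ℝ ℂ (2 * Real.pi * Complex.I) z
  form z := (2 * Real.pi)⁻¹ •
    Complex.imCLM.comp (ContinuousLinearMap.mul ℝ ℂ (Complex.conjCLE z))
  hasDerivAt t := by
    have h1 : (fun t => (circleMap t : ℂ)) =
        fun t : ℝ => Complex.exp ((t : ℂ) * (2 * Real.pi * Complex.I)) := by
      funext t
      rw [circleMap, Circle.coe_exp]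
      push_cast
      ring_nf
    have h2 : HasDerivAt (fun t : ℝ => (t : ℂ) * (2 * Real.pi * Complex.I))
        (1 * (2 * Real.pi * Complex.I)) t :=
      (Complex.ofRealCLM.hasDerivAt (x := t)).mul_const _
    have h3 := h2.cexp
    rw [mul_comm (Complex.exp _), one_mul] at h3
    have h4 := congrFun h1 t
    rw [h1]
    rw [ContinuousLinearMap.mul_apply', h4]
    exact h3
  lipschitz := ⟨_, (ContinuousLinearMap.mul ℝ ℂ (2 * Real.pi * Complex.I)).lipschitz⟩
  smooth_form := (contDiff_const.clm_comp
    ((ContinuousLinearMap.mul ℝ ℂ).contDiff.comp Complex.conjCLE.contDiff)).const_smul _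

theorem two_pi_mul_circleClock_form (z w : ℂ) :
    2 * Real.pi * circleClock.form z w = (starRingEnd ℂ z * w).im := by
  have : (2 * Real.pi) ≠ 0 := by positivity
  change 2 * Real.pi * ((2 * Real.pi)⁻¹ * (starRingEnd ℂ z * w).im) = _
  rw [mul_inv_cancel_left₀ this]

/-- A vector orthogonal to `z` is a real multiple of `i z`, because `z̄ w` is purely imaginary. -/
theorem eq_circleClock_form_smul (z : Circle) (w : ℂ) (h0 : inner ℝ (z : ℂ) w = 0) :
    w = circleClock.form z w • circleClock.G z := by
  have h1 := two_pi_mul_circleClock_form z w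
  have hre : (starRingEnd ℂ (z : ℂ) * w).re = 0 := by
    rw [Complex.inner] at h0
    simpa [mul_comm] using h0
  have hz : (z : ℂ) * starRingEnd ℂ (z : ℂ) = 1 := by
    rw [Complex.mul_conj, Circle.normSq_coe, Complex.ofReal_one]
  have hw : starRingEnd ℂ (z : ℂ) * w =
      ((2 * Real.pi * circleClock.form z w : ℝ) : ℂ) * Complex.I := by
    rw [h1]
    apply Complex.ext
    · simpa using hre
    · simp
  have h2 : w = (z : ℂ) * (starRingEnd ℂ (z : ℂ) * w) := by rw [← mul_assoc, hz, one_mul]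
  change w = circleClock.form z w • (2 * Real.pi * Complex.I * (z : ℂ))
  rw [Complex.real_smul]
  rw [hw] at h2
  refine h2.trans ?_
  push_cast
  ring

variable {d : ℕ} {X : Type*} [TopologicalSpace X] [ChartedSpace (EuclideanHalfSpace (d + 1)) X]
  {f : X → Circle}

theorem two_pi_mul_circleClock_rate (f : X → Circle) (x : X) (v : TangentSpace (𝓡∂ (d + 1)) x) :
    2 * Real.pi * circleClock.rate (𝓡∂ (d + 1)) (fun x => (f x : ℂ)) x v = angularDeriv f x v :=
  two_pi_mul_circleClock_form _ _

theorem angularDeriv_pos_iff (f : X → Circle) (x : X) (v : TangentSpace (𝓡∂ (d + 1)) x) :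
    0 < angularDeriv f x v ↔
      0 < circleClock.rate (𝓡∂ (d + 1)) (fun x => (f x : ℂ)) x v := by
  rw [← two_pi_mul_circleClock_rate]
  exact mul_pos_iff_of_pos_left (by positivity)

theorem isCircleTypeD_iff (f : X → Circle) (p : X) :
    IsCircleTypeD d f p ↔ ∃ η : TangentSpace (𝓡∂ (d + 1)) p,
      IsOutward (𝓡∂ (d + 1)) ((𝓡∂ (d + 1)).boundary X) p η ∧
        0 < circleClock.rate (𝓡∂ (d + 1)) (fun x => (f x : ℂ)) p η := by
  unfold IsCircleTypeD
  simp only [angularDeriv_pos_iff]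

theorem range_halfSpace :
    range (𝓡∂ (d + 1)) = {x | ∀ k ∈ ({0} : Set (Fin (d + 1))), 0 ≤ x k} := by
  simp only [mem_singleton_iff, forall_eq]
  exact range_euclideanHalfSpace (d + 1)

theorem exists_isFaceChart_boundary [IsManifold (𝓡∂ (d + 1)) ∞ X] (p : X) :
    ∃ φ i, IsFaceChart (𝓡∂ (d + 1)) ((𝓡∂ (d + 1)).boundary X) p φ i := by
  refine ⟨chartAt _ p, 0, IsManifold.chart_mem_maximalAtlas p, mem_chart_source _ p, fun y hy => ?_⟩
  rw [mem_boundary_iff (IsManifold.chart_mem_maximalAtlas p) range_halfSpace hy]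
  simp

theorem contMDiff_coe_circle : ContMDiff (𝓡 1) 𝓘(ℝ, ℂ) ∞ (fun z : Circle => (z : ℂ)) :=
  have := finrank_real_complex_fact'
  contMDiff_coe_sphere (E := ℂ)

theorem mfderiv_coe_circle_injective (z : Circle) :
    Function.Injective (mfderiv (𝓡 1) 𝓘(ℝ, ℂ) (fun z : Circle => (z : ℂ)) z) :=
  have := finrank_real_complex_fact'
  injective_mvfderiv_subtypeVal_sphere (E := ℂ) (n := 1) z

theorem inner_mfderiv_coe_circle (z : Circle) (v : TangentSpace (𝓡 1) z) :
    inner ℝ (z : ℂ) (mfderiv (𝓡 1) 𝓘(ℝ, ℂ) (fun z : Circle => (z : ℂ)) z v : ℂ) = 0 := by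
  have := finrank_real_complex_fact'
  have h := range_mvfderiv_subtypeVal (E := ℂ) (n := 1) z
  have h2 : (mfderiv (𝓡 1) 𝓘(ℝ, ℂ) (fun z : Circle => (z : ℂ)) z v : ℂ) ∈ (ℝ ∙ (z : ℂ))ᗮ := by
    rw [← h]
    exact ⟨v, rfl⟩
  exact Submodule.mem_orthogonal_singleton_iff_inner_right.1 h2

namespace IsCircleTame

theorem contMDiff_coe (hf : IsCircleTame d f) : ContMDiff (𝓡∂ (d + 1)) 𝓘(ℝ, ℂ) ∞ (fun x => (f x : ℂ)) :=
  contMDiff_coe_circle.comp hf.smooth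

theorem mfderiv_coe (hf : IsCircleTame d f) (x : X) (v : TangentSpace (𝓡∂ (d + 1)) x) :
    mfderiv (𝓡∂ (d + 1)) 𝓘(ℝ, ℂ) (fun x => (f x : ℂ)) x v =
      mfderiv (𝓡 1) 𝓘(ℝ, ℂ) (fun z : Circle => (z : ℂ)) (f x) (mfderiv (𝓡∂ (d + 1)) (𝓡 1) f x v) := by
  have h := mfderiv_comp x
    ((contMDiff_coe_circle.contMDiffAt (x := f x)).mdifferentiableAt (by simp))
    ((hf.smooth.contMDiffAt (x := x)).mdifferentiableAt (by simp))
  exact congrArg (fun A => A v) h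

theorem mfderiv_coe_eq_rate_smul (hf : IsCircleTame d f) (x : X) (v : TangentSpace (𝓡∂ (d + 1)) x) :
    mfderiv (𝓡∂ (d + 1)) 𝓘(ℝ, ℂ) (fun x => (f x : ℂ)) x v =
      circleClock.rate (𝓡∂ (d + 1)) (fun x => (f x : ℂ)) x v • circleClock.G (f x) := by
  rw [circleClock.rate_apply]
  refine eq_circleClock_form_smul (f x) _ ?_
  rw [hf.mfderiv_coe]
  exact inner_mfderiv_coe_circle _ _

/-- The circle is immersed in `ℂ` and its tangent lines are spanned by `circleClock.G`, so no
information is lost by passing to complex values. -/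
theorem rate_eq_zero_iff (hf : IsCircleTame d f) (x : X) (v : TangentSpace (𝓡∂ (d + 1)) x) :
    circleClock.rate (𝓡∂ (d + 1)) (fun x => (f x : ℂ)) x v = 0 ↔
      mfderiv (𝓡∂ (d + 1)) (𝓡 1) f x v = 0 := by
  constructor
  · intro h
    have h1 := hf.mfderiv_coe_eq_rate_smul x v
    rw [h, zero_smul, hf.mfderiv_coe] at h1
    refine mfderiv_coe_circle_injective (f x) ?_
    rw [map_zero]
    exact h1
  · intro h
    rw [circleClock.rate_apply, hf.mfderiv_coe, h, map_zero]
    exact map_zero _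

theorem circleCrit_eq (hf : IsCircleTame d f) : circleCrit d f = {p | p ∈ (𝓡∂ (d + 1)).boundary X ∧
    ∀ v, IsTangentTo (𝓡∂ (d + 1)) ((𝓡∂ (d + 1)).boundary X) p v →
      circleClock.rate (𝓡∂ (d + 1)) (fun x => (f x : ℂ)) p v = 0} := by
  simp only [hf.rate_eq_zero_iff]
  rfl

theorem finite_circleCrit (hf : IsCircleTame d f) [CompactSpace X] [IsManifold (𝓡∂ (d + 1)) ∞ X] :
    (circleCrit d f).Finite := by
  refine hf.isolated.finite ?_
  rw [hf.circleCrit_eq]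
  exact isClosed_setOf_critical (ModelWithCorners.isClosed_boundary (n := ∞) (by simp))
    circleClock hf.contMDiff_coe

theorem rate_ne_zero (hf : IsCircleTame d f) (x : X) :
    circleClock.rate (𝓡∂ (d + 1)) (fun x => (f x : ℂ)) x ≠ 0 := by
  intro h
  have hs := hf.submersive x
  obtain ⟨v, hv⟩ := hs (EuclideanSpace.single (0 : Fin 1) (1 : ℝ))
  rw [(hf.rate_eq_zero_iff x v).1 (by rw [h]; rfl)] at hv
  have h1 : (0 : EuclideanSpace ℝ (Fin 1)) = EuclideanSpace.single 0 1 := hv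
  have h2 := congrArg (fun w : EuclideanSpace ℝ (Fin 1) => w 0) h1
  simp at h2

/-- There are no caps. The field lives on `X`, whereas the slab lies in the pullback, where the
height distinguishes the times that the circle identifies. -/
theorem exists_isCollapsing (hf : IsCircleTame d f) [CompactSpace X] [T2Space X] [IsManifold (𝓡∂ (d + 1)) ∞ X]
    {a b t₁ ς : ℝ} (hab : a < b) (hς : ς = 1 ∧ t₁ = b ∨ ς = -1 ∧ t₁ = a)
    (ht₁ : ∀ p ∈ circleCrit d f, f p ≠ circleMap t₁)
    (hN : ∀ p ∈ circleCrit d f, (∃ t ∈ Icc a b, f p = circleMap t) → ς = 1 →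
      ¬ IsCircleTypeD d f p)
    (hD : ∀ p ∈ circleCrit d f, (∃ t ∈ Icc a b, f p = circleMap t) → ς = -1 →
      IsCircleTypeD d f p) :
    ∃ (n : ℕ) (j : Pullback f → EuclideanSpace ℝ (Fin n) × ℂ) (Φ : _ → ℝ → _),
      IsCollapsing (height f) j Φ a b t₁ ς := by
  have hfin := hf.finite_circleCrit
  have hcoe : ∀ {p : X} {t : ℝ}, (f p : ℂ) = circleClock.ν t → f p = circleMap t :=
    fun h => Subtype.ext h
  refine SectionSpace.exists_isCollapsing range_halfSpace circleClock hf.contMDiff_coe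
    hf.mfderiv_coe_eq_rate_smul hf.rate_ne_zero ?_
    (ModelWithCorners.isClosed_boundary (n := ∞) (by simp)) isClosed_empty
    subset_union_left hfin ?_ (π := fun y => y.1.1) IsEmbedding.subtypeVal
    (fun y => congrArg _ y.2) (fun x t h => ⟨⟨(x, t), hcoe h⟩, rfl, rfl⟩) hab hς ?_
    (Q := (fun x => (f x : ℂ)) '' circleCrit d f) (hfin.image _).isClosed ?_
    (fun p hp => mem_image_of_mem _ hp) fun q hq => hq.elim
  · intro U hU
    convert (isOpenMap_circleMap U hU).preimage hf.smooth.continuous using 1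
    ext x
    exact ⟨fun ⟨t, ht, hx⟩ => ⟨t, ht, (hcoe hx).symm⟩,
      fun ⟨t, ht, hx⟩ => ⟨t, ht, congrArg _ hx.symm⟩⟩
  · intro p hp hpZ
    rw [hf.circleCrit_eq] at hpZ
    by_contra hcon
    push Not at hcon
    exact hpZ ⟨hp, hcon⟩
  · rintro p hp ⟨t, ht, hpt⟩
    have hpt : ∃ t ∈ Icc a b, f p = circleMap t := ⟨t, ht, hcoe hpt⟩
    have hp' := hp
    rw [hf.circleCrit_eq] at hp'
    rcases hς with ⟨rfl, -⟩ | ⟨rfl, -⟩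
    · refine exists_inward_of_critical (hf.rate_ne_zero p) (exists_isFaceChart_boundary p) hp'.2 ?_
      rw [← isCircleTypeD_iff]
      exact hN p hp hpt rfl
    · refine exists_inward_of_outward ?_
      rw [← isCircleTypeD_iff]
      exact hD p hp hpt rfl
  · rintro ⟨p, hp, hpt⟩
    exact ht₁ p hp (hcoe hpt)

end IsCircleTame

namespace CircleSubdivision

variable {n : ℕ} (S : CircleSubdivision d f n)

theorem t_mem_Ioo (i : Fin n) : S.t i ∈ Ioo (S.s 0) (S.s 0 + 1) := by
  have hm : Monotone S.s := S.levels.strictMono.monotone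
  refine ⟨(hm (Fin.zero_le _)).trans_lt (S.left_lt i), (S.lt_right i).trans_le ?_⟩
  rw [← S.s_last]
  exact hm (Fin.le_last _)

theorem t_notMem_of_ne {i j : Fin n} (h : j ≠ i) :
    S.t j ∉ Icc (S.s i.castSucc) (S.s i.succ) := by
  have hm : Monotone S.s := S.levels.strictMono.monotone
  rcases lt_or_gt_of_ne h with h | h
  · intro hj
    have h1 := hm (show j.succ ≤ i.castSucc by rw [Fin.le_def]; simpa using h)
    linarith [S.lt_right j, hj.1]
  · intro hj
    have h1 := hm (show i.succ ≤ j.castSucc by rw [Fin.le_def]; simpa using h)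
    linarith [S.left_lt j, hj.2]

/-- `t` and some `S.t j` differ by an integer, one lies in `[s₀, s₀ + 1]` and the other in its
interior, so they are equal. -/
theorem eq_of_apply_eq {i : Fin n} {p : X} (hp : p ∈ circleCrit d f) {t : ℝ}
    (ht : t ∈ Icc (S.s i.castSucc) (S.s i.succ)) (hpt : f p = circleMap t) :
    p = S.p i ∧ t = S.t i := by
  rw [← S.range_p] at hp
  obtain ⟨j, rfl⟩ := hp
  rw [← S.circleMap_t] at hpt
  obtain ⟨m, hm⟩ := circleMap_eq_iff.1 hpt
  have h1 := S.t_mem_Ioo j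
  have h2 : t ∈ Icc (S.s 0) (S.s (Fin.last n)) := S.levels.interval_subset i ht
  rw [S.s_last] at h2
  have h3 : (m : ℝ) < 1 := by linarith [h1.2, h2.1]
  have h4 : (-1 : ℝ) < m := by linarith [h1.1, h2.2]
  obtain rfl : m = 0 := by
    have h5 : m < 1 := by exact_mod_cast h3
    have h6 : -1 < m := by exact_mod_cast h4
    omega
  have h7 : S.t j = t := by simpa using hm
  obtain rfl : j = i := by
    by_contra hne
    exact S.t_notMem_of_ne hne (by rwa [h7])
  exact ⟨rfl, h7.symm⟩

theorem exists_isCollapsing [CompactSpace X] [T2Space X] [IsManifold (𝓡∂ (d + 1)) ∞ X]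
    (hf : IsCircleTame d f) (i : Fin n) :
    ∃ (ς : ℝ) (k : ℕ) (j : Pullback f → EuclideanSpace ℝ (Fin k) × ℂ) (Φ : _ → ℝ → _),
      IsCollapsing (height f) j Φ (S.levels.s i.castSucc) (S.levels.s i.succ)
        (S.levels.s (S.levels.plus i)) ς := by
  have hlt : S.s i.castSucc < S.s i.succ := (S.left_lt i).trans (S.lt_right i)
  by_cases hD : IsCircleTypeD d f (S.p i)
  · have hplus : S.levels.plus i = i.castSucc := by
      have : S.levels.D i := hD
      simp [Levels.plus, this]
    rw [hplus]
    refine ⟨-1, hf.exists_isCollapsing hlt (.inr ⟨rfl, rfl⟩)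
      (fun p hp h => (S.left_lt i).ne (S.eq_of_apply_eq hp ⟨le_rfl, hlt.le⟩ h).2)
      (fun _ _ _ h => by norm_num at h) fun p hp ⟨t, ht, h⟩ _ => ?_⟩
    rwa [(S.eq_of_apply_eq hp ht h).1]
  · have hplus : S.levels.plus i = i.succ := by
      have : ¬ S.levels.D i := hD
      simp [Levels.plus, this]
    rw [hplus]
    refine ⟨1, hf.exists_isCollapsing hlt (.inl ⟨rfl, rfl⟩)
      (fun p hp h => (S.lt_right i).ne' (S.eq_of_apply_eq hp ⟨hlt.le, le_rfl⟩ h).2)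
      (fun p hp ⟨t, ht, h⟩ _ => ?_) fun _ _ _ h => by norm_num at h⟩
    rwa [(S.eq_of_apply_eq hp ht h).1]

end CircleSubdivision

end CircleTame

/-! ### Existence of subdivisions -/

section Subdivide

theorem exists_interleaving {n : ℕ} {t : Fin n → ℝ} (ht : StrictMono t) {a b : ℝ}
    (hab : ∀ i, t i ∈ Ioo a b) :
    ∃ s : Fin (n + 1) → ℝ, s 0 = a ∧ (0 < n → s (Fin.last n) = b) ∧
      (∀ i, s i.castSucc < t i) ∧ ∀ i, t i < s i.succ := by
  -- Midpoints of consecutive `t`, with `a` and `b` at the ends. Index `0` is tested first, so for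
  -- `n = 0` the only level is `a`.
  let s : Fin (n + 1) → ℝ := fun j => if h0 : j.val = 0 then a else
    if h : j.val < n then (t ⟨j.val - 1, by omega⟩ + t ⟨j.val, h⟩) / 2 else b
  refine ⟨s, by simp [s], fun hn => by simp [s, hn.ne'], fun i => ?_, fun i => ?_⟩
  · by_cases h0 : i.val = 0
    · simp only [s, Fin.val_castSucc, h0, dif_pos]
      exact (hab i).1
    · have h1 : t ⟨i.val - 1, by omega⟩ < t i := ht (Fin.lt_def.2 (by change i.val - 1 < _; omega))
      simp only [s, Fin.val_castSucc, h0, i.2, dif_pos, dif_neg, not_false_eq_true]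
      linarith
  · by_cases h : i.val + 1 < n
    · have h1 : t i < t ⟨i.val + 1, h⟩ := ht (Fin.lt_def.2 (by change i.val < i.val + 1; omega))
      simp only [s, Fin.val_succ, Nat.succ_ne_zero, h, dif_pos, dif_neg, not_false_eq_true,
        Nat.add_sub_cancel]
      linarith
    · simp only [s, Fin.val_succ, Nat.succ_ne_zero, h, dif_neg, not_false_eq_true]
      exact (hab i).2

theorem exists_enumeration {X : Type*} {A : Set X} (hA : A.Finite) {g : X → ℝ} (hg : InjOn g A) :
    ∃ (n : ℕ) (p : Fin n → X), range p = A ∧ StrictMono fun i => g (p i) := by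
  have hfin := hA.image g
  let T := hfin.toFinset
  have hT : ∀ i, T.orderEmbOfFin rfl i ∈ g '' A := fun i =>
    hfin.mem_toFinset.1 (T.orderEmbOfFin_mem rfl i)
  choose p hpA hp using hT
  refine ⟨T.card, p, Subset.antisymm (range_subset_iff.2 hpA) fun x hx => ?_, ?_⟩
  · have h1 : g x ∈ range (T.orderEmbOfFin rfl) := by
      rw [T.range_orderEmbOfFin rfl]
      exact hfin.mem_toFinset.2 (mem_image_of_mem g hx)
    obtain ⟨i, hi⟩ := h1
    exact ⟨i, hg (hpA i) hx ((hp i).trans hi)⟩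
  · simp only [hp]
    exact (T.orderEmbOfFin rfl).strictMono

end Subdivide

theorem IsTame.exists_subdivision {d : ℕ} {X : Type*} [TopologicalSpace X] [CompactSpace X]
    [ChartedSpace (EuclideanQuadrant (d + 1)) X] [IsManifold (Corners (d + 1)) ∞ X]
    {W : BoundaryCobordism d X} {f : X → ℝ} (hf : IsTame W f) :
    ∃ n, Nonempty (Subdivision W f n) := by
  obtain ⟨n, p, hp, hm⟩ := exists_enumeration hf.finite_crit hf.injOn
  obtain ⟨s, h0, h1, hl, hr⟩ := exists_interleaving hm fun i =>
    hf.crit_mem (p i) (hp ▸ mem_range_self i)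
  exact ⟨n, ⟨⟨p, hp, s, h0, h1, hl, hr⟩⟩⟩

/-- A period is infinite and embeds in the circle. The angle found is where the circle is cut open,
away from all critical values. -/
theorem exists_circleMap_notMem {A : Set Circle} (hA : A.Finite) : ∃ t, circleMap t ∉ A := by
  by_contra hcon
  push Not at hcon
  have h1 : InjOn circleMap (Ico 0 1) := by
    intro x hx y hy h
    obtain ⟨m, hm⟩ := circleMap_eq_iff.1 h
    have h3 : (m : ℝ) < 1 := by linarith [hx.2, hy.1]
    have h4 : (-1 : ℝ) < m := by linarith [hx.1, hy.2]
    obtain rfl : m = 0 := by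
      have h5 : m < 1 := by exact_mod_cast h3
      have h6 : -1 < m := by exact_mod_cast h4
      omega
    simpa using hm
  exact (Ico_infinite zero_lt_one) (Finite.of_finite_image
    (hA.subset (image_subset_iff.2 fun t _ => hcon t)) h1)

theorem IsCircleTame.exists_subdivision {d : ℕ} {X : Type*} [TopologicalSpace X] [CompactSpace X]
    [ChartedSpace (EuclideanHalfSpace (d + 1)) X] [IsManifold (𝓡∂ (d + 1)) ∞ X]
    {f : X → Circle} (hf : IsCircleTame d f) (hne : (circleCrit d f).Nonempty) :
    ∃ n, Nonempty (CircleSubdivision d f n) := by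
  -- Lifting the values to `[a, a + 1)` puts all critical ones strictly inside, as `a` is not over a
  -- critical value.
  obtain ⟨a, ha⟩ := exists_circleMap_notMem (hf.finite_circleCrit.image f)
  choose g hg hgf using fun x => exists_circleMap_eq a (f x)
  have hinj : InjOn g (circleCrit d f) := fun x hx y hy h =>
    hf.injOn hx hy (by rw [← hgf x, ← hgf y, h])
  obtain ⟨n, p, hp, hm⟩ := exists_enumeration hf.finite_circleCrit hinj
  have hmem : ∀ i, g (p i) ∈ Ioo a (a + 1) := fun i =>
    ⟨lt_of_le_of_ne (hg _).1 fun h => ha ⟨p i, hp ▸ mem_range_self i, by rw [← hgf, ← h]⟩, (hg _).2⟩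
  obtain ⟨s, h0, h1, hl, hr⟩ := exists_interleaving hm hmem
  have hn : 0 < n := by
    obtain ⟨x, hx⟩ := hne
    rw [← hp] at hx
    obtain ⟨i, -⟩ := hx
    exact i.pos
  exact ⟨n, ⟨⟨p, hp, fun i => g (p i), fun i => hgf _, s, by rw [h1 hn, h0], hl, hr⟩⟩⟩

end SectionSpace

end

/-! ### The theorem, assembled for the interval and the circle -/

theorem theorem1p1 :
    (∀ (d : ℕ) (X : Type*) [TopologicalSpace X] [CompactSpace X] [T2Space X]
      [ChartedSpace (EuclideanQuadrant (d + 1)) X] [IsManifold (Corners (d + 1)) ∞ X]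
      (W : BoundaryCobordism d X) (f : X → ℝ), IsTame W f →
      (∃ n, Nonempty (Subdivision W f n)) ∧
      ∀ (n : ℕ) (S : Subdivision W f n),
        Nonempty (S.levels.Retractions f) ∧
        ∀ R : S.levels.Retractions f,
          range S.Pi0 = Levels.limit R ∧
          ∀ Ψ ∈ Levels.limit R, ∀ b : Sec f (Icc 0 1), S.Pi0 (.mk b) = Ψ →
            ∀ R' : S.levels.Retractions f,
              ∃! Θ : MulAction.orbitRel.Quotient (Levels.LoopGroup S.subset b)
                    (Levels.Labels S.subset R' b) ≃ {c // S.Pi0 c = Ψ},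
                ∀ (δ : Sec f (Icc 0 1))
                  (h : ∀ j, Levels.eval S.subset j δ = Levels.eval S.subset j b),
                  (Θ (Quotient.mk _ (Levels.sectionCollapse S.subset R' b δ h))).1 = .mk δ) ∧
    (∀ (d : ℕ) (X : Type*) [TopologicalSpace X] [CompactSpace X] [T2Space X]
      [ChartedSpace (EuclideanHalfSpace (d + 1)) X] [IsManifold (𝓡∂ (d + 1)) ∞ X]
      (f : X → Circle), IsCircleTame d f →
      ((circleCrit d f).Nonempty → ∃ n, Nonempty (CircleSubdivision d f n)) ∧
      ∀ (n : ℕ) (S : CircleSubdivision d f n),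
        Nonempty (S.levels.Retractions (height f)) ∧
        ∀ R : S.levels.Retractions (height f),
          range S.Pi0 = S.limit R ∧
          ∀ Ψ ∈ S.limit R, ∀ b : CircleSec f, S.Pi0 (.mk b) = Ψ →
            ∀ R' : S.levels.Retractions (height f),
              ∃! Θ : MulAction.orbitRel.Quotient (S.cyclicLoops b)
                    (Levels.Labels subset_rfl R' (S.cut b)) ≃ {c // S.Pi0 c = Ψ},
                ∀ (δ : CircleSec f)
                  (h : ∀ j, Levels.eval subset_rfl j (S.cut δ) =
                    Levels.eval subset_rfl j (S.cut b)),
                  (Θ (Quotient.mk _ (Levels.sectionCollapse subset_rfl R' (S.cut b)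
                    (S.cut δ) h))).1 = .mk δ) := by
  refine ⟨fun d X _ _ _ _ _ W f hf => ⟨hf.exists_subdivision, fun n S => ?_⟩,
    fun d X _ _ _ _ _ f hf => ⟨hf.exists_subdivision, fun n S => ?_⟩⟩
  · have hc := S.exists_isCollapsing hf
    have Φ : ∀ i, Nonempty (S.levels.SlabFlow f i) := fun i => by
      obtain ⟨_, _, _, _, h⟩ := hc i
      exact Levels.nonempty_slabFlow_of_isCollapsing h
    have h0 : n = 0 → Nonempty (FibrewiseRetraction f 0 1 1) := by
      rintro rfl
      exact Subdivision.nonempty_fibrewiseRetraction_of_isEmpty hf S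
    refine ⟨⟨fun i => Classical.choice ?_⟩, fun R => ⟨S.range_Pi0_eq Φ hf.mem_Icc h0 R,
      fun Ψ _ b hb R' => S.existsUnique_equiv Φ hf.mem_Icc h0 R' b hb⟩⟩
    obtain ⟨_, _, _, _, h⟩ := hc i
    exact h.nonempty_fibrewiseRetraction
  · have hc := S.exists_isCollapsing hf
    have Φ : ∀ i, Nonempty (S.levels.SlabFlow (height f) i) := fun i => by
      obtain ⟨_, _, _, _, h⟩ := hc i
      exact Levels.nonempty_slabFlow_of_isCollapsing h
    refine ⟨⟨fun i => Classical.choice ?_⟩, fun R => ⟨S.range_Pi0_eq Φ R,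
      fun Ψ _ b hb R' => S.existsUnique_equiv Φ R' b hb⟩⟩
    obtain ⟨_, _, _, _, h⟩ := hc i
    exact h.nonempty_fibrewiseRetraction
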